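/- **Countable branching recurrence validates (generalized) long production.** Let $P,Q,R$ be ($0$-ary general) letters and let $!={\circ\hspace{-0.4em}\mid}^{\,\aleph_0}$ be countable branching recurrence. Then the formula of computability logic $$P\wedge\,!(P\to P\wedge Q)\wedge\,!(R\vee Q\to R)\;\to\;!R$$ is uniformly valid: there is a single hard-play machine that, for every interpretation of the letters $P,Q,R$ by static games, wins the game denoted by the formula, against every behavior of the environment (and for every valuation). Here the notions are the standard ones of computability logic. * The players are $\top$ (machine) and $\bot$ (environment). A move is a string over a fixed finite keyboard alphabet. A run is a finite or infinite sequence of moves labeled by players; a position is a finite run. A constant game consists of a set of legal positions that contains the empty position, is closed under initial segments and contains no position with the special move $\spadesuit$, and of a function assigning a winner to every run such that whoever makes the first illegal move loses. A run is legal if all its finite initial segments are. A game is a function from valuations (of variables by natural numbers) to constant games. * A run $\Delta$ is a $\wp$-delay of $\Gamma$ if, for each player, the subsequences of that player's moves in $\Gamma$ and $\Delta$ coincide and, for all $n,k\ge 1$, whenever the $n$-th move of $\wp$ comes after the $k$-th move of the adversary of $\wp$ in $\Gamma$, it does so in $\Delta$. A game is static if, in each of its instances, a $\wp$-delay of a run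 won by $\wp$ is always won by $\wp$. * $\neg$ interchanges the players. In $A\wedge B$ and $A\vee B$ the two games are played in parallel (moves $0.\alpha$, $1.\alpha$), and $\top$ has to win both, respectively at least one, of them. $A\to B$ is $\neg A\vee B$. * In $!A$, the actual nodes of a position are the empty bit string and all $u0,u1$ such that the position contains the move "$u{:}$"; a leaf is an actual node that is not a proper prefix of another one. The legal moves are the replicative moves "$w{:}$" of $\bot$, with $w$ a leaf, and the moves $w.\alpha$ of either player, with $w$ an actual node and $\alpha$ legal for that player in the position $\Phi^{\preceq v}$ of $A$ for every infinite bit string $v$ extending $w$. Here $\Phi$ is the current position and $\Theta^{\preceq v}$ consists of the moves of $\Theta$ of the form $u.\beta$ with $u$ an initial segment of $v$, the prefix "$u.$" being deleted. A legal run $\Gamma$ of $!A$ is won by $\top$ iff $\Gamma^{\preceq v}$ is a $\top$-won run of $A$ for every infinite bit string $v$ with only finitely many $1$s. * A hard-play machine is an interactive algorithm that always sees the current position (and the valuation) and can make moves at any time; the environment can make any finite number of moves in each step of the machine. The machine wins a game if, for every valuation and every behavior of the environment, the resulting run of the corresponding instance is won by $\top$. -/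

import Mathlib

namespace CoL

/-! ### Moves, positions, runs -/

/-- The two players: `true` is the machine `⊤`, `false` is the environment `⊥`;
`!p` is the adversary of `p`. -/
abbrev Player := Bool

/-- The machine `⊤`. -/
abbrev machine : Player := true

/-- The environment `⊥`. -/
abbrev environment : Player := false

/-- The (finite) keyboard alphabet, given by ASCII codes. -/
abbrev Sym := Fin 128

/-- A move is a finite string over the keyboard alphabet. -/
abbrev Move := List Sym

/-- The symbol `.` -/
def dot : Sym := 46

/-- The symbol `:` -/
def colon : Sym := 58

/-- The symbols `0` and `1`. -/
def bitSym (b : Bool) : Sym := if b then 49 else 48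

/-- A bit string, written as a string over the keyboard alphabet. -/
def bits (w : List Bool) : Move := w.map bitSym

/-- The distinguished one-symbol move that is never legal in any game. -/
def spade : Move := [127]

/-- A labeled move: a move together with the player who makes it. -/
abbrev LabMove := Player × Move

/-- A position is a finite sequence of labeled moves. -/
abbrev Position := List LabMove

/-- A run is a finite or infinite sequence of labeled moves. It is represented by the set of
its finite initial segments; such a set is precisely a nonempty set of positions that is
closed under initial segments and linearly ordered by the initial segment relation. -/
@[ext]
structure Run where
  /-- the finite initial segments of the run -/
  segs : Set Position
  nil_mem : [] ∈ segs
  closed : ∀ Φ ∈ segs, ∀ Ψ : Position, Ψ <+: Φ → Ψ ∈ segs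
  chain : ∀ Φ ∈ segs, ∀ Ψ ∈ segs, Φ <+: Ψ ∨ Ψ <+: Φ

/-- Apply the partial map `f` to each labeled move of a run, deleting the labeled moves on which
`f` is undefined. -/
def Run.filterMap (f : LabMove → Option LabMove) (Γ : Run) : Run where
  segs := (fun Φ => Φ.filterMap f) '' Γ.segs
  nil_mem := ⟨[], Γ.nil_mem, rfl⟩
  closed := by
    rintro _ ⟨Φ, hΦ, rfl⟩ Ψ hΨ
    obtain ⟨Φ', h, rfl⟩ := List.prefix_filterMap_iff.1 hΨ
    exact ⟨Φ', Γ.closed Φ hΦ Φ' h, rfl⟩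
  chain := by
    rintro _ ⟨Φ, hΦ, rfl⟩ _ ⟨Ψ, hΨ, rfl⟩
    exact (Γ.chain Φ hΦ Ψ hΨ).imp (fun h => h.filterMap f) (fun h => h.filterMap f)

/-- The labeled move with its label reversed. -/
def flipLab (x : LabMove) : LabMove := (!x.1, x.2)

/-- The position with all labels reversed. -/
def negPos (Φ : Position) : Position := Φ.map flipLab

/-- The run with all labels reversed. -/
def Run.neg (Γ : Run) : Run := Γ.filterMap (fun x => some (flipLab x))

/-- The subsequence of the labeled moves of `Γ` that are made by `p`. -/
def Run.movesOf (p : Player) (Γ : Run) : Run :=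
  Γ.filterMap (fun x => if x.1 = p then some x else none)

/-- In `Γ` there is an `n`-th move of `p`, and it comes after the `k`-th move of the adversary of
`p` (counting from one). -/
def Run.Later (Γ : Run) (p : Player) (n k : ℕ) : Prop :=
  ∃ (Φ : Position) (α : Move), Φ ++ [(p, α)] ∈ Γ.segs ∧
    Φ.countP (fun x => x.1 == p) + 1 = n ∧ k ≤ Φ.countP (fun x => x.1 == !p)

/-- `Δ` is a `p`-delay of `Γ`. -/
def IsDelay (p : Player) (Δ Γ : Run) : Prop :=
  (∀ p' : Player, Δ.movesOf p' = Γ.movesOf p') ∧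
    ∀ n k : ℕ, 1 ≤ n → 1 ≤ k → Γ.Later p n k → Δ.Later p n k

/-! ### Constant games -/

/-- All finite initial segments of `Γ` are in `L`. -/
def LegalRun (L : Set Position) (Γ : Run) : Prop := ∀ Φ ∈ Γ.segs, Φ ∈ L

/-- The run `Γ` is illegal with respect to the set `L` of legal positions, and the last move of its
shortest illegal initial segment is made by `p`. -/
def IllegalBy (L : Set Position) (p : Player) (Γ : Run) : Prop :=
  ∃ (Φ : Position) (α : Move), Φ ++ [(p, α)] ∈ Γ.segs ∧ Φ ∈ L ∧ Φ ++ [(p, α)] ∉ L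

/-- A constant game: the set of legal positions (a run, finite or infinite, is legal iff all its
finite initial segments are) and the function that tells the winner of each run. The player who
makes the first illegal move loses. -/
structure ConstGame where
  legal : Set Position
  winner : Run → Player
  nil_legal : [] ∈ legal
  closed : ∀ Φ ∈ legal, ∀ Ψ : Position, Ψ <+: Φ → Ψ ∈ legal
  spade_illegal : ∀ Φ ∈ legal, ∀ x ∈ Φ, x.2 ≠ spade
  winner_illegal : ∀ (p : Player) (Γ : Run), IllegalBy legal p Γ → winner Γ ≠ p

/-- A constant game is static iff a player who wins a run also wins all of its delays by that
player. -/
def ConstGame.Static (A : ConstGame) : Prop :=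
  ∀ (p : Player) (Γ Δ : Run), IsDelay p Δ Γ → A.winner Γ = p → A.winner Δ = p

theorem IllegalBy.not_legalRun {L : Set Position} {p : Player} {Γ : Run}
    (h : IllegalBy L p Γ) : ¬ LegalRun L Γ := by
  obtain ⟨Φ, α, h1, _, h3⟩ := h
  exact fun hl => h3 (hl _ h1)

theorem IllegalBy.unique {L : Set Position} (hL : ∀ Φ ∈ L, ∀ Ψ : Position, Ψ <+: Φ → Ψ ∈ L)
    {p q : Player} {Γ : Run} (hp : IllegalBy L p Γ) (hq : IllegalBy L q Γ) : p = q := by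
  obtain ⟨Φ, α, h1, h2, h3⟩ := hp
  obtain ⟨Ψ, β, k1, k2, k3⟩ := hq
  have key : ∀ {X Y : Position} {x y : LabMove}, X ++ [x] <+: Y ++ [y] → Y ∈ L → X ++ [x] ∉ L →
      X ++ [x] = Y ++ [y] := by
    intro X Y x y h hY hX
    rcases List.prefix_concat_iff.1 h with h | h
    · exact h
    · exact absurd (hL _ hY _ h) hX
  rcases Γ.chain _ h1 _ k1 with h | h
  · have := key h k2 h3
    simpa using congrArg (fun l => l.map Prod.fst) (List.append_inj' this rfl).2
  · have := key h h2 k3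
    simpa using congrArg (fun l => l.map Prod.fst) (List.append_inj' this rfl).2.symm

open Classical in
/-- The winner function that gives a legal run to the machine iff `W` holds of it, and decides
against the author of the first illegal move on illegal runs. -/
noncomputable def stdWinner (L : Set Position) (W : Run → Prop) (Γ : Run) : Player :=
  if LegalRun L Γ then (if W Γ then machine else environment)
  else if IllegalBy L environment Γ then machine else environment

theorem stdWinner_illegal {L : Set Position}
    (hL : ∀ Φ ∈ L, ∀ Ψ : Position, Ψ <+: Φ → Ψ ∈ L) (W : Run → Prop) (p : Player) (Γ : Run)
    (h : IllegalBy L p Γ) : stdWinner L W Γ ≠ p := by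
  have h0 := h.not_legalRun
  cases p with
  | false => simp [stdWinner, h0, h]
  | true =>
    have : ¬ IllegalBy L environment Γ := fun h' => by
      have := IllegalBy.unique hL h h'
      simp at this
    simp [stdWinner, h0, this]

/-! ### Negation -/

/-- `¬A`: the roles of the players are interchanged. -/
def ConstGame.neg (A : ConstGame) : ConstGame where
  legal := {Φ | negPos Φ ∈ A.legal}
  winner Γ := !(A.winner Γ.neg)
  nil_legal := A.nil_legal
  closed Φ hΦ Ψ h := A.closed _ hΦ _ (h.map flipLab)
  spade_illegal Φ hΦ x hx := A.spade_illegal _ hΦ (flipLab x) (List.mem_map_of_mem hx)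
  winner_illegal := by
    rintro p Γ ⟨Φ, α, h1, h2, h3⟩ hw
    refine A.winner_illegal (!p) Γ.neg ⟨negPos Φ, α, ⟨_, h1, ?_⟩, h2, ?_⟩ ?_
    · simp [negPos, flipLab]
    · simpa [negPos, flipLab] using h3
    · rw [← hw]; simp

/-! ### Parallel conjunction and disjunction -/

/-- If the move is `b.α` (with `b` one of the symbols `0`, `1`), return `α`. -/
def compMove (b : Bool) : Move → Option Move
  | c :: d :: α => if c = bitSym b ∧ d = dot then some α else none
  | _ => none

/-- Keep a labeled move if it is made in the component `b`, and delete the prefix `b.` from it. -/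
def compLab (b : Bool) (x : LabMove) : Option LabMove := (compMove b x.2).map (fun α => (x.1, α))

/-- Legal positions of both `A ∧ B` and `A ∨ B`: every move is `0.α` or `1.α`, and the positions
of the two components are legal. -/
def parLegal (A B : ConstGame) : Set Position :=
  {Φ | (∀ x ∈ Φ, ∃ (b : Bool) (α : Move), x.2 = bitSym b :: dot :: α) ∧
    Φ.filterMap (compLab false) ∈ A.legal ∧ Φ.filterMap (compLab true) ∈ B.legal}

theorem parLegal_closed (A B : ConstGame) :
    ∀ Φ ∈ parLegal A B, ∀ Ψ : Position, Ψ <+: Φ → Ψ ∈ parLegal A B :=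
  fun _ hΦ _ h => ⟨fun x hx => hΦ.1 x (h.subset hx), A.closed _ hΦ.2.1 _ (h.filterMap _),
    B.closed _ hΦ.2.2 _ (h.filterMap _)⟩

/-- The game with the legal positions of a parallel combination of `A` and `B` whose legal runs are
won by the machine iff `W` holds. -/
noncomputable def ConstGame.par (A B : ConstGame) (W : Run → Prop) : ConstGame where
  legal := parLegal A B
  winner := stdWinner (parLegal A B) W
  nil_legal := ⟨by simp, A.nil_legal, B.nil_legal⟩
  closed := parLegal_closed A B
  spade_illegal Φ hΦ x hx := by
    obtain ⟨b, α, h⟩ := hΦ.1 x hx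
    simp [h, spade]
  winner_illegal := stdWinner_illegal (parLegal_closed A B) W

/-- `A ∧ B`: the machine has to win both components. -/
noncomputable def ConstGame.and (A B : ConstGame) : ConstGame :=
  A.par B (fun Γ => A.winner (Γ.filterMap (compLab false)) = machine ∧
    B.winner (Γ.filterMap (compLab true)) = machine)

/-- `A ∨ B`: the machine has to win at least one component. -/
noncomputable def ConstGame.or (A B : ConstGame) : ConstGame :=
  A.par B (fun Γ => A.winner (Γ.filterMap (compLab false)) = machine ∨
    B.winner (Γ.filterMap (compLab true)) = machine)

/-! ### Countable branching recurrence -/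

/-- The finite bit string `w` is an initial segment of the infinite bit string `v`. -/
def InitSeg (w : List Bool) (v : ℕ → Bool) : Prop := ∀ (i : ℕ) (h : i < w.length), w[i] = v i

/-- An infinite bit string is essentially finite iff it contains only finitely many `1`s. -/
def EssFinite (v : ℕ → Bool) : Prop := {i | v i = true}.Finite

/-- If the move is `u.β` for an initial segment `u` of the infinite bit string `v`,
return `β`. -/
def threadMove : (ℕ → Bool) → Move → Option Move
  | _, [] => none
  | v, c :: m =>
    if c = dot then some m
    else if c = bitSym (v 0) then threadMove (fun i => v (i + 1)) m else none

theorem threadMove_eq_some_iff (v : ℕ → Bool) (m β : Move) :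
    threadMove v m = some β ↔ ∃ u : List Bool, InitSeg u v ∧ m = bits u ++ dot :: β := by
  have hb : ∀ b, bitSym b ≠ dot := by decide
  have hi : ∀ b b', bitSym b = bitSym b' → b = b' := by decide
  induction m generalizing v with
  | nil => simp [threadMove]
  | cons c m ih =>
    rw [threadMove]
    split_ifs with h1 h2
    · subst h1
      constructor
      · intro h
        exact ⟨[], fun i h => by simp at h, by simpa [bits] using h⟩
      · rintro ⟨u, hu, h⟩
        cases u with
        | nil => simpa [bits] using h
        | cons b u => simp [bits] at h; exact absurd h.1.symm (hb b)
    · refine (ih (fun i => v (i + 1))).trans ?_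
      constructor
      · rintro ⟨u, hu, rfl⟩
        refine ⟨v 0 :: u, ?_, by simp [bits, h2]⟩
        intro i hi
        cases i with
        | zero => rfl
        | succ i => exact hu i (by simpa using hi)
      · rintro ⟨u, hu, h⟩
        cases u with
        | nil => simp [bits] at h; exact absurd h.1 h1
        | cons b u =>
          simp only [bits, List.map_cons, List.cons_append, List.cons.injEq] at h
          exact ⟨u, fun i hi => hu (i + 1) (by simpa using hi), h.2⟩
    · simp only [false_iff, not_exists, not_and]
      intro u hu h
      cases u with
      | nil => simp [bits] at h; exact h1 h.1
      | cons b u =>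
        simp only [bits, List.map_cons, List.cons_append, List.cons.injEq] at h
        have := hu 0 (by simp)
        simp only [List.getElem_cons_zero] at this
        exact h2 (this ▸ h.1)

/-- Keep a labeled move if it is `u.β` for an initial segment `u` of `v`, and delete the prefix
`u.` from it. -/
def threadLab (v : ℕ → Bool) (x : LabMove) : Option LabMove :=
  (threadMove v x.2).map (fun β => (x.1, β))

/-- The bit string `w` is an actual node of the position `Φ`. -/
def ActualNode (Φ : Position) (w : List Bool) : Prop :=
  w = [] ∨ ∃ (u : List Bool) (b : Bool), w = u ++ [b] ∧
    ∃ p : Player, (p, bits u ++ [colon]) ∈ Φ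

/-- The bit string `w` is a leaf of the position `Φ`. -/
def Leaf (Φ : Position) (w : List Bool) : Prop :=
  ActualNode Φ w ∧ ∀ w' : List Bool, ActualNode Φ w' → w <+: w' → w' = w

/-- The labeled move `x` may be made in the position `Φ` of the branching recurrence of `A`: either
it is a replicative move `w:` of the environment for a leaf `w`, or it is a non-replicative move
`w.α` for an actual node `w`, with `α` legal for the same player in all threads through `w`. -/
def BranchMove (A : ConstGame) (Φ : Position) (x : LabMove) : Prop :=
  (x.1 = environment ∧ ∃ w : List Bool, Leaf Φ w ∧ x.2 = bits w ++ [colon]) ∨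
  ∃ (w : List Bool) (α : Move), ActualNode Φ w ∧ x.2 = bits w ++ dot :: α ∧
    ∀ v : ℕ → Bool, InitSeg w v → Φ.filterMap (threadLab v) ++ [(x.1, α)] ∈ A.legal

/-- Legal positions of the branching recurrence of `A`. -/
def branchLegal (A : ConstGame) : Set Position :=
  {Φ | ∀ (Ψ : Position) (x : LabMove), Ψ ++ [x] <+: Φ → BranchMove A Ψ x}

theorem branchLegal_closed (A : ConstGame) :
    ∀ Φ ∈ branchLegal A, ∀ Ψ : Position, Ψ <+: Φ → Ψ ∈ branchLegal A :=
  fun _ hΦ _ h Θ x hx => hΦ Θ x (hx.trans h)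

/-- The countable branching recurrence of `A`: in order to win a legal run, the machine has to win
`A` in all essentially finite threads. -/
noncomputable def ConstGame.cbr (A : ConstGame) : ConstGame where
  legal := branchLegal A
  winner := stdWinner (branchLegal A)
    (fun Γ => ∀ v : ℕ → Bool, EssFinite v → A.winner (Γ.filterMap (threadLab v)) = machine)
  nil_legal := fun Ψ x h => by simp at h
  closed := branchLegal_closed A
  spade_illegal Φ hΦ x hx := by
    have hb : ∀ b, bitSym b ≠ 127 := by decide
    obtain ⟨s, t, rfl⟩ := List.append_of_mem hx
    have := hΦ s x ⟨t, by simp⟩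
    rcases this with ⟨_, w, _, h⟩ | ⟨w, α, _, h, _⟩ <;> rw [h] <;>
      cases w <;> simp [bits, spade, hb, dot, colon]
  winner_illegal := stdWinner_illegal (branchLegal_closed A) _

/-! ### Games, formulas, interpretations -/

/-- A valuation assigns a constant (a natural number) to each variable. -/
abbrev Valuation := ℕ → ℕ

/-- A (not necessarily constant) game is a function from valuations to constant games. -/
abbrev Game := Valuation → ConstGame

/-- A game is static iff all of its instances are. -/
def Game.Static (G : Game) : Prop := ∀ e : Valuation, (G e).Static

/-- Formulas built from (`0`-ary general) letters by negation, parallel conjunction, parallel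
disjunction and countable branching recurrence `!`. -/
inductive Formula where
  | letter (n : ℕ)
  | neg (F : Formula)
  | and (F G : Formula)
  | or (F G : Formula)
  | bang (F : Formula)

/-- `F → G` abbreviates `¬F ∨ G`. -/
def Formula.imp (F G : Formula) : Formula := .or (.neg F) G

/-- An interpretation assigns a static game to each letter. -/
structure Interpretation where
  game : ℕ → Game
  static : ∀ n, (game n).Static

/-- The game denoted by a formula under an interpretation. -/
noncomputable def Formula.interp (I : Interpretation) : Formula → Game
  | .letter n => I.game n
  | .neg F => fun e => (F.interp I e).neg
  | .and F G => fun e => (F.interp I e).and (G.interp I e)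
  | .or F G => fun e => (F.interp I e).or (G.interp I e)
  | .bang F => fun e => (F.interp I e).cbr

/-! ### Hard-play machines -/

/-- A hard-play machine, presented by its (effective) work cycle. The machine has an internal
memory, a read-only valuation tape and a read-only run tape that always spells the current
position. In each cycle it reads the memory, an initial piece of the valuation tape and the run
tape, computes from this a new content of the memory, and possibly makes one move. While it is
computing, the environment goes on moving, see `HPM.config`. -/
structure HPM where
  /-- contents of the memory -/
  Mem : Type
  [primcodable : Primcodable Mem]
  init : Mem
  step : Mem × List ℕ × Position → Mem × Option Move
  computable : Computable step

/-- The behavior of an environment: in each cycle of the machine it makes an arbitrary finite number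
of moves before the move of the machine (if there is one) gets to the run tape, and an arbitrary
finite number of moves after that. -/
structure EnvBehavior where
  before : ℕ → List Move
  after : ℕ → List Move

/-- The moves in a list, all labeled by the player `p`. -/
def label (p : Player) (l : List Move) : Position := l.map (fun α => (p, α))

/-- Memory and run tape at the beginning of the `n`-th cycle. In the `n`-th cycle the machine has
access to the first `n` entries of the valuation tape. -/
def HPM.config (H : HPM) (e : Valuation) (E : EnvBehavior) : ℕ → H.Mem × Position
  | 0 => (H.init, [])
  | n + 1 =>
    let c := H.config e E n
    let r := H.step (c.1, (List.range n).map e, c.2)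
    (r.1, c.2 ++ label environment (E.before n) ++ label machine r.2.toList ++
      label environment (E.after n))

theorem HPM.config_mono (H : HPM) (e : Valuation) (E : EnvBehavior) {m n : ℕ} (h : m ≤ n) :
    (H.config e E m).2 <+: (H.config e E n).2 := by
  induction n, h using Nat.le_induction with
  | base => exact List.prefix_rfl
  | succ n _ ih =>
    refine ih.trans ?_
    simp only [HPM.config, List.append_assoc]
    exact List.prefix_append _ _

/-- The run that is spelled on the run tape in the limit. -/
def HPM.run (H : HPM) (e : Valuation) (E : EnvBehavior) : Run where
  segs := {Φ | ∃ n, Φ <+: (H.config e E n).2}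
  nil_mem := ⟨0, List.nil_prefix⟩
  closed := fun _ ⟨n, hn⟩ _ h => ⟨n, h.trans hn⟩
  chain := by
    rintro Φ ⟨m, hm⟩ Ψ ⟨n, hn⟩
    rcases le_total m n with h | h
    · exact List.prefix_or_prefix_of_prefix (hm.trans (H.config_mono e E h)) hn
    · exact List.prefix_or_prefix_of_prefix hm (hn.trans (H.config_mono e E h))

/-- The machine wins the game: whatever the valuation and the behavior of the environment are, the
resulting run of the corresponding instance of the game is won by `⊤`. -/
def HPM.Wins (H : HPM) (G : Game) : Prop :=
  ∀ (e : Valuation) (E : EnvBehavior), (G e).winner (H.run e E) = machine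

/-- A formula is uniformly valid iff one and the same machine wins it under all
interpretations. -/
def UniformlyValid (F : Formula) : Prop :=
  ∃ H : HPM, ∀ I : Interpretation, H.Wins (F.interp I)

/-- The generalized long production principle `P ∧ !(P → P ∧ Q) ∧ !(R ∨ Q → R) → !R`. -/
def longProduction (P Q R : Formula) : Formula :=
  .imp (.and P (.and (.bang (.imp P (.and P Q))) (.bang (.imp (.or R Q) R)))) (.bang R)

end CoL

namespace CoL

/-! ### Strings and addresses -/

/-! The machine wins by copying moves between matched plays of the same letter. It plays the
antecedent with the roles reversed, so it may split the two recurrent resources as it likes, while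
the environment splits the goal `!R`. Along the all-zero branch of each resource the machine creates
infinitely many copies, the `n`-th one rooted at `comb n`, that is 0ⁿ1.

In the left resource the antecedent P of copy 0 is matched with the given P, and that of copy n+1
with the consequent P of copy n. So all copies are fed, and each one delivers a Q.

In the right resource copy number `encode s` is reserved for the goal node s, and the tree of the
goal below s is rebuilt below its root (`loc`). The consequent R of the copy for the empty string is
matched with the goal, thread by thread. In the copy for s the antecedent R ∨ Q is served according
to the thread: the all-zero thread gets the Q of the left copy `encode s`; a thread 0ᵏ1v gets the R
that the copy for s0ᵏ1 produces in its thread v. Each such step uses up a 1, so an essentially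
finite thread ends at a Q after finitely many steps. If s0ᵏ1 never becomes an actual node of the
goal, the thread 0ᵏ1v of that copy cannot be told from the all-zero one, and the Q serves it as well
(`ext_eq_zeroStr`). This induction is `won_goal`.

Copies arrive late, so a matched play is only a delay of its original; this is where staticness
enters. It carries victories over (`isDelay_of_copies`, `Live.isDelay`), and it implies that a
player who only copies never makes the first illegal move (`ConstGame.Static.legal_of_copies`).

The machine works in rounds. At the start of a round it takes a snapshot of the position and queues
tasks, which it then carries out one per cycle while the environment goes on moving. `Snap` and
`Mid` are the invariants of this process, `Mid.legal_move` and `good_or_illegal` show that only the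
environment can violate the rules, and `Live.catch_up` shows that no move stays uncopied between
threads that remain linked. -/

/-- Delete the prefix `p` from the string `m`. -/
def strip (p m : Move) : Option Move :=
  if m.take p.length = p then some (m.drop p.length) else none

/-- The string that consists of `n` zeros. -/
def zeros (n : ℕ) : List Bool := (List.range n).map fun _ => false

/-- The root of the `n`-th copy of a replicated resource. -/
def comb (n : ℕ) : List Bool := zeros n ++ [true]

/-- The node `u` of the copy that is reserved for the node `s` of the goal. -/
def loc (s u : List Bool) : List Bool := comb (Encodable.encode s) ++ u

/-- All ways of cutting a string in two. -/
def splits (w : List Bool) : List (List Bool × List Bool) :=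
  (List.range (w.length + 1)).map fun i => (w.take i, w.drop i)

/-- The places where the letters of the long production formula are played. -/
inductive Slot where
  | given | anteP | consP | consQ | anteR | anteQ | consR | goal

/-- The string that precedes the node in the moves made at a slot. -/
def Slot.pre : Slot → Move
  -- The given P is treated as a tree that has only its root: the dot that `full` puts after the
  -- empty node completes the prefix `0.0.`.
  | given => [48, 46, 48]
  | anteP | consP | consQ => [48, 46, 49, 46, 48, 46]
  | anteR | anteQ | consR => [48, 46, 49, 46, 49, 46]
  | goal => [49, 46]

/-- The string that follows the node in the moves made at a slot. -/
def Slot.suf : Slot → Move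
  | given | goal => []
  | anteP => [48, 46]
  | consP => [49, 46, 48, 46]
  | consQ => [49, 46, 49, 46]
  | anteR => [48, 46, 48, 46]
  | anteQ => [48, 46, 49, 46]
  | consR => [49, 46]

/-- A node of a tree, with the strings that precede and follow it in moves. -/
abbrev Place := Move × List Bool × Move

/-- The place of the node `x` at the slot `σ`. -/
abbrev Slot.place (σ : Slot) (x : List Bool) : Place := (σ.pre, x, σ.suf)

/-- The prefix of the moves made at a place. -/
def full (A : Place) : Move := A.1 ++ (bits A.2.1 ++ dot :: A.2.2)

/-- The prefixes of the moves that affect a place. -/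
def pats (A : Place) : List Move :=
  (List.range (A.2.1.length + 1)).map fun i => full (A.1, A.2.1.take i, A.2.2)

/-- The moves of `p` that start with one of the patterns in `l`, with the pattern deleted. -/
def hits (p : Player) (Φ : Position) (l : List Move) : List Move :=
  Φ.filterMap fun x => if x.1 = p then (l.filterMap fun t => strip t x.2).head? else none

/-! ### The machine -/

/-- A task consists of a move, a list of patterns and a number. It is to make the move provided that
the number of moves made so far that match a pattern is the given one. -/
abbrev Task := Move × List Move × ℕ

/-- The task to make a replicative move. -/
def repTask (a : Move) (x : List Bool) : Task :=
  (a ++ (bits x ++ [colon]), [a ++ (bits x ++ [colon])], 0)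

/-- The task to copy the next move of the environment from `A` to `B`. -/
def push (Φ : Position) (A B : Place) : List Task :=
  ((hits environment Φ (pats A))[(hits machine Φ (pats B)).length]?).toList.map
    fun α => (full B ++ α, pats B, (hits machine Φ (pats B)).length)

/-- The bits in a string. -/
def bitsOf (m : Move) : List Bool :=
  m.filterMap fun c => if c = 48 then some false else if c = 49 then some true else none

/-- The node that is replicated in the goal by a move. -/
def repNode (m : Move) : Option (List Bool) :=
  -- The goal prefix `1.` itself contributes a leading bit, which `tail` removes. The candidate is
  -- accepted only if it spells the given move.
  if m = Slot.goal.pre ++ (bits (bitsOf m).tail ++ [colon]) then some (bitsOf m).tail else none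

/-- The leaves of the goal. -/
def leaves (Φ : Position) : List (List Bool) :=
  ([] :: Φ.flatMap fun x => (repNode x.2).toList.flatMap fun u =>
    [u ++ [false], u ++ [true]]).filterMap fun w =>
      -- An actual node is a leaf when no move replicates it. Counting such moves keeps the test
      -- primitive recursive.
      if (Φ.filterMap fun x =>
        if x.2 = Slot.goal.pre ++ (bits w ++ [colon]) then some x else none).length = 0 then
          some w else none

/-- The pairs of places where the same letter is played and that are to be kept equal by
copying moves. -/
def pairs (n : ℕ) (Φ : Position) : List (Place × Place) :=
  (Slot.anteP.place (comb 0), Slot.given.place []) ::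
    (((List.range n).map fun i => (Slot.anteP.place (comb (i + 1)), Slot.consP.place (comb i))) ++
    (leaves Φ).flatMap fun w => (Slot.goal.place w, Slot.consR.place (loc [] w)) ::
      (splits w).flatMap fun d => if Encodable.encode d.1 ≤ n then
        (if d.2 = zeros d.2.length then
          [(Slot.anteQ.place (loc d.1 d.2), Slot.consQ.place (comb (Encodable.encode d.1)))]
          else []) ++
        (splits d.2).flatMap fun z =>
          -- A comb word `comb k` has length k+1, so this tests whether `z.1` is a comb word; the
          -- empty string fails. The middle condition is `OneEnded d.1`.
          if z.1 = comb (z.1.length - 1) ∧ ¬ d.1.reverse.head? = some false ∧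
              Encodable.encode (d.1 ++ z.1) ≤ n then
            [(Slot.anteR.place (loc d.1 d.2), Slot.consR.place (loc (d.1 ++ z.1) z.2))] else []
        else [])

/-- The tasks to replicate in the copies the nodes that are replicated in the goal. -/
def repTasks (n : ℕ) (Φ : Position) : List Task :=
  Φ.flatMap fun x => (repNode x.2).toList.flatMap fun w => (splits w).flatMap fun d =>
    if Encodable.encode d.1 ≤ n then [repTask Slot.consR.pre (loc d.1 d.2)] else []

/-- The tasks to copy moves. -/
def pushTasks (n : ℕ) (Φ : Position) : List Task :=
  (pairs n Φ).flatMap fun c => push Φ c.1 c.2 ++ push Φ c.2 c.1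

/-- All tasks that are computed from the position `Φ` in the `n`-th round. -/
def sync (n : ℕ) (Φ : Position) : List Task :=
  -- The order matters: the new copy of each resource comes first, then the nodes inside the copies,
  -- and only then the moves to be made at these nodes. Round n uses only copies with number at most
  -- n, which exist by then.
  repTask Slot.consP.pre (zeros n) :: repTask Slot.consR.pre (zeros n) ::
    (repTasks n Φ ++ pushTasks n Φ)

/-- The move, if any, by which a task is carried out in the position `Φ`. -/
def exec (Φ : Position) (t : Task) : Option Move :=
  if (hits machine Φ t.2.1).length = t.2.2 then some t.1 else none

/-- The work cycle of the machine. -/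
def cycle (x : (ℕ × List Task) × List ℕ × Position) : (ℕ × List Task) × Option Move :=
  -- An empty queue opens a new round: the tasks are computed from the current position and no move
  -- is made. Otherwise the first task is tested against the current position and removed, whether
  -- or not it leads to a move.
  x.1.2.casesOn ((x.1.1 + 1, sync x.1.1 x.2.2), none)
    fun t q => ((x.1.1, q), exec x.2.2 t)

/-! ### Computability of the work cycle -/

section Computability

open Primrec

variable {α : Type*} [Primcodable α]

theorem primrec_strip {f g : α → Move} (hf : Primrec f) (hg : Primrec g) :
    Primrec fun a => strip (f a) (g a) :=
  Primrec.ite (Primrec.eq.comp (list_take.comp (list_length.comp hf) hg) hf)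
    (option_some.comp (list_drop.comp (list_length.comp hf) hg)) (.const none)

theorem primrec_zeros {f : α → ℕ} (hf : Primrec f) : Primrec fun a => zeros (f a) :=
  list_map (list_range.comp hf) (Primrec.const false).to₂

theorem primrec_comb {f : α → ℕ} (hf : Primrec f) : Primrec fun a => comb (f a) :=
  list_append.comp (primrec_zeros hf) (.const _)

theorem primrec_loc {f g : α → List Bool} (hf : Primrec f) (hg : Primrec g) :
    Primrec fun a => loc (f a) (g a) :=
  list_append.comp (primrec_comb (Primrec.encode.comp hf)) hg

theorem primrec_bits {f : α → List Bool} (hf : Primrec f) : Primrec fun a => bits (f a) :=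
  list_map hf ((dom_finite bitSym).comp snd).to₂

theorem primrec_splits {f : α → List Bool} (hf : Primrec f) : Primrec fun a => splits (f a) :=
  list_map (list_range.comp (Primrec.succ.comp (list_length.comp hf)))
    ((list_take.comp snd (hf.comp fst)).pair (list_drop.comp snd (hf.comp fst))).to₂

theorem primrec_full {f : α → Place} (hf : Primrec f) : Primrec fun a => full (f a) :=
  list_append.comp (fst.comp hf) (list_append.comp (primrec_bits (fst.comp (snd.comp hf)))
    (list_cons.comp (.const _) (snd.comp (snd.comp hf))))

theorem primrec_pats {f : α → Place} (hf : Primrec f) : Primrec fun a => pats (f a) :=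
  list_map (list_range.comp (Primrec.succ.comp (list_length.comp (fst.comp (snd.comp hf)))))
    (primrec_full ((fst.comp (hf.comp fst)).pair
      ((list_take.comp snd (fst.comp (snd.comp (hf.comp fst)))).pair
        (snd.comp (snd.comp (hf.comp fst)))))).to₂

theorem primrec_hits {p : Player} {f : α → Position} {g : α → List Move} (hf : Primrec f)
    (hg : Primrec g) : Primrec fun a => hits p (f a) (g a) :=
  listFilterMap hf (Primrec.ite (Primrec.eq.comp (fst.comp snd) (.const p))
    (list_head?.comp (listFilterMap (hg.comp fst)
      (primrec_strip snd (snd.comp (snd.comp fst))).to₂)) (.const none)).to₂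

theorem primrec_repTask {a : Move} {f : α → List Bool} (hf : Primrec f) :
    Primrec fun x => repTask a (f x) := by
  have h : Primrec fun x => a ++ (bits (f x) ++ [colon]) :=
    list_append.comp (.const a) (list_append.comp (primrec_bits hf) (.const _))
  exact h.pair ((list_cons.comp h (.const [])).pair (.const 0))

theorem primrec_option_toList {β : Type*} [Primcodable β] {f : α → Option β} (hf : Primrec f) :
    Primrec fun a => (f a).toList :=
  (option_casesOn hf (.const []) (list_cons.comp snd (.const [])).to₂).of_eq fun a => by
    cases f a <;> rfl

theorem primrec_push {f : α → Position} {g h : α → Place} (hf : Primrec f) (hg : Primrec g)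
    (hh : Primrec h) : Primrec fun a => push (f a) (g a) (h a) := by
  have hl : Primrec fun a => (hits machine (f a) (pats (h a))).length :=
    list_length.comp (primrec_hits hf (primrec_pats hh))
  exact list_map (primrec_option_toList (list_getElem?.comp (primrec_hits hf (primrec_pats hg)) hl))
    ((list_append.comp (primrec_full (hh.comp fst)) snd).pair
      ((primrec_pats (hh.comp fst)).pair (hl.comp fst))).to₂

theorem primrec_repNode {f : α → Move} (hf : Primrec f) : Primrec fun a => repNode (f a) := by
  have hb : Primrec fun a => (bitsOf (f a)).tail :=
    list_tail.comp (listFilterMap hf (((dom_finite fun c : Sym => if c = 48 then some false else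
      if c = 49 then some true else none)).comp snd).to₂)
  exact Primrec.ite (Primrec.eq.comp hf (list_append.comp (.const _)
    (list_append.comp (primrec_bits hb) (.const _)))) (option_some.comp hb) (.const none)

theorem primrec_leaves {f : α → Position} (hf : Primrec f) : Primrec fun a => leaves (f a) := by
  have h : Primrec fun x : (α × List Bool) × LabMove =>
      Slot.goal.pre ++ (bits x.1.2 ++ [colon]) :=
    list_append.comp (.const _) (list_append.comp (primrec_bits (snd.comp fst)) (.const _))
  refine listFilterMap (list_cons.comp (.const []) (list_flatMap hf (list_flatMap
    (primrec_option_toList (primrec_repNode (snd.comp snd)))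
    (list_cons.comp (list_append.comp snd (.const _)) (list_cons.comp
      (list_append.comp snd (.const _)) (.const []))).to₂).to₂)) (Primrec.ite (Primrec.eq.comp (list_length.comp
      (listFilterMap (hf.comp fst) (Primrec.ite (Primrec.eq.comp (snd.comp snd) h)
        (option_some.comp snd) (.const none)).to₂)) (.const 0))
      (option_some.comp snd) (.const none)).to₂

theorem primrec_place {σ : Slot} {f : α → List Bool} (hf : Primrec f) :
    Primrec fun a => σ.place (f a) :=
  (Primrec.const _).pair (hf.pair (.const _))

theorem primrec_pairs {f : α → ℕ} {g : α → Position} (hf : Primrec f) (hg : Primrec g) :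
    Primrec fun a => pairs (f a) (g a) := by
  refine list_cons.comp (.const _) (list_append.comp
    (list_map (list_range.comp hf) ((primrec_place (primrec_comb
      (Primrec.succ.comp snd))).pair (primrec_place (primrec_comb snd))).to₂)
    (list_flatMap (primrec_leaves hg) (list_cons.comp
      ((primrec_place snd).pair (primrec_place (primrec_loc (.const []) snd)))
      (list_flatMap (primrec_splits snd) (Primrec.ite (nat_le.comp
        (Primrec.encode.comp (fst.comp snd)) (hf.comp (fst.comp fst)))
        (list_append.comp (Primrec.ite (Primrec.eq.comp (snd.comp snd)
          (primrec_zeros (list_length.comp (snd.comp snd))))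
          (list_cons.comp ((primrec_place (primrec_loc (fst.comp snd) (snd.comp snd))).pair
            (primrec_place (primrec_comb (Primrec.encode.comp (fst.comp snd))))) (.const [])) (.const []))
          (list_flatMap (primrec_splits (snd.comp snd)) (Primrec.ite (PrimrecPred.and
            (Primrec.eq.comp (fst.comp snd) (primrec_comb (Primrec.pred.comp
              (list_length.comp (fst.comp snd))))) (PrimrecPred.and
                (PrimrecPred.not (Primrec.eq.comp (list_head?.comp (list_reverse.comp
                  (fst.comp (snd.comp fst)))) (.const (some false))))
                (nat_le.comp (Primrec.encode.comp
                (list_append.comp (fst.comp (snd.comp fst)) (fst.comp snd)))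
                (hf.comp (fst.comp (fst.comp fst))))))
            (list_cons.comp ((primrec_place (primrec_loc (fst.comp (snd.comp fst))
              (snd.comp (snd.comp fst)))).pair (primrec_place (primrec_loc
                (list_append.comp (fst.comp (snd.comp fst)) (fst.comp snd)) (snd.comp snd))))
              (.const [])) (.const [])).to₂)) (.const [])).to₂)).to₂))

theorem primrec_sync {f : α → ℕ} {g : α → Position} (hf : Primrec f) (hg : Primrec g) :
    Primrec fun a => sync (f a) (g a) := by
  refine list_cons.comp (primrec_repTask (primrec_zeros hf)) (list_cons.comp
    (primrec_repTask (primrec_zeros hf)) (list_append.comp (list_flatMap hg (list_flatMap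
      (primrec_option_toList (primrec_repNode (snd.comp snd))) (list_flatMap (primrec_splits snd)
        (Primrec.ite (nat_le.comp (Primrec.encode.comp (fst.comp snd))
          (hf.comp (fst.comp (fst.comp fst)))) (list_cons.comp (primrec_repTask
            (primrec_loc (fst.comp snd) (snd.comp snd))) (.const [])) (.const [])).to₂).to₂).to₂)
    (list_flatMap (primrec_pairs hf hg) (list_append.comp
      (primrec_push (hg.comp fst) (fst.comp snd) (snd.comp snd))
      (primrec_push (hg.comp fst) (snd.comp snd) (fst.comp snd))).to₂)))

theorem primrec_exec {f : α → Position} {g : α → Task} (hf : Primrec f) (hg : Primrec g) :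
    Primrec fun a => exec (f a) (g a) :=
  Primrec.ite (Primrec.eq.comp (list_length.comp (primrec_hits hf (fst.comp (snd.comp hg))))
    (snd.comp (snd.comp hg))) (option_some.comp (fst.comp hg)) (.const none)

/-- All searches of the machine are bounded list operations on the run tape, so the work cycle is
even primitive recursive. -/
theorem primrec_cycle : Primrec cycle :=
  list_casesOn (snd.comp fst)
    (((Primrec.succ.comp (fst.comp fst)).pair
      (primrec_sync (fst.comp fst) (snd.comp snd))).pair (.const none))
    (((fst.comp (fst.comp fst)).pair (snd.comp snd)).pair
      (primrec_exec (snd.comp (snd.comp fst)) (fst.comp snd))).to₂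

end Computability

/-- The machine that wins the long production formula. -/
def copycat : HPM where
  Mem := ℕ × List Task
  init := (0, [])
  step := cycle
  computable := primrec_cycle.to_comp

end CoL

namespace CoL

/-! ### Delays from copying -/

/-- The moves of the player `p` in a position. -/
def mv (p : Player) (Φ : Position) : List Move :=
  Φ.filterMap fun x => if x.1 = p then some x.2 else none

@[simp]
theorem mv_nil (p : Player) : mv p [] = [] := rfl

@[simp]
theorem mv_append (p : Player) (Φ Ψ : Position) : mv p (Φ ++ Ψ) = mv p Φ ++ mv p Ψ :=
  List.filterMap_append

@[simp]
theorem mv_label_self (p : Player) (l : List Move) : mv p (label p l) = l := by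
  simp [mv, label]

@[simp]
theorem mv_label_not (p : Player) (l : List Move) : mv p (label (!p) l) = [] := by
  simp [mv, label]

@[simp]
theorem mv_not_label (p : Player) (l : List Move) : mv (!p) (label p l) = [] := by
  simp [mv, label]

theorem mv_prefix (p : Player) {Φ Ψ : Position} (h : Φ <+: Ψ) : mv p Φ <+: mv p Ψ :=
  h.filterMap _

theorem countP_eq_length_mv (p : Player) (Φ : Position) :
    Φ.countP (fun x => x.1 == p) = (mv p Φ).length := by
  induction Φ with
  | nil => rfl
  | cons x Φ ih =>
    by_cases h : x.1 = p <;> simp [mv, h] at ih ⊢ <;> exact ih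

theorem filterMap_player (p : Player) (Φ : Position) :
    Φ.filterMap (fun x => if x.1 = p then some x else none) = label p (mv p Φ) := by
  induction Φ with
  | nil => rfl
  | cons x Φ ih =>
    by_cases h : x.1 = p
    · subst h; simpa [mv, label] using ih
    · simpa [mv, label, h] using ih

theorem exists_split_of_lt_length_mv {p : Player} {n : ℕ} {Φ : Position}
    (h : n < (mv p Φ).length) :
    ∃ Ψ β, Ψ ++ [(p, β)] <+: Φ ∧ (mv p Ψ).length = n := by
  induction Φ using List.reverseRecOn with
  | nil => simp at h
  | append_singleton Φ x ih =>
    by_cases h' : n < (mv p Φ).length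
    · obtain ⟨Ψ, β, h1, h2⟩ := ih h'
      exact ⟨Ψ, β, h1.trans (List.prefix_append _ _), h2⟩
    · obtain ⟨q, β⟩ := x
      by_cases hq : q = p
      · subst hq
        refine ⟨Φ, β, List.prefix_rfl, ?_⟩
        simp [mv] at h h' ⊢
        omega
      · simp [mv, hq] at h h'
        omega

theorem Run.eq_of_prefixes {Γ Δ : Run} (h1 : ∀ Φ ∈ Γ.segs, ∃ Ψ ∈ Δ.segs, Φ <+: Ψ)
    (h2 : ∀ Φ ∈ Δ.segs, ∃ Ψ ∈ Γ.segs, Φ <+: Ψ) : Γ = Δ := by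
  ext Φ
  constructor
  · intro h
    obtain ⟨Ψ, hΨ, hp⟩ := h1 Φ h
    exact Δ.closed _ hΨ _ hp
  · intro h
    obtain ⟨Ψ, hΨ, hp⟩ := h2 Φ h
    exact Γ.closed _ hΨ _ hp

/-- In `y` the player `p` is ahead of his moves in `x`, and in `x` his adversary is ahead of his
moves in `y`. -/
def Copies (p : Player) (x y : Position) : Prop :=
  mv p x <+: mv p y ∧ mv (!p) y <+: mv (!p) x

/-- Here `S` is a common time line, and `f`, `g` cut the two plays out of it. By `hc`, at each
moment `p` has made in the first play only moves that `p` has already made in the second, and the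
adversary the other way round. So the moves of `p` come later in the first play, relative to those
of the adversary. The conditions `h1` and `h2` say that all moves are copied in the end, so that
both plays have the same moves of either player. -/
theorem isDelay_of_copies {T : Type*} {p : Player} {S : Set (List T)} {f g : T → Option LabMove}
    {Δ Γ : Run} (hΔ : Δ.segs = List.filterMap f '' S) (hΓ : Γ.segs = List.filterMap g '' S)
    (hcl : ∀ Φ ∈ S, ∀ Ψ, Ψ <+: Φ → Ψ ∈ S) (hch : ∀ Φ ∈ S, ∀ Ψ ∈ S, Φ <+: Ψ ∨ Ψ <+: Φ)
    (hc : ∀ Φ ∈ S, Copies p (Φ.filterMap f) (Φ.filterMap g))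
    (h1 : ∀ Φ ∈ S, ∃ Ψ ∈ S, mv p (Φ.filterMap g) <+: mv p (Ψ.filterMap f))
    (h2 : ∀ Φ ∈ S, ∃ Ψ ∈ S, mv (!p) (Φ.filterMap f) <+: mv (!p) (Ψ.filterMap g)) :
    IsDelay p Δ Γ := by
  have hfΔ : ∀ Φ ∈ S, Φ.filterMap f ∈ Δ.segs := fun Φ h => hΔ ▸ ⟨Φ, h, rfl⟩
  have hgΓ : ∀ Φ ∈ S, Φ.filterMap g ∈ Γ.segs := fun Φ h => hΓ ▸ ⟨Φ, h, rfl⟩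
  have hmoves : ∀ q, (∀ Φ ∈ S, ∃ Ψ ∈ S, mv q (Φ.filterMap g) <+: mv q (Ψ.filterMap f)) →
      (∀ Φ ∈ S, ∃ Ψ ∈ S, mv q (Φ.filterMap f) <+: mv q (Ψ.filterMap g)) →
      Δ.movesOf q = Γ.movesOf q := by
    intro q k1 k2
    apply Run.eq_of_prefixes
    · rintro _ ⟨Φ, hΦ, rfl⟩
      rw [hΔ] at hΦ
      obtain ⟨Φ, hΦ, rfl⟩ := hΦ
      obtain ⟨Ψ, hΨ, hp⟩ := k2 Φ hΦ
      refine ⟨_, ⟨_, hgΓ Ψ hΨ, rfl⟩, ?_⟩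
      simp only [filterMap_player]
      exact hp.map _
    · rintro _ ⟨Φ, hΦ, rfl⟩
      rw [hΓ] at hΦ
      obtain ⟨Φ, hΦ, rfl⟩ := hΦ
      obtain ⟨Ψ, hΨ, hp⟩ := k1 Φ hΦ
      refine ⟨_, ⟨_, hfΔ Ψ hΨ, rfl⟩, ?_⟩
      simp only [filterMap_player]
      exact hp.map _
  constructor
  · intro q
    rcases Bool.eq_or_eq_not q p with rfl | rfl
    · exact hmoves _ h1 fun Φ h => ⟨Φ, h, (hc Φ h).1⟩
    · exact hmoves _ (fun Φ h => ⟨Φ, h, (hc Φ h).2⟩) h2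
  · rintro n k - - ⟨Φ, α, hΦ, hn, hk⟩
    rw [hΓ] at hΦ
    obtain ⟨Θ, hΘ, hΘe⟩ := hΦ
    obtain ⟨Θ', hp, hΘ'⟩ := List.prefix_filterMap_iff.1
      (show Φ <+: Θ.filterMap g from hΘe ▸ List.prefix_append _ _)
    have hΘ'S := hcl _ hΘ _ hp
    rw [countP_eq_length_mv] at hn hk
    obtain ⟨Ψ, hΨ, hlen⟩ := h1 Θ hΘ
    replace hlen := hlen.length_le
    rw [hΘe] at hlen
    simp only [mv_append, List.length_append] at hlen
    have e1 : ∀ a, (mv p [(p, a)]).length = 1 := by simp [mv]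
    have e2 := e1 α
    -- At the moment `Θ'` just before the n-th move of `p` in `Γ`, the play `Δ` contains fewer than
    -- n moves of `p` and already at least k of the adversary. The n-th move of `p` in `Δ`, located
    -- here, must therefore come after that moment.
    obtain ⟨X, β, hX, hXn⟩ := exists_split_of_lt_length_mv
      (show (mv p Φ).length < (mv p (Ψ.filterMap f)).length by omega)
    have c1 := (hc _ hΘ'S).1.length_le
    have c2 := (hc _ hΘ'S).2.length_le
    rw [← hΘ'] at c1 c2
    refine ⟨X, β, Δ.closed _ (hfΔ Ψ hΨ) _ hX, ?_, ?_⟩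
    · rw [countP_eq_length_mv]; omega
    · rw [countP_eq_length_mv]
      have hfp : Θ'.filterMap f <+: Ψ.filterMap f := by
        rcases hch _ hΘ'S _ hΨ with h | h
        · exact h.filterMap f
        · have := (mv_prefix p (h.filterMap f)).length_le
          omega
      rcases List.prefix_or_prefix_of_prefix hfp hX with h | h
      · rcases List.prefix_concat_iff.1 h with h | h
        · rw [h] at c1
          simp [mv_append, e1] at c1
          omega
        · have := (mv_prefix (!p) h).length_le
          omega
      · have := (mv_prefix p h).length_le
        simp [mv_append, e1] at this
        omega

/-! ### Legality of copied moves -/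

/-- The finite run that ends in the position `Φ`. -/
def Run.ofPosition (Φ : Position) : Run where
  segs := {Ψ | Ψ <+: Φ}
  nil_mem := List.nil_prefix
  closed _ h _ h' := h'.trans h
  chain _ h _ h' := List.prefix_or_prefix_of_prefix h h'

/-- If a block of moves by one player leads out of the legal positions, the first illegal move lies
in the block and is made by that player. -/
theorem ConstGame.illegalBy_of_label (A : ConstGame) {q : Player} {Φ : Position} (h : Φ ∈ A.legal)
    {l : List Move} (hl : Φ ++ label q l ∉ A.legal) {Γ : Run} (hΓ : Φ ++ label q l ∈ Γ.segs) :
    IllegalBy A.legal q Γ := by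
  induction l using List.reverseRecOn with
  | nil => simp [label, h] at hl
  | append_singleton l a ih =>
    have e : Φ ++ label q (l ++ [a]) = (Φ ++ label q l) ++ [(q, a)] := by simp [label]
    rw [e] at hl hΓ
    by_cases h' : Φ ++ label q l ∈ A.legal
    · exact ⟨_, a, hΓ, h', hl⟩
    · exact ih h' (Γ.closed _ hΓ _ (List.prefix_append _ _))

theorem prefix_append_cases {T : Type*} {l a b : List T} (h : l <+: a ++ b) :
    l <+: a ∨ ∃ b', b' <+: b ∧ l = a ++ b' := by
  rcases List.prefix_or_prefix_of_prefix h (List.prefix_append a b) with h' | ⟨b', rfl⟩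
  · exact .inl h'
  · exact .inr ⟨b', (List.prefix_append_right_inj a).1 h, rfl⟩

/-- A player who copies the moves of the adversary from another play of the same static game never
makes an illegal move. -/
theorem ConstGame.Static.legal_of_copies {A : ConstGame} (hA : A.Static) {T : Type*} {p : Player}
    {D : List T} {f g : T → Option LabMove} {α : Move}
    (hc : ∀ Φ, Φ <+: D → Copies p (Φ.filterMap f) (Φ.filterMap g))
    (hf : D.filterMap f ∈ A.legal) (hg : D.filterMap g ∈ A.legal)
    (h : mv p (D.filterMap f) ++ [α] <+: mv p (D.filterMap g)) :
    D.filterMap f ++ [(p, α)] ∈ A.legal := by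
  obtain ⟨r, hr⟩ := h
  obtain ⟨t, ht⟩ := (hc D List.prefix_rfl).2
  by_contra hill
  -- If copying `α` were illegal, both plays could be completed as follows. After the common history
  -- `D1`, the player `p` makes all outstanding copies in the first play (`D2`), the adversary makes
  -- his in the second (`D3`), and finally the adversary makes the never legal move `spade` in both
  -- (`D4`). The first play is then a `p`-delay of the second.
  let D1 : List (Option LabMove × Option LabMove) := D.map fun x => (f x, g x)
  let D2 : List (Option LabMove × Option LabMove) := (α :: r).map fun a => (some (p, a), none)
  let D3 : List (Option LabMove × Option LabMove) := t.map fun a => (none, some (!p, a))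
  let D4 : List (Option LabMove × Option LabMove) := [(some (!p, spade), some (!p, spade))]
  have f1 : ∀ X : List T, (X.map fun x => (f x, g x)).filterMap Prod.fst = X.filterMap f := by
    intro X; rw [List.filterMap_map]; rfl
  have g1 : ∀ X : List T, (X.map fun x => (f x, g x)).filterMap Prod.snd = X.filterMap g := by
    intro X; rw [List.filterMap_map]; rfl
  have f2 : ∀ X : List Move, (X.map fun a => ((some (p, a), none) :
      Option LabMove × Option LabMove)).filterMap Prod.fst = label p X := by
    simp [label]
  have g2 : ∀ X : List Move, (X.map fun a => ((some (p, a), none) :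
      Option LabMove × Option LabMove)).filterMap Prod.snd = [] := by
    simp
  have f3 : ∀ X : List Move, (X.map fun a => ((none, some (!p, a)) :
      Option LabMove × Option LabMove)).filterMap Prod.fst = [] := by
    simp
  have g3 : ∀ X : List Move, (X.map fun a => ((none, some (!p, a)) :
      Option LabMove × Option LabMove)).filterMap Prod.snd = label (!p) X := by
    simp [label]
  have hr' : mv p (D.filterMap f) ++ (α :: r) = mv p (D.filterMap g) := by rw [← hr]; simp
  have f4 : D4.filterMap Prod.fst = label (!p) [spade] := rfl
  have g4 : D4.filterMap Prod.snd = label (!p) [spade] := rfl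
  have hcc : ∀ X, X <+: D1 ++ D2 ++ D3 ++ D4 →
      Copies p (X.filterMap Prod.fst) (X.filterMap Prod.snd) := by
    intro X hX
    rcases prefix_append_cases hX with hX | ⟨Y, hY, rfl⟩
    · rcases prefix_append_cases hX with hX | ⟨Y, hY, rfl⟩
      · rcases prefix_append_cases hX with hX | ⟨Y, hY, rfl⟩
        · obtain ⟨X', hX', rfl⟩ := List.prefix_map_iff.1 hX
          rw [f1, g1]; exact hc _ hX'
        · obtain ⟨Z, hZ, rfl⟩ := List.prefix_map_iff.1 hY
          simp only [List.filterMap_append, D1, f1, g1, f2, g2]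
          refine ⟨?_, ?_⟩
          · simpa [← hr'] using hZ
          · simpa using (hc D List.prefix_rfl).2
      · obtain ⟨Z, hZ, rfl⟩ := List.prefix_map_iff.1 hY
        simp only [List.filterMap_append, D1, D2, f1, g1, f2, g2, f3, g3]
        refine ⟨?_, ?_⟩
        · simp [hr']
        · simpa [← ht] using hZ
    · have e : Y.filterMap Prod.fst = Y.filterMap Prod.snd := by
        rcases List.prefix_concat_iff.1 (show Y <+: [] ++ D4 from hY) with rfl | h
        · rfl
        · rw [List.prefix_nil.1 h]; rfl
      simp only [List.filterMap_append, D1, D2, D3, f1, g1, f2, g2, f3, g3, e]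
      refine ⟨?_, ?_⟩
      · simp only [mv_append, mv_label_self, hr', List.append_nil, mv_label_not]
        exact List.prefix_rfl
      · simp only [mv_append, mv_label_self, ht, List.append_nil, mv_not_label]
        exact List.prefix_rfl
  have efin : (D1 ++ D2 ++ D3 ++ D4).filterMap Prod.fst =
      D.filterMap f ++ label p (α :: r) ++ label (!p) [spade] := by
    simp only [List.filterMap_append, D1, D2, D3, f1, f2, f3, f4, List.append_nil]
  have egin : (D1 ++ D2 ++ D3 ++ D4).filterMap Prod.snd =
      D.filterMap g ++ label (!p) (t ++ [spade]) := by
    simp only [List.filterMap_append, D1, D2, D3, g1, g2, g3, g4, List.append_nil]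
    simp [label]
  have hseg : ∀ k : Option LabMove × Option LabMove → Option LabMove, ∀ X : List _,
      (Run.ofPosition (X.filterMap k)).segs = List.filterMap k '' {Y | Y <+: X} := by
    intro k X
    ext Z
    constructor
    · intro hZ
      obtain ⟨Y, hY, rfl⟩ := List.prefix_filterMap_iff.1 hZ
      exact ⟨Y, hY, rfl⟩
    · rintro ⟨Y, hY, rfl⟩
      exact List.IsPrefix.filterMap k hY
  have hdelay := isDelay_of_copies (p := p) (hseg Prod.fst (D1 ++ D2 ++ D3 ++ D4))
    (hseg Prod.snd (D1 ++ D2 ++ D3 ++ D4)) (fun _ h _ h' => h'.trans h)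
    (fun _ h _ h' => List.prefix_or_prefix_of_prefix h h') hcc
    (fun Φ hΦ => ⟨_, List.prefix_rfl, (mv_prefix p (hΦ.filterMap _)).trans (by
      rw [efin, egin]; simp [hr'])⟩)
    (fun Φ hΦ => ⟨_, List.prefix_rfl, (mv_prefix (!p) (hΦ.filterMap _)).trans (by
      rw [efin, egin]; simp [← ht])⟩)
  rw [efin, egin] at hdelay
  -- In the second play everything after the legal history is made by the adversary and ends with
  -- `spade`, so he is to blame and `p` wins. Staticness passes the win to the first play, where `α`
  -- is the first illegal move, made by `p`.
  have hw : A.winner (Run.ofPosition (D.filterMap g ++ label (!p) (t ++ [spade]))) = p := by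
    have := A.winner_illegal (!p) _ (A.illegalBy_of_label hg (l := t ++ [spade]) (q := !p)
      (fun hl => A.spade_illegal _ hl (!p, spade) (by simp [label]) rfl)
      (Γ := Run.ofPosition _) List.prefix_rfl)
    simpa using this
  refine A.winner_illegal p _ ⟨_, α, ?_, hf, hill⟩ (hA p _ _ hdelay hw)
  exact ⟨label p r ++ label (!p) [spade], by simp [label]⟩

end CoL

namespace CoL

/-! ### Projections of positions -/

theorem strip_eq_some {p m β : Move} : strip p m = some β ↔ m = p ++ β := by
  unfold strip
  constructor
  · intro h
    split_ifs at h with h'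
    rw [← Option.some.inj h]
    conv_lhs => rw [← List.take_append_drop p.length m, h']
  · rintro rfl
    simp

@[simp]
theorem strip_append (p β : Move) : strip p (p ++ β) = some β := strip_eq_some.2 rfl

@[simp]
theorem strip_nil (m : Move) : strip [] m = some m := strip_eq_some.2 rfl

theorem strip_bind (p q m : Move) : (strip p m).bind (strip q) = strip (p ++ q) m := by
  ext β
  simp only [Option.bind_eq_some_iff, strip_eq_some]
  constructor
  · rintro ⟨_, rfl, rfl⟩; simp
  · rintro rfl; exact ⟨_, by simp, rfl⟩

theorem bitSym_inj {b b' : Bool} (h : bitSym b = bitSym b') : b = b' := by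
  revert b b'; decide

theorem bitSym_ne_dot (b : Bool) : bitSym b ≠ dot := by revert b; decide

theorem bitSym_ne_colon (b : Bool) : bitSym b ≠ colon := by revert b; decide

/-- The bit string ends at the first symbol that is not a bit, so addresses can be read off
uniquely. -/
theorem bits_append_inj {c d : Sym} (hc : ∀ b, bitSym b ≠ c) (hd : ∀ b, bitSym b ≠ d) :
    ∀ {u u' : List Bool} {m m' : Move}, bits u ++ c :: m = bits u' ++ d :: m' →
      u = u' ∧ c = d ∧ m = m'
  | [], [], _, _, h => by simpa [bits] using h
  | [], b :: _, _, _, h => by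
    simp only [bits, List.map_nil, List.nil_append, List.map_cons, List.cons_append,
      List.cons.injEq] at h
    exact absurd h.1.symm (hc b)
  | b :: _, [], _, _, h => by
    simp only [bits, List.map_nil, List.nil_append, List.map_cons, List.cons_append,
      List.cons.injEq] at h
    exact absurd h.1 (hd b)
  | b :: u, b' :: u', m, m', h => by
    simp only [bits, List.map_cons, List.cons_append, List.cons.injEq] at h
    obtain ⟨h1, h2, h3⟩ := bits_append_inj (u := u) (u' := u') hc hd h.2
    exact ⟨by rw [bitSym_inj h.1, h1], h2, h3⟩

/-- Apply the partial map `g` to the move, and reverse the label if `φ` holds. -/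
def lab (φ : Bool) (g : Move → Option Move) (x : LabMove) : Option LabMove :=
  (g x.2).map fun α => (xor φ x.1, α)

theorem filterMap_lab (φ ψ : Bool) (g h : Move → Option Move) (Φ : Position) :
    (Φ.filterMap (lab φ g)).filterMap (lab ψ h) =
      Φ.filterMap (lab (xor ψ φ) fun m => (g m).bind h) := by
  rw [List.filterMap_filterMap]
  congr 1
  funext x
  unfold lab
  cases hg : g x.2 <;> simp [hg]

theorem filterMap_lab_strip (φ ψ : Bool) (p q : Move) (Φ : Position) :
    (Φ.filterMap (lab φ (strip p))).filterMap (lab ψ (strip q)) =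
      Φ.filterMap (lab (xor ψ φ) (strip (p ++ q))) := by
  rw [filterMap_lab]
  simp only [strip_bind]

theorem compLab_eq (b : Bool) : compLab b = lab false (strip [bitSym b, dot]) := by
  funext x
  unfold compLab lab
  have : compMove b x.2 = strip [bitSym b, dot] x.2 := by
    ext β
    rw [strip_eq_some]
    rcases x.2 with _ | ⟨c, _ | ⟨d, m⟩⟩ <;> simp [compMove, and_assoc]
  simp [this]

theorem threadLab_eq (v : ℕ → Bool) : threadLab v = lab false (threadMove v) := by
  funext x
  simp [threadLab, lab]

theorem negPos_eq (Φ : Position) : negPos Φ = Φ.filterMap (lab true (strip [])) := by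
  unfold negPos
  rw [← List.filterMap_eq_map]
  congr 1
  funext x
  simp [lab, flipLab]

theorem mem_filterMap_lab {φ : Bool} {g : Move → Option Move} {Φ : Position} {p : Player}
    {m : Move} : (p, m) ∈ Φ.filterMap (lab φ g) ↔ ∃ m', (xor φ p, m') ∈ Φ ∧ g m' = some m := by
  simp only [List.mem_filterMap, lab, Option.map_eq_some_iff, Prod.mk.injEq, Prod.exists]
  constructor
  · rintro ⟨q, m', h, m'', h', rfl, rfl⟩
    exact ⟨m', by simpa using h, h'⟩
  · rintro ⟨m', h, h'⟩
    exact ⟨_, m', h, m, h', by simp, rfl⟩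

theorem filterMap_lab_concat_some {φ : Bool} {g : Move → Option Move} {Φ : Position} {p : Player}
    {m β : Move} (h : g m = some β) :
    (Φ ++ [(p, m)]).filterMap (lab φ g) = Φ.filterMap (lab φ g) ++ [(xor φ p, β)] := by
  simp [List.filterMap_append, lab, h]

theorem filterMap_lab_concat_none {φ : Bool} {g : Move → Option Move} {Φ : Position} {p : Player}
    {m : Move} (h : g m = none) : (Φ ++ [(p, m)]).filterMap (lab φ g) = Φ.filterMap (lab φ g) := by
  simp [List.filterMap_append, lab, h]

/-! ### Legal positions of compound games -/

theorem parLegal_iff {A B : ConstGame} {Φ : Position} : Φ ∈ parLegal A B ↔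
    (∀ x ∈ Φ, ∃ (b : Bool) (α : Move), x.2 = [bitSym b, dot] ++ α) ∧
      Φ.filterMap (lab false (strip [bitSym false, dot])) ∈ A.legal ∧
      Φ.filterMap (lab false (strip [bitSym true, dot])) ∈ B.legal := by
  rw [← compLab_eq, ← compLab_eq]
  rfl

theorem strip_bit_of_ne {b b' : Bool} (h : b ≠ b') (m : Move) :
    strip [bitSym b, dot] ([bitSym b', dot] ++ m) = none := by
  rw [Option.eq_none_iff_forall_ne_some]
  intro β hβ
  rw [strip_eq_some] at hβ
  simp only [List.cons_append, List.nil_append, List.cons.injEq] at hβ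
  exact h (bitSym_inj hβ.1.symm)

theorem parLegal_concat_false {A B : ConstGame} {Φ : Position} (h : Φ ∈ parLegal A B) {p : Player}
    {m : Move} (hm : Φ.filterMap (lab false (strip [bitSym false, dot])) ++ [(p, m)] ∈ A.legal) :
    Φ ++ [(p, [bitSym false, dot] ++ m)] ∈ parLegal A B := by
  rw [parLegal_iff] at h ⊢
  refine ⟨?_, ?_, ?_⟩
  · intro x hx
    rcases List.mem_append.1 hx with hx | hx
    · exact h.1 x hx
    · rw [List.mem_singleton.1 hx]; exact ⟨_, _, rfl⟩
  · rw [filterMap_lab_concat_some (strip_append _ _)]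
    simpa using hm
  · rw [filterMap_lab_concat_none (strip_bit_of_ne (by simp) _)]
    exact h.2.2

theorem parLegal_concat_true {A B : ConstGame} {Φ : Position} (h : Φ ∈ parLegal A B) {p : Player}
    {m : Move} (hm : Φ.filterMap (lab false (strip [bitSym true, dot])) ++ [(p, m)] ∈ B.legal) :
    Φ ++ [(p, [bitSym true, dot] ++ m)] ∈ parLegal A B := by
  rw [parLegal_iff] at h ⊢
  refine ⟨?_, ?_, ?_⟩
  · intro x hx
    rcases List.mem_append.1 hx with hx | hx
    · exact h.1 x hx
    · rw [List.mem_singleton.1 hx]; exact ⟨_, _, rfl⟩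
  · rw [filterMap_lab_concat_none (strip_bit_of_ne (by simp) _)]
    exact h.2.1
  · rw [filterMap_lab_concat_some (strip_append _ _)]
    simpa using hm

theorem mem_neg_legal {A : ConstGame} {Φ : Position} :
    Φ ∈ A.neg.legal ↔ Φ.filterMap (lab true (strip [])) ∈ A.legal := by
  rw [← negPos_eq]
  rfl

theorem neg_legal_concat {A : ConstGame} {Φ : Position} {p : Player} {m : Move}
    (hm : Φ.filterMap (lab true (strip [])) ++ [(!p, m)] ∈ A.legal) :
    Φ ++ [(p, m)] ∈ A.neg.legal := by
  rw [mem_neg_legal, filterMap_lab_concat_some (strip_nil m)]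
  simpa using hm

theorem branchLegal_concat {A : ConstGame} {Φ : Position} {x : LabMove} :
    Φ ++ [x] ∈ branchLegal A ↔ Φ ∈ branchLegal A ∧ BranchMove A Φ x := by
  constructor
  · intro h
    exact ⟨branchLegal_closed A _ h _ (List.prefix_append _ _), h Φ x List.prefix_rfl⟩
  · rintro ⟨h1, h2⟩ Ψ y hy
    rcases List.prefix_concat_iff.1 hy with hy | hy
    · obtain ⟨rfl, he⟩ := List.append_inj' hy rfl
      rw [(List.cons.inj he).1]; exact h2
    · exact h1 Ψ y hy

theorem threadMove_colon (v : ℕ → Bool) (w : List Bool) :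
    threadMove v (bits w ++ [colon]) = none := by
  rw [Option.eq_none_iff_forall_ne_some]
  intro β hβ
  obtain ⟨u, _, hu⟩ := (threadMove_eq_some_iff _ _ _).1 hβ
  have := (bits_append_inj bitSym_ne_colon bitSym_ne_dot hu).2.1
  revert this; decide

/-- A replicative move is invisible in every thread, and the rules demand that any other move be
legal in all threads through its node. -/
theorem branchLegal_thread {A : ConstGame} {Φ : Position} (h : Φ ∈ branchLegal A) (v : ℕ → Bool) :
    Φ.filterMap (lab false (threadMove v)) ∈ A.legal := by
  induction Φ using List.reverseRecOn with
  | nil => exact A.nil_legal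
  | append_singleton Φ x ih =>
    obtain ⟨h1, h2⟩ := branchLegal_concat.1 h
    obtain ⟨p, m⟩ := x
    rcases h2 with ⟨_, w, _, hw⟩ | ⟨w, α, _, hw, hl⟩
    · dsimp only at hw
      rw [hw, filterMap_lab_concat_none (threadMove_colon v w)]
      exact ih h1
    · dsimp only at hw
      cases ht : threadMove v m with
      | none => rw [filterMap_lab_concat_none ht]; exact ih h1
      | some β =>
        obtain ⟨u, hu, hm⟩ := (threadMove_eq_some_iff _ _ _).1 ht
        obtain ⟨rfl, _, rfl⟩ := bits_append_inj bitSym_ne_dot bitSym_ne_dot (hw.symm.trans hm)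
        rw [filterMap_lab_concat_some ht, ← threadLab_eq]
        simpa using hl v hu

theorem ActualNode.mono {Φ Ψ : Position} {w : List Bool} (h : ActualNode Φ w) (hs : Φ ⊆ Ψ) :
    ActualNode Ψ w := by
  rcases h with h | ⟨u, b, h, p, hp⟩
  · exact .inl h
  · exact .inr ⟨u, b, h, p, hs hp⟩

theorem branchLegal_dot {A : ConstGame} {Φ : Position} (h : Φ ∈ branchLegal A) {p : Player}
    {w : List Bool} {α : Move} (hm : (p, bits w ++ dot :: α) ∈ Φ) : ActualNode Φ w := by
  obtain ⟨s, t, rfl⟩ := List.append_of_mem hm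
  rcases h s (p, bits w ++ dot :: α) ⟨t, by simp⟩ with ⟨_, u, _, hu⟩ | ⟨u, β, hu, hw, _⟩
  · have := (bits_append_inj bitSym_ne_dot bitSym_ne_colon hu).2.1
    exact absurd this (by decide)
  · obtain ⟨rfl, _⟩ := bits_append_inj bitSym_ne_dot bitSym_ne_dot hw
    exact hu.mono (List.subset_append_left _ _)

theorem branchMove_colon {A : ConstGame} {Φ : Position} {p : Player}
    {w : List Bool} {α : Move} (h : BranchMove A Φ (p, bits w ++ colon :: α)) :
    α = [] ∧ p = environment ∧ Leaf Φ w := by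
  rcases h with ⟨hp, u, hl, hu⟩ | ⟨u, β, hu, hw, _⟩
  · obtain ⟨rfl, _, rfl⟩ := bits_append_inj bitSym_ne_colon bitSym_ne_colon hu
    exact ⟨rfl, hp, hl⟩
  · have := (bits_append_inj bitSym_ne_colon bitSym_ne_dot hw).2.1
    exact absurd this (by decide)

theorem branchLegal_colon {A : ConstGame} {Φ : Position} (h : Φ ∈ branchLegal A) {p : Player}
    {w : List Bool} {α : Move} (hm : (p, bits w ++ colon :: α) ∈ Φ) :
    α = [] ∧ p = environment ∧ ActualNode Φ w := by
  obtain ⟨s, t, rfl⟩ := List.append_of_mem hm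
  obtain ⟨h1, h2, h3⟩ := branchMove_colon (h s (p, bits w ++ colon :: α) ⟨t, by simp⟩)
  exact ⟨h1, h2, h3.1.mono (List.subset_append_left _ _)⟩

/-- A proper prefix of an actual node has been replicated. -/
theorem branchLegal_replicated {A : ConstGame} {Φ : Position} (h : Φ ∈ branchLegal A)
    {w t : List Bool} (hw : ActualNode Φ (w ++ t)) (ht : t ≠ []) :
    (environment, bits w ++ [colon]) ∈ Φ := by
  induction t using List.reverseRecOn with
  | nil => exact absurd rfl ht
  | append_singleton t b ih =>
    rcases hw with hw | ⟨u, b', hu, p, hp⟩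
    · simp at hw
    · rw [← List.append_assoc] at hu
      obtain ⟨rfl, -⟩ := List.append_inj' hu rfl
      obtain ⟨-, rfl, ha⟩ := branchLegal_colon h hp
      by_cases ht' : t = []
      · subst ht'; simpa using hp
      · exact ih ha ht'

theorem branchLegal_leaf {A : ConstGame} {Φ : Position} (h : Φ ∈ branchLegal A)
    {w : List Bool} (hw : ActualNode Φ w) (hn : (environment, bits w ++ [colon]) ∉ Φ) :
    Leaf Φ w := by
  refine ⟨hw, ?_⟩
  rintro _ hw' ⟨t, rfl⟩
  by_contra ht
  exact hn (branchLegal_replicated h hw' (by simpa using ht))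

/-! ### Infinite bit strings -/

/-- The infinite bit string that starts with `w` and goes on with `v`. -/
def cat : List Bool → (ℕ → Bool) → ℕ → Bool
  | [], v => v
  | b :: w, v => fun i => i.casesOn b (cat w v)

theorem initSeg_nil (v : ℕ → Bool) : InitSeg [] v := fun i h => by simp at h

theorem initSeg_cons {b : Bool} {w : List Bool} {v : ℕ → Bool} :
    InitSeg (b :: w) v ↔ b = v 0 ∧ InitSeg w fun i => v (i + 1) := by
  constructor
  · intro h
    exact ⟨h 0 (by simp), fun i hi => h (i + 1) (by simpa using hi)⟩
  · rintro ⟨h1, h2⟩ i hi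
    cases i with
    | zero => exact h1
    | succ i => exact h2 i (by simpa using hi)

theorem initSeg_cat_append {w t : List Bool} {v : ℕ → Bool} :
    InitSeg (w ++ t) (cat w v) ↔ InitSeg t v := by
  induction w with
  | nil => rfl
  | cons b w ih => simpa [initSeg_cons, cat] using ih

theorem initSeg_cat (w : List Bool) (v : ℕ → Bool) : InitSeg w (cat w v) := by
  simpa using initSeg_cat_append (w := w) (t := []) |>.2 (initSeg_nil v)

theorem cat_append (w t : List Bool) (v : ℕ → Bool) : cat (w ++ t) v = cat w (cat t v) := by
  induction w with
  | nil => rfl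
  | cons b w ih => simp [cat, ih]

theorem InitSeg.exists_cat {w : List Bool} {v : ℕ → Bool} (h : InitSeg w v) :
    ∃ v', v = cat w v' := by
  induction w generalizing v with
  | nil => exact ⟨v, rfl⟩
  | cons b w ih =>
    obtain ⟨h1, h2⟩ := initSeg_cons.1 h
    obtain ⟨v', hv'⟩ := ih h2
    refine ⟨v', ?_⟩
    funext i
    cases i with
    | zero => exact h1.symm
    | succ i => exact congrFun hv' i

theorem InitSeg.prefix {u w : List Bool} {v : ℕ → Bool} (hu : InitSeg u v) (hw : InitSeg w v)
    (hl : u.length ≤ w.length) : u <+: w := by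
  rw [List.prefix_iff_getElem]
  exact ⟨hl, fun i hi => (hu i hi).trans (hw i (by omega)).symm⟩

theorem InitSeg.of_prefix {u w : List Bool} {v : ℕ → Bool} (hw : InitSeg w v) (h : u <+: w) :
    InitSeg u v := fun i hi => (List.IsPrefix.getElem h hi).trans (hw i _)

theorem InitSeg.total {u w : List Bool} {v : ℕ → Bool} (hu : InitSeg u v) (hw : InitSeg w v) :
    u <+: w ∨ w <+: u :=
  (le_total u.length w.length).imp (hu.prefix hw) (hw.prefix hu)

/-! ### Slots -/

namespace Slot

/-- The part of a move that is made at the slot `σ` in the thread `v`. -/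
def ext (σ : Slot) (v : ℕ → Bool) (m : Move) : Option Move :=
  ((strip σ.pre m).bind (threadMove v)).bind (strip σ.suf)

theorem ext_eq_some {σ : Slot} {v : ℕ → Bool} {m β : Move} :
    σ.ext v m = some β ↔ ∃ u, InitSeg u v ∧ m = full (σ.place u) ++ β := by
  simp only [ext, Option.bind_eq_some_iff, strip_eq_some, threadMove_eq_some_iff, full]
  constructor
  · rintro ⟨_, ⟨_, rfl, u, hu, rfl⟩, rfl⟩
    exact ⟨u, hu, by simp⟩
  · rintro ⟨u, hu, rfl⟩
    exact ⟨σ.suf ++ β, ⟨bits u ++ dot :: (σ.suf ++ β), by simp, u, hu, rfl⟩, rfl⟩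

/-- None of the four prefixes `0.0`, `0.1.0.`, `0.1.1.` and `1.` is an initial segment of another.
-/
theorem pre_append_inj {σ τ : Slot} {m m' : Move} (h : σ.pre ++ m = τ.pre ++ m') :
    σ.pre = τ.pre ∧ m = m' := by
  have hp : σ.pre = τ.pre := by
    revert h; cases σ <;> cases τ <;> simp [pre]
  rw [hp] at h
  exact ⟨hp, List.append_cancel_left h⟩

/-- A move determines its slot, its node and the remainder: once prefix and node are read off, the
suffixes of slots with the same prefix are again incomparable. -/
theorem full_inj {σ τ : Slot} {u u' : List Bool} {β β' : Move}
    (h : full (σ.place u) ++ β = full (τ.place u') ++ β') : σ = τ ∧ u = u' ∧ β = β' := by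
  simp only [full, List.append_assoc] at h
  obtain ⟨h1, h2⟩ := pre_append_inj h
  obtain ⟨rfl, -, h3⟩ := bits_append_inj bitSym_ne_dot bitSym_ne_dot h2
  have : σ = τ ∧ β = β' := by
    revert h1 h3; cases σ <;> cases τ <;> simp [pre, suf]
  exact ⟨this.1, rfl, this.2⟩

theorem pre_dot_ne_colon {σ τ : Slot} {u u' : List Bool} {β β' : Move} :
    full (σ.place u) ++ β ≠ τ.pre ++ (bits u' ++ colon :: β') := by
  intro h
  simp only [full, List.append_assoc] at h
  exact absurd (bits_append_inj bitSym_ne_dot bitSym_ne_colon (pre_append_inj h).2).2.1 (by decide)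

/-- Whether the machine plays the letter at the slot with the roles interchanged. -/
def flip : Slot → Bool
  | given | consP | consQ | consR => true
  | anteP | anteR | anteQ | goal => false

/-- Whether the machine plays the branching recurrence with the roles interchanged. -/
def treeFlip : Slot → Bool
  | goal => false
  | _ => true

/-- The letter that is played at a slot. -/
def game (P Q R : ConstGame) : Slot → ConstGame
  | given | anteP | consP => P
  | consQ | anteQ => Q
  | anteR | consR | goal => R

/-- The game whose branching recurrence the slot belongs to. -/
noncomputable def inner (P Q R : ConstGame) : Slot → ConstGame
  | given => P
  | anteP | consP | consQ => (P.neg).or (P.and Q)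
  | anteR | anteQ | consR => ((R.or Q).neg).or R
  | goal => R

end Slot

/-- The long production game. -/
noncomputable def production (P Q R : ConstGame) : ConstGame :=
  ((P.and (((P.neg).or (P.and Q)).cbr.and (((R.or Q).neg).or R).cbr)).neg).or R.cbr

/-! ### Legality in the production game reduced to the trees and the letters -/

section

variable {P Q R : ConstGame}

theorem mem_and_legal {A B : ConstGame} {Φ : Position} :
    Φ ∈ (A.and B).legal ↔ Φ ∈ parLegal A B := Iff.rfl

theorem mem_or_legal {A B : ConstGame} {Φ : Position} :
    Φ ∈ (A.or B).legal ↔ Φ ∈ parLegal A B := Iff.rfl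

theorem production_legal {Φ : Position} (h : Φ ∈ (production P Q R).legal) :
    Φ.filterMap (lab true (strip [48, 46, 48, 46])) ∈ P.legal ∧
    ∀ σ : Slot, σ ≠ .given →
      Φ.filterMap (lab σ.treeFlip (strip σ.pre)) ∈ branchLegal (σ.inner P Q R) := by
  have h' := parLegal_iff.1 (mem_or_legal.1 h)
  have h0 := parLegal_iff.1 (mem_and_legal.1 (mem_neg_legal.1 h'.2.1))
  have h1 := parLegal_iff.1 (mem_and_legal.1 h0.2.2)
  simp only [filterMap_lab_strip] at h0 h1
  refine ⟨h0.2.1, ?_⟩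
  intro σ hσ
  cases σ
  · exact absurd rfl hσ
  all_goals first | exact h1.2.1 | exact h1.2.2 | exact h'.2.2

/-- In a legal position the component P of the antecedent has no addresses, so the dot follows at
once. Thus the tree attributed to the slot `given` consists of its root. -/
theorem production_given {Φ : Position} (h : Φ ∈ (production P Q R).legal) {p : Player} {m : Move}
    (hm : (p, [48, 46, 48] ++ m) ∈ Φ) : ∃ β, m = dot :: β := by
  have h' := parLegal_iff.1 (mem_or_legal.1 h)
  have h0 := parLegal_iff.1 (mem_and_legal.1 (mem_neg_legal.1 h'.2.1))
  simp only [filterMap_lab_strip] at h0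
  obtain ⟨b, α, hb⟩ := h0.1 (!p, 48 :: m) (mem_filterMap_lab.2
    ⟨[48, 46, 48] ++ m, by simpa using hm, by rw [strip_eq_some]; rfl⟩)
  simp only [List.cons_append, List.cons.injEq] at hb
  exact ⟨_, hb.2⟩

theorem production_concat {Φ : Position} (h : Φ ∈ (production P Q R).legal) {σ : Slot}
    (hσ : σ ≠ .given) {p : Player} {m : Move}
    (hm : Φ.filterMap (lab σ.treeFlip (strip σ.pre)) ++ [(xor σ.treeFlip p, m)] ∈
      branchLegal (σ.inner P Q R)) : Φ ++ [(p, σ.pre ++ m)] ∈ (production P Q R).legal := by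
  have h' := parLegal_iff.1 (mem_or_legal.1 h)
  have h0 := parLegal_iff.1 (mem_and_legal.1 (mem_neg_legal.1 h'.2.1))
  have e1 : Φ.filterMap (lab true (strip [48, 46, 49, 46])) ∈
      parLegal ((P.neg).or (P.and Q)).cbr (((R.or Q).neg).or R).cbr := by
    have := mem_and_legal.1 h0.2.2
    simp only [filterMap_lab_strip] at this
    exact this
  have key : ∀ {m : Move}, Φ.filterMap (lab true (strip [48, 46, 49, 46])) ++ [(!p, m)] ∈
      parLegal ((P.neg).or (P.and Q)).cbr (((R.or Q).neg).or R).cbr →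
      Φ ++ [(p, [48, 46, 49, 46] ++ m)] ∈ (production P Q R).legal := by
    intro m hm
    refine mem_or_legal.2 (parLegal_concat_false (mem_or_legal.1 h) (neg_legal_concat
      (mem_and_legal.2 (parLegal_concat_true (m := m)
        (mem_and_legal.1 (mem_neg_legal.1 h'.2.1)) ?_))))
    simp only [filterMap_lab_strip]
    exact hm
  cases σ
  · exact absurd rfl hσ
  case goal =>
    exact mem_or_legal.2 (parLegal_concat_true (mem_or_legal.1 h) (by cases p <;> exact hm))
  case anteP | consP | consQ =>
    refine key (m := [48, 46] ++ m) (parLegal_concat_false e1 ?_)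
    rw [filterMap_lab_strip]
    cases p <;> exact hm
  all_goals
    refine key (m := [49, 46] ++ m) (parLegal_concat_true e1 ?_)
    rw [filterMap_lab_strip]
    cases p <;> exact hm

theorem production_concat_given {Φ : Position} (h : Φ ∈ (production P Q R).legal) {p : Player}
    {m : Move} (hm : Φ.filterMap (lab true (strip [48, 46, 48, 46])) ++ [(!p, m)] ∈ P.legal) :
    Φ ++ [(p, [48, 46, 48, 46] ++ m)] ∈ (production P Q R).legal := by
  have h' := parLegal_iff.1 (mem_or_legal.1 h)
  refine mem_or_legal.2 (parLegal_concat_false (mem_or_legal.1 h) (neg_legal_concat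
    (mem_and_legal.2 (parLegal_concat_false (m := m)
      (mem_and_legal.1 (mem_neg_legal.1 h'.2.1)) ?_))))
  simp only [filterMap_lab_strip]
  exact hm

theorem inner_legal {Φ : Position} {σ : Slot} (h : Φ ∈ (σ.inner P Q R).legal) :
    Φ.filterMap (lab (xor σ.flip σ.treeFlip) (strip σ.suf)) ∈ (σ.game P Q R).legal := by
  have hid : Φ.filterMap (lab false (strip [])) = Φ := by
    have : lab false (strip []) = some := by funext x; simp [lab]
    rw [this, List.filterMap_some]
  cases σ
  case given => exact hid.symm ▸ h
  case goal => exact hid.symm ▸ h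
  case anteP =>
    simpa only [filterMap_lab_strip] using! mem_neg_legal.1 (parLegal_iff.1 (mem_or_legal.1 h)).2.1
  case consP =>
    simpa only [filterMap_lab_strip] using!
      (parLegal_iff.1 (mem_and_legal.1 (parLegal_iff.1 (mem_or_legal.1 h)).2.2)).2.1
  case consQ =>
    simpa only [filterMap_lab_strip] using!
      (parLegal_iff.1 (mem_and_legal.1 (parLegal_iff.1 (mem_or_legal.1 h)).2.2)).2.2
  case anteR =>
    simpa only [filterMap_lab_strip] using! (parLegal_iff.1 (mem_or_legal.1
      (mem_neg_legal.1 (parLegal_iff.1 (mem_or_legal.1 h)).2.1))).2.1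
  case anteQ =>
    simpa only [filterMap_lab_strip] using! (parLegal_iff.1 (mem_or_legal.1
      (mem_neg_legal.1 (parLegal_iff.1 (mem_or_legal.1 h)).2.1))).2.2
  case consR => exact (parLegal_iff.1 (mem_or_legal.1 h)).2.2

theorem inner_concat {Φ : Position} {σ : Slot} (h : Φ ∈ (σ.inner P Q R).legal) {p : Player}
    {m : Move} (hm : Φ.filterMap (lab (xor σ.flip σ.treeFlip) (strip σ.suf)) ++
      [(xor (xor σ.flip σ.treeFlip) p, m)] ∈ (σ.game P Q R).legal) :
    Φ ++ [(p, σ.suf ++ m)] ∈ (σ.inner P Q R).legal := by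
  have hid : Φ.filterMap (lab false (strip [])) = Φ := by
    have : lab false (strip []) = some := by funext x; simp [lab]
    rw [this, List.filterMap_some]
  cases σ
  case given => simpa [Slot.flip, Slot.treeFlip, Slot.suf, hid] using! hm
  case goal => simpa [Slot.flip, Slot.treeFlip, Slot.suf, hid] using! hm
  case anteP =>
    refine mem_or_legal.2 (parLegal_concat_false (mem_or_legal.1 h) (neg_legal_concat ?_))
    rw [filterMap_lab_strip]
    cases p <;> exact hm
  case consP =>
    refine mem_or_legal.2 (parLegal_concat_true (m := [48, 46] ++ m) (mem_or_legal.1 h)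
      (mem_and_legal.2 (parLegal_concat_false
      (mem_and_legal.1 (parLegal_iff.1 (mem_or_legal.1 h)).2.2) ?_)))
    rw [filterMap_lab_strip]
    cases p <;> exact hm
  case consQ =>
    refine mem_or_legal.2 (parLegal_concat_true (m := [49, 46] ++ m) (mem_or_legal.1 h)
      (mem_and_legal.2 (parLegal_concat_true
      (mem_and_legal.1 (parLegal_iff.1 (mem_or_legal.1 h)).2.2) ?_)))
    rw [filterMap_lab_strip]
    cases p <;> exact hm
  case anteR =>
    refine mem_or_legal.2 (parLegal_concat_false (m := [48, 46] ++ m) (mem_or_legal.1 h)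
      (neg_legal_concat (mem_or_legal.2 (parLegal_concat_false
      (mem_or_legal.1 (mem_neg_legal.1 (parLegal_iff.1 (mem_or_legal.1 h)).2.1)) ?_))))
    rw [filterMap_lab_strip, filterMap_lab_strip]
    cases p <;> exact hm
  case anteQ =>
    refine mem_or_legal.2 (parLegal_concat_false (m := [49, 46] ++ m) (mem_or_legal.1 h)
      (neg_legal_concat (mem_or_legal.2 (parLegal_concat_true
      (mem_or_legal.1 (mem_neg_legal.1 (parLegal_iff.1 (mem_or_legal.1 h)).2.1)) ?_))))
    rw [filterMap_lab_strip, filterMap_lab_strip]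
    cases p <;> exact hm
  case consR =>
    exact mem_or_legal.2 (parLegal_concat_true (mem_or_legal.1 h) (by cases p <;> exact hm))

end

end CoL

namespace CoL

/-! ### The moves at a slot -/

/-- The moves of `p` on which the partial map `g` is defined. -/
def mvs (p : Player) (Φ : Position) (g : Move → Option Move) : List Move :=
  Φ.filterMap fun x => if x.1 = p then g x.2 else none

theorem mv_filterMap_lab (p : Player) (φ : Bool) (g : Move → Option Move) (Φ : Position) :
    mv p (Φ.filterMap (lab φ g)) = mvs (xor φ p) Φ g := by
  unfold mv mvs
  rw [List.filterMap_filterMap]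
  congr 1
  funext x
  unfold lab
  cases hg : g x.2 with
  | none => simp
  | some α =>
    obtain ⟨q, m⟩ := x
    revert p φ q
    simp

theorem mvs_append (p : Player) (Φ Ψ : Position) (g : Move → Option Move) :
    mvs p (Φ ++ Ψ) g = mvs p Φ g ++ mvs p Ψ g := List.filterMap_append

theorem mvs_prefix (p : Player) {Φ Ψ : Position} (h : Φ <+: Ψ) (g : Move → Option Move) :
    mvs p Φ g <+: mvs p Ψ g := h.filterMap _

theorem mvs_label_of_ne {p q : Player} (h : p ≠ q) (l : List Move) (g : Move → Option Move) :
    mvs p (label q l) g = [] := by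
  simp [mvs, label, h.symm]

namespace Slot

/-- The node `u` has been replicated. -/
def Rep (σ : Slot) (Φ : Position) (u : List Bool) : Prop :=
  ∃ p, (p, σ.pre ++ (bits u ++ [colon])) ∈ Φ

/-- `u` is an actual node of the tree that belongs to the slot. -/
def Node (σ : Slot) (Φ : Position) (u : List Bool) : Prop :=
  u = [] ∨ ∃ w b, u = w ++ [b] ∧ σ.Rep Φ w

theorem Rep.mono {σ : Slot} {Φ Ψ : Position} {u : List Bool} (h : σ.Rep Φ u) (hs : Φ ⊆ Ψ) :
    σ.Rep Ψ u := h.imp fun _ h => hs h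

theorem Node.mono {σ : Slot} {Φ Ψ : Position} {u : List Bool} (h : σ.Node Φ u) (hs : Φ ⊆ Ψ) :
    σ.Node Ψ u := h.imp id fun ⟨w, b, h, hr⟩ => ⟨w, b, h, hr.mono hs⟩

theorem actualNode_iff {σ : Slot} {Φ : Position} {u : List Bool} {φ : Bool} :
    ActualNode (Φ.filterMap (lab φ (strip σ.pre))) u ↔ σ.Node Φ u := by
  unfold ActualNode Node Rep
  simp only [mem_filterMap_lab, strip_eq_some]
  refine or_congr Iff.rfl (exists_congr fun w => exists_congr fun b => and_congr_right fun _ => ?_)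
  constructor
  · rintro ⟨p, _, h, rfl⟩
    exact ⟨_, h⟩
  · rintro ⟨p, h⟩
    exact ⟨xor φ p, _, by simpa using h, rfl⟩

theorem ext_eq (σ : Slot) (v : ℕ → Bool) : σ.ext v = fun m =>
    (strip σ.pre m).bind fun m => (threadMove v m).bind (strip σ.suf) := by
  funext m
  rw [ext, Option.bind_assoc]

theorem ext_given_of_legal {P Q R : ConstGame} {Φ : Position}
    (h : Φ ∈ (production P Q R).legal) (v : ℕ → Bool) (φ : Bool) :
    Φ.filterMap (lab φ (given.ext v)) = Φ.filterMap (lab φ (strip [48, 46, 48, 46])) := by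
  refine List.filterMap_congr fun x hx => ?_
  unfold lab
  congr 1
  ext β
  rw [ext_eq_some, strip_eq_some]
  constructor
  · rintro ⟨u, -, hu⟩
    obtain ⟨p, m⟩ := x
    dsimp only at hu
    obtain ⟨β', hβ⟩ := production_given (p := p) (m := bits u ++ dot :: β) h (by
      rw [hu] at hx; simpa [full, pre, suf] using hx)
    cases u with
    | nil => rw [hu]; rfl
    | cons b u =>
      simp only [bits, List.map_cons, List.cons_append, List.cons.injEq] at hβ
      exact absurd hβ.1 (bitSym_ne_dot b)
  · intro hx
    exact ⟨[], initSeg_nil v, hx⟩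

section

variable {P Q R : ConstGame} {Φ : Position} (h : Φ ∈ (production P Q R).legal)

include h

theorem given_not_colon {p : Player} {u : List Bool} {β : Move} :
    (p, given.pre ++ (bits u ++ colon :: β)) ∉ Φ := by
  intro hm
  obtain ⟨β', hβ⟩ := production_given h hm
  cases u with
  | nil =>
    simp only [bits, List.map_nil, List.nil_append, List.cons.injEq] at hβ
    exact absurd hβ.1 (by decide)
  | cons b u =>
    simp only [bits, List.map_cons, List.cons_append, List.cons.injEq] at hβ
    exact absurd hβ.1 (bitSym_ne_dot b)

theorem legal_ext (σ : Slot) (v : ℕ → Bool) :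
    Φ.filterMap (lab σ.flip (σ.ext v)) ∈ (σ.game P Q R).legal := by
  by_cases hσ : σ = given
  · subst hσ
    rw [ext_given_of_legal h]
    exact (production_legal h).1
  · have := inner_legal (branchLegal_thread ((production_legal h).2 σ hσ) v)
    rw [filterMap_lab, filterMap_lab] at this
    have e : xor (xor (xor σ.flip σ.treeFlip) false) σ.treeFlip = σ.flip := by
      cases σ <;> rfl
    rw [e] at this
    rwa [ext_eq]

theorem dot_node {σ : Slot} {p : Player} {u : List Bool} {β : Move}
    (hm : (p, full (σ.place u) ++ β) ∈ Φ) : σ.Node Φ u := by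
  by_cases hσ : σ = given
  · subst hσ
    obtain ⟨β', hβ⟩ := production_given (p := p) (m := bits u ++ dot :: β) h (by
      simpa [full, pre, suf] using hm)
    cases u with
    | nil => exact .inl rfl
    | cons b u =>
      simp only [bits, List.map_cons, List.cons_append, List.cons.injEq] at hβ
      exact absurd hβ.1 (bitSym_ne_dot b)
  · rw [← actualNode_iff (φ := σ.treeFlip)]
    refine branchLegal_dot (p := xor σ.treeFlip p) (α := σ.suf ++ β)
      ((production_legal h).2 σ hσ) ?_
    rw [mem_filterMap_lab]
    exact ⟨_, by simpa using hm, by simp [full]⟩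

theorem colon_node {σ : Slot} {p : Player} {u : List Bool} {β : Move}
    (hm : (p, σ.pre ++ (bits u ++ colon :: β)) ∈ Φ) :
    β = [] ∧ p = σ.treeFlip ∧ σ.Node Φ u := by
  by_cases hσ : σ = given
  · subst hσ
    exact absurd hm (given_not_colon h)
  · rw [← actualNode_iff (φ := σ.treeFlip)]
    obtain ⟨h1, h2, h3⟩ := branchLegal_colon (p := xor σ.treeFlip p) (w := u) (α := β)
      ((production_legal h).2 σ hσ) (by
        rw [mem_filterMap_lab]
        exact ⟨_, by simpa using hm, by simp⟩)
    refine ⟨h1, ?_, h3⟩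
    revert h2
    cases σ.treeFlip <;> cases p <;> simp

theorem Node.replicated {σ : Slot} {w t : List Bool} (hw : σ.Node Φ (w ++ t)) (ht : t ≠ []) :
    σ.Rep Φ w := by
  by_cases hσ : σ = given
  · subst hσ
    rcases hw with hw | ⟨u, b, -, p, hp⟩
    · simp [ht] at hw
    · exact absurd hp (given_not_colon h)
  · rw [← actualNode_iff (φ := σ.treeFlip)] at hw
    have := branchLegal_replicated ((production_legal h).2 σ hσ) hw ht
    rw [mem_filterMap_lab] at this
    obtain ⟨m, hm, he⟩ := this
    rw [strip_eq_some.1 he] at hm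
    exact ⟨_, hm⟩

theorem Node.of_append {σ : Slot} {w t : List Bool} (hw : σ.Node Φ (w ++ t)) :
    σ.Node Φ w := by
  by_cases ht : t = []
  · subst ht; simpa using hw
  · obtain ⟨p, hp⟩ := Node.replicated h hw ht
    exact (colon_node h hp).2.2

/-- This reduces the legality of a move in the whole game to the legality of its last part in the
plays of the letter along all threads through the node. -/
theorem legal_dot {σ : Slot} {x : List Bool} {p : Player} {α : Move} (hx : σ.Node Φ x)
    (hl : ∀ v, InitSeg x v →
      Φ.filterMap (lab σ.flip (σ.ext v)) ++ [(xor σ.flip p, α)] ∈ (σ.game P Q R).legal) :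
    Φ ++ [(p, full (σ.place x) ++ α)] ∈ (production P Q R).legal := by
  by_cases hσ : σ = given
  · subst hσ
    have hx' : x = [] := by
      rcases hx with hx | ⟨u, b, -, p, hp⟩
      · exact hx
      · exact absurd hp (given_not_colon h)
    subst hx'
    have := hl (fun _ => false) (initSeg_nil _)
    rw [ext_given_of_legal h] at this
    refine production_concat_given h ?_
    cases p <;> exact this
  · have hb := (production_legal h).2 σ hσ
    have e : full (σ.place x) ++ α = σ.pre ++ (bits x ++ dot :: (σ.suf ++ α)) := by simp [full]
    rw [e]
    refine production_concat h hσ (branchLegal_concat.2 ⟨hb, .inr ⟨x, σ.suf ++ α,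
      actualNode_iff.2 hx, rfl, fun v hv => ?_⟩⟩)
    rw [threadLab_eq]
    refine inner_concat (branchLegal_thread hb v) ?_
    rw [filterMap_lab, filterMap_lab]
    have e : xor (xor (xor σ.flip σ.treeFlip) false) σ.treeFlip = σ.flip := by
      cases σ <;> rfl
    have e' : xor (xor σ.flip σ.treeFlip) (xor σ.treeFlip p) = xor σ.flip p := by
      cases σ <;> cases p <;> rfl
    dsimp only
    rw [e, e']
    have := hl v hv
    rwa [ext_eq] at this

theorem legal_colon {σ : Slot} (hσ : σ ≠ given) {x : List Bool} (hx : σ.Node Φ x)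
    (hn : ¬ σ.Rep Φ x) :
    Φ ++ [(σ.treeFlip, σ.pre ++ (bits x ++ [colon]))] ∈ (production P Q R).legal := by
  have hb := (production_legal h).2 σ hσ
  refine production_concat h hσ (branchLegal_concat.2 ⟨hb, .inl ⟨by simp, x, ?_, rfl⟩⟩)
  refine branchLegal_leaf hb (actualNode_iff.2 hx) fun hm => hn ?_
  rw [mem_filterMap_lab] at hm
  obtain ⟨m, hm, he⟩ := hm
  rw [strip_eq_some.1 he] at hm
  exact ⟨_, hm⟩

end

/-- Unlike in `colon_node`, the node is actual already before the move; this is what orders the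
replication of a parent before that of its child. -/
theorem colon_node_last {P Q R : ConstGame} {Φ : Position} {σ : Slot} {p : Player}
    {u : List Bool} (hσ : σ ≠ given)
    (h : Φ ++ [(p, σ.pre ++ (bits u ++ [colon]))] ∈ (production P Q R).legal) : σ.Node Φ u := by
  have hb := (production_legal h).2 σ hσ
  rw [filterMap_lab_concat_some (strip_append _ _), branchLegal_concat] at hb
  exact actualNode_iff.1 (branchMove_colon hb.2).2.2.1

end Slot

/-! ### Combs -/

@[simp]
theorem length_zeros (n : ℕ) : (zeros n).length = n := by simp [zeros]

theorem zeros_eq_replicate (n : ℕ) : zeros n = List.replicate n false := by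
  simp [zeros, List.map_const']

@[simp]
theorem zeros_succ (n : ℕ) : zeros (n + 1) = false :: zeros n := by
  simp [zeros_eq_replicate, List.replicate_succ]

@[simp]
theorem zeros_zero : zeros 0 = [] := rfl

@[simp]
theorem comb_zero : comb 0 = [true] := rfl

@[simp]
theorem comb_succ (n : ℕ) : comb (n + 1) = false :: comb n := by simp [comb]

@[simp]
theorem length_comb (n : ℕ) : (comb n).length = n + 1 := by simp [comb]

theorem zeros_add (m n : ℕ) : zeros (m + n) = zeros m ++ zeros n := by
  simp only [zeros_eq_replicate, List.replicate_add]

/-- The words 0ⁿ1 form a prefix code, so the number of the copy and the node inside it are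
determined by the address. -/
theorem comb_append_inj {m n : ℕ} {u u' : List Bool} (h : comb m ++ u = comb n ++ u') :
    m = n ∧ u = u' := by
  induction m generalizing n with
  | zero => cases n <;> simp_all
  | succ m ih =>
    cases n with
    | zero => simp at h
    | succ n =>
      obtain ⟨rfl, h'⟩ := ih (n := n) (by simpa using h)
      exact ⟨rfl, h'⟩

theorem comb_append_ne_zeros {m n : ℕ} {u : List Bool} : comb m ++ u ≠ zeros n := by
  intro h
  have : true ∈ zeros n := h ▸ by simp [comb]
  simp [zeros_eq_replicate] at this

theorem initSeg_comb_append {m n : ℕ} {u : List Bool} {v : ℕ → Bool} :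
    InitSeg (comb m ++ u) (cat (comb n) v) ↔ m = n ∧ InitSeg u v := by
  constructor
  · intro h
    obtain ⟨v', hv'⟩ := h.exists_cat
    have key : ∀ m n : ℕ, ∀ v v' : ℕ → Bool, cat (comb n) v = cat (comb m) v' → m = n := by
      intro m
      induction m with
      | zero =>
        intro n v v' hv
        cases n with
        | zero => rfl
        | succ n => simpa [cat] using congrFun hv 0
      | succ m ih =>
        intro n v v' hv
        cases n with
        | zero => simpa [cat] using congrFun hv 0
        | succ n =>
          rw [ih n v v' (funext fun i => by simpa [cat] using congrFun hv (i + 1))]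
    rw [cat_append] at hv'
    obtain rfl := key _ _ _ _ hv'
    exact ⟨rfl, initSeg_cat_append.1 h⟩
  · rintro ⟨rfl, h⟩
    exact initSeg_cat_append.2 h

/-- The string is empty or ends with `1`. -/
def OneEnded (s : List Bool) : Prop := ¬ s.reverse.head? = some false

theorem oneEnded_nil : OneEnded [] := by simp [OneEnded]

theorem oneEnded_comb (s : List Bool) (k : ℕ) : OneEnded (s ++ comb k) := by
  simp [OneEnded, comb]

/-- Dropping the last 1 and the zeros before it recovers `s`, provided that `s` does not itself end
with 0. It follows that the consequent R of a copy is called for by only one antecedent R; without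
`OneEnded`, the copy for 01 would have to serve both the empty string and 0. -/
theorem append_comb_inj {s s' : List Bool} {k k' : ℕ} (hs : OneEnded s) (hs' : OneEnded s')
    (h : s ++ comb k = s' ++ comb k') : s = s' ∧ k = k' := by
  have key : ∀ {k k' : ℕ} {r r' : List Bool}, ¬ r.head? = some false → ¬ r'.head? = some false →
      zeros k ++ r = zeros k' ++ r' → r = r' ∧ k = k' := by
    intro k
    induction k with
    | zero =>
      intro k' r r' hr hr' h
      cases k' with
      | zero => exact ⟨by simpa using h, rfl⟩
      | succ k' => simp only [zeros_zero, List.nil_append] at h; simp [h] at hr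
    | succ k ih =>
      intro k' r r' hr hr' h
      cases k' with
      | zero => simp only [zeros_zero, List.nil_append] at h; simp [← h] at hr'
      | succ k' =>
        obtain ⟨h1, h2⟩ := ih hr hr' (by simpa using h)
        exact ⟨h1, by rw [h2]⟩
  have hrev : ∀ n, (zeros n).reverse = zeros n := by simp [zeros_eq_replicate]
  have h' := congrArg List.reverse h
  simp only [comb, List.reverse_append, hrev, List.reverse_cons, List.reverse_nil, List.nil_append,
    List.cons_append, List.cons.injEq, true_and] at h'
  obtain ⟨h1, h2⟩ := key hs hs' h'
  exact ⟨List.reverse_injective h1, h2⟩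

end CoL

namespace CoL

open Encodable

/-! ### The tasks of the machine -/

theorem bitsOf_bits (u : List Bool) : bitsOf (bits u) = u := by
  induction u with
  | nil => rfl
  | cons b u ih =>
    have : bitsOf (bits (b :: u)) = b :: bitsOf (bits u) := by
      cases b <;> simp [bitsOf, bits, bitSym]
    rw [this, ih]

theorem repNode_eq_some {m : Move} {u : List Bool} :
    repNode m = some u ↔ m = Slot.goal.pre ++ (bits u ++ [colon]) := by
  have key : ∀ u, (bitsOf (Slot.goal.pre ++ (bits u ++ [colon]))).tail = u := by
    intro u
    have : bitsOf (Slot.goal.pre ++ (bits u ++ [colon])) = true :: bitsOf (bits u) := by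
      simp [bitsOf, Slot.pre, colon]
    rw [this, bitsOf_bits, List.tail_cons]
  unfold repNode
  constructor
  · intro h
    split_ifs at h with h'
    rw [← Option.some.inj h]; exact h'
  · rintro rfl
    rw [key, if_pos rfl]

theorem mem_splits {w : List Bool} {d : List Bool × List Bool} :
    d ∈ splits w ↔ d.1 ++ d.2 = w := by
  simp only [splits, List.mem_map, List.mem_range]
  constructor
  · rintro ⟨i, -, rfl⟩
    exact List.take_append_drop i w
  · intro h
    refine ⟨d.1.length, ?_, ?_⟩
    · rw [← h, List.length_append]; omega
    · rw [← h]; simp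

/-- `w` is a leaf of the goal. -/
def GoalLeaf (S : Position) (w : List Bool) : Prop := Slot.goal.Node S w ∧ ¬ Slot.goal.Rep S w

theorem mem_leaves {S : Position} {w : List Bool} : w ∈ leaves S ↔ GoalLeaf S w := by
  simp only [leaves, List.mem_filterMap, List.length_eq_zero_iff, List.filterMap_eq_nil_iff,
    List.mem_cons, List.mem_flatMap, Option.mem_toList, repNode_eq_some]
  constructor
  · rintro ⟨u, hu, h⟩
    split_ifs at h with h'
    obtain rfl := Option.some.inj h
    refine ⟨?_, ?_⟩
    · rcases hu with rfl | ⟨x, hx, w, hw, hu⟩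
      · exact .inl rfl
      · have hr : Slot.goal.Rep S w := ⟨x.1, by rw [← hw]; exact hx⟩
        rcases hu with rfl | rfl | h
        · exact .inr ⟨w, _, rfl, hr⟩
        · exact .inr ⟨w, _, rfl, hr⟩
        · simp at h
    · rintro ⟨p, hp⟩
      simpa using h' _ hp
  · rintro ⟨h1, h2⟩
    refine ⟨w, ?_, ?_⟩
    · rcases h1 with h1 | ⟨u, b, rfl, p, hp⟩
      · exact .inl h1
      · refine .inr ⟨_, hp, u, rfl, ?_⟩
        cases b <;> simp
    · rw [if_pos]
      intro x hx
      rw [if_neg]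
      intro he
      exact h2 ⟨x.1, by rw [← he]; exact hx⟩

/-- The pairs of nodes between which moves are copied. -/
inductive Pair (n : ℕ) (S : Position) : Slot → List Bool → Slot → List Bool → Prop
  | given : Pair n S .anteP (comb 0) .given []
  | produce (i : ℕ) : i < n → Pair n S .anteP (comb (i + 1)) .consP (comb i)
  | supply (s : List Bool) (k : ℕ) : GoalLeaf S (s ++ zeros k) → encode s ≤ n →
      Pair n S .anteQ (loc s (zeros k)) .consQ (comb (encode s))
  | chain (s : List Bool) (k : ℕ) (u : List Bool) : OneEnded s → GoalLeaf S (s ++ (comb k ++ u)) →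
      encode s ≤ n → encode (s ++ comb k) ≤ n →
      Pair n S .anteR (loc s (comb k ++ u)) .consR (loc (s ++ comb k) u)
  | goal (w : List Bool) : GoalLeaf S w → Pair n S .goal w .consR (loc [] w)

theorem mem_pairs {n : ℕ} {S : Position} {c : Place × Place} :
    c ∈ pairs n S ↔ ∃ σ x τ y, Pair n S σ x τ y ∧ c = (σ.place x, τ.place y) := by
  simp only [pairs, List.mem_cons, List.mem_append, List.mem_map, List.mem_range, List.mem_flatMap,
    mem_leaves, mem_splits]
  constructor
  · rintro (rfl | ⟨i, hi, rfl⟩ | ⟨w, hw, rfl | ⟨⟨s, u⟩, rfl, hc⟩⟩)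
    · exact ⟨_, _, _, _, .given, rfl⟩
    · exact ⟨_, _, _, _, .produce i hi, rfl⟩
    · exact ⟨_, _, _, _, .goal w hw, rfl⟩
    · by_cases h1 : encode s ≤ n
      · rw [if_pos h1] at hc
        rcases List.mem_append.1 hc with hc | hc
        · split_ifs at hc with h2
          · obtain rfl := List.mem_singleton.1 hc
            dsimp only at h1 h2 hw ⊢
            rw [h2] at hw ⊢
            exact ⟨_, _, _, _, .supply s _ hw h1, rfl⟩
          · simp at hc
        · obtain ⟨⟨z, u'⟩, hz, hc⟩ := List.mem_flatMap.1 hc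
          rw [mem_splits] at hz
          dsimp only at hz hc h1 hw
          split_ifs at hc with h2
          · obtain rfl := List.mem_singleton.1 hc
            subst hz
            obtain ⟨h2, h3, h4⟩ := h2
            rw [h2] at hw h4 ⊢
            exact ⟨_, _, _, _, .chain s _ u' h3 hw h1 h4, rfl⟩
          · simp at hc
      · rw [if_neg h1] at hc
        simp at hc
  · rintro ⟨σ, x, τ, y, h, rfl⟩
    cases h with
    | given => exact .inl rfl
    | produce i hi => exact .inr (.inl ⟨i, hi, rfl⟩)
    | goal w hw => exact .inr (.inr ⟨_, hw, .inl rfl⟩)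
    | supply s k hl hs =>
      refine .inr (.inr ⟨_, hl, .inr ⟨(s, zeros k), rfl, ?_⟩⟩)
      rw [if_pos hs]
      exact List.mem_append_left _ (by simp)
    | chain s k u h1 hl hs hk =>
      refine .inr (.inr ⟨_, hl, .inr ⟨(s, comb k ++ u), rfl, ?_⟩⟩)
      rw [if_pos hs]
      refine List.mem_append_right _ (List.mem_flatMap.2 ⟨(comb k, u), mem_splits.2 rfl, ?_⟩)
      rw [if_pos ⟨by simp, h1, hk⟩]
      exact List.mem_singleton_self _

/-- Copying goes both ways. -/
def Linked (n : ℕ) (S : Position) (σ : Slot) (x : List Bool) (τ : Slot) (y : List Bool) : Prop :=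
  Pair n S σ x τ y ∨ Pair n S τ y σ x

theorem mem_pushTasks {n : ℕ} {S : Position} {t : Task} :
    t ∈ pushTasks n S ↔ ∃ σ x τ y α, Linked n S σ x τ y ∧
      (hits environment S (pats (σ.place x)))[(hits machine S (pats (τ.place y))).length]? =
        some α ∧
      t = (full (τ.place y) ++ α, pats (τ.place y), (hits machine S (pats (τ.place y))).length) := by
  simp only [pushTasks, List.mem_flatMap, mem_pairs, List.mem_append, push, List.mem_map,
    Option.mem_toList]
  constructor
  · rintro ⟨_, ⟨σ, x, τ, y, h, rfl⟩, ⟨α, hα, rfl⟩ | ⟨α, hα, rfl⟩⟩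
    · exact ⟨σ, x, τ, y, α, .inl h, hα, rfl⟩
    · exact ⟨τ, y, σ, x, α, .inr h, hα, rfl⟩
  · rintro ⟨σ, x, τ, y, α, h | h, hα, rfl⟩
    · exact ⟨_, ⟨_, _, _, _, h, rfl⟩, .inl ⟨α, hα, rfl⟩⟩
    · exact ⟨_, ⟨_, _, _, _, h, rfl⟩, .inr ⟨α, hα, rfl⟩⟩

theorem mem_repTasks {n : ℕ} {S : Position} {t : Task} : t ∈ repTasks n S ↔
    ∃ s u, Slot.goal.Rep S (s ++ u) ∧ encode s ≤ n ∧ t = repTask Slot.consR.pre (loc s u) := by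
  simp only [repTasks, List.mem_flatMap, Option.mem_toList, repNode_eq_some, mem_splits]
  constructor
  · rintro ⟨⟨p, m⟩, hx, w, hw, ⟨s, u⟩, rfl, h⟩
    split_ifs at h with hs
    · dsimp only at hw
      rw [hw] at hx
      exact ⟨s, u, ⟨p, hx⟩, hs, List.mem_singleton.1 h⟩
    · simp at h
  · rintro ⟨s, u, ⟨p, hp⟩, hs, rfl⟩
    refine ⟨_, hp, s ++ u, rfl, (s, u), rfl, ?_⟩
    rw [if_pos hs]
    exact List.mem_singleton_self _

/-- For the task list this means that everything generated by earlier moves of the snapshot stands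
earlier in the queue. -/
theorem exists_split_of_flatMap_eq {α β : Type*} {f : α → List β} {l : List α} {d q : List β}
    {t : β} (h : d ++ t :: q = l.flatMap f) :
    ∃ l₁ x l₂, l = l₁ ++ x :: l₂ ∧ t ∈ f x ∧ ∀ y ∈ l₁, ∀ t' ∈ f y, t' ∈ d := by
  induction l generalizing d with
  | nil => simp at h
  | cons x l ih =>
    rw [List.flatMap_cons] at h
    rcases List.append_eq_append_iff.1 h with ⟨c, h1, h2⟩ | ⟨c, h1, h2⟩
    · cases c with
      | nil =>
        obtain ⟨l₁, y, l₂, rfl, hy, hd⟩ := ih (d := []) (by simpa using h2)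
        refine ⟨x :: l₁, y, l₂, rfl, hy, ?_⟩
        intro z hz t' ht'
        rcases List.mem_cons.1 hz with rfl | hz
        · rw [h1] at ht'; simpa using ht'
        · exact absurd (hd z hz t' ht') (by simp)
      | cons t₀ c =>
        simp only [List.cons_append, List.cons.injEq] at h2
        refine ⟨[], x, l, rfl, ?_, by simp⟩
        rw [h1, h2.1]; simp
    · obtain ⟨l₁, y, l₂, rfl, hy, hd⟩ := ih (d := c) h2.symm
      refine ⟨x :: l₁, y, l₂, rfl, hy, ?_⟩
      intro z hz t' ht'
      rw [h1]
      rcases List.mem_cons.1 hz with rfl | hz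
      · exact List.mem_append_left _ ht'
      · exact List.mem_append_right _ (hd z hz t' ht')

/-- The kinds of tasks, with the tasks that come before them in the list. -/
theorem sync_cases {P Q R : ConstGame} {n : ℕ} {S : Position}
    (hS : S ∈ (production P Q R).legal) {d q : List Task} {t : Task}
    (h : d ++ t :: q = sync n S) :
    t = repTask Slot.consP.pre (zeros n) ∨ t = repTask Slot.consR.pre (zeros n) ∨
    repTask Slot.consP.pre (zeros n) ∈ d ∧ repTask Slot.consR.pre (zeros n) ∈ d ∧
      ((∃ s u, Slot.goal.Rep S (s ++ u) ∧ encode s ≤ n ∧ t = repTask Slot.consR.pre (loc s u) ∧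
        ∀ u' b, u = u' ++ [b] → repTask Slot.consR.pre (loc s u') ∈ d) ∨
      t ∈ pushTasks n S ∧ ∀ t' ∈ repTasks n S, t' ∈ d) := by
  unfold sync at h
  rcases d with _ | ⟨t₁, d⟩
  · simp only [List.nil_append, List.cons.injEq] at h
    exact .inl h.1
  rcases d with _ | ⟨t₂, d⟩
  · simp only [List.nil_append, List.cons_append, List.cons.injEq] at h
    exact .inr (.inl h.2.1)
  simp only [List.cons_append, List.cons.injEq] at h
  obtain ⟨rfl, rfl, h⟩ := h
  refine .inr (.inr ⟨by simp, by simp, ?_⟩)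
  rcases List.append_eq_append_iff.1 h with ⟨c, h1, h2⟩ | ⟨c, h1, h2⟩
  · cases c with
    | nil =>
      right
      refine ⟨by rw [List.nil_append] at h2; rw [← h2]; simp, fun t' ht' => ?_⟩
      rw [h1, List.append_nil] at ht'
      simp [ht']
    | cons t₀ c =>
      simp only [List.cons_append, List.cons.injEq] at h2
      obtain ⟨rfl, -⟩ := h2
      left
      obtain ⟨l₁, ⟨p, m⟩, l₂, rfl, ht, hd⟩ := exists_split_of_flatMap_eq h1.symm
      simp only [List.mem_flatMap, Option.mem_toList, repNode_eq_some, mem_splits] at ht hd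
      obtain ⟨w, rfl, ⟨s, u⟩, rfl, ht⟩ := ht
      split_ifs at ht with hs
      · refine ⟨s, u, ⟨p, by simp⟩, hs, List.mem_singleton.1 ht, ?_⟩
        rintro u' b rfl
        -- Since the snapshot is legal, the environment replicated the parent `s ++ u'` in the goal
        -- before `s ++ (u' ++ [b])`, so the task for the parent's counterpart is among the earlier
        -- ones.
        have hnode := Slot.colon_node_last (P := P) (Q := Q) (R := R) (Φ := l₁) (p := p)
          (σ := .goal) (u := s ++ (u' ++ [b])) (by simp)
          ((production P Q R).closed _ hS _ ⟨l₂, by simp⟩)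
        rcases hnode with h0 | ⟨w, b', hw, p', hp'⟩
        · simp at h0
        · rw [← List.append_assoc] at hw
          obtain ⟨rfl, -⟩ := List.append_inj' hw rfl
          refine List.mem_cons_of_mem _ (List.mem_cons_of_mem _ (hd _ hp' _
            ⟨_, rfl, (s, u'), rfl, ?_⟩))
          rw [if_pos hs]
          exact List.mem_singleton_self _
      · simp at ht
  · right
    refine ⟨by rw [h2]; simp, fun t' ht' => ?_⟩
    rw [h1]
    simp [ht']

theorem mem_sync {n : ℕ} {S : Position} {t : Task} : t ∈ sync n S ↔
    t = repTask Slot.consP.pre (zeros n) ∨ t = repTask Slot.consR.pre (zeros n) ∨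
      t ∈ repTasks n S ∨ t ∈ pushTasks n S := by
  simp [sync]

/-! ### Virtual trees -/

/-- The nodes of the trees after the nodes of the goal have been copied. -/
def VNode (S : Position) (σ : Slot) (u : List Bool) : Prop :=
  match σ with
  | .given => u = []
  | .anteP | .consP | .consQ => ∃ i, u = zeros i ∨ u = comb i
  | .anteR | .anteQ | .consR =>
    (∃ i, u = zeros i ∨ u = comb i) ∨ ∃ s t, u = loc s t ∧ Slot.goal.Node S (s ++ t)
  | .goal => Slot.goal.Node S u

/-- A virtual node without proper extensions. -/
def VLeaf (S : Position) (σ : Slot) (x : List Bool) : Prop :=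
  VNode S σ x ∧ ∀ t, VNode S σ (x ++ t) → t = []

/-- The replicated nodes in the copies come from replicated nodes of the goal. -/
structure RepsFrom (S Φ : Position) : Prop where
  left : ∀ x, Slot.consP.Rep Φ x → ∃ i, x = zeros i
  right : ∀ x, Slot.consR.Rep Φ x →
    (∃ i, x = zeros i) ∨ ∃ s u, x = loc s u ∧ Slot.goal.Rep S (s ++ u)

theorem zeros_concat (i : ℕ) (b : Bool) :
    zeros i ++ [b] = zeros (i + 1) ∨ zeros i ++ [b] = comb i := by
  cases b
  · left; rw [zeros_add]; rfl
  · right; rfl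

/-- Nodes other than the root are children of replicated nodes. The children of 0ⁱ are 0ⁱ⁺¹ and
`comb i`, and those of `loc s u` correspond to children of the replicated goal node `s ++ u`. -/
theorem RepsFrom.vnode {P Q R : ConstGame} {S Φ : Position} (h : RepsFrom S Φ)
    (hΦ : Φ ∈ (production P Q R).legal) {σ : Slot} (hσ : σ ≠ .goal) {u : List Bool}
    (hu : σ.Node Φ u) : VNode S σ u := by
  have left : Slot.consP.Node Φ u → ∃ i, u = zeros i ∨ u = comb i := by
    rintro (rfl | ⟨w, b, rfl, hw⟩)
    · exact ⟨0, .inl rfl⟩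
    · obtain ⟨i, rfl⟩ := h.left w hw
      rcases zeros_concat i b with e | e
      · exact ⟨_, .inl e⟩
      · exact ⟨_, .inr e⟩
  have right : Slot.consR.Node Φ u → (∃ i, u = zeros i ∨ u = comb i) ∨
      ∃ s t, u = loc s t ∧ Slot.goal.Node S (s ++ t) := by
    rintro (rfl | ⟨w, b, rfl, hw⟩)
    · exact .inl ⟨0, .inl rfl⟩
    · rcases h.right w hw with ⟨i, rfl⟩ | ⟨s, t, rfl, ht⟩
      · left
        rcases zeros_concat i b with e | e
        · exact ⟨_, .inl e⟩
        · exact ⟨_, .inr e⟩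
      · right
        exact ⟨s, t ++ [b], by simp [loc], .inr ⟨s ++ t, b, by simp, ht⟩⟩
  cases σ
  case given =>
    rcases hu with hu | ⟨w, b, rfl, p, hp⟩
    · exact hu
    · exact absurd hp (Slot.given_not_colon hΦ)
  case goal => exact absurd rfl hσ
  case anteP | consP | consQ => exact left hu
  all_goals exact right hu

theorem GoalLeaf.eq_nil {P Q R : ConstGame} {S : Position} (hS : S ∈ (production P Q R).legal)
    {w t : List Bool} (h : GoalLeaf S w) (ht : Slot.goal.Node S (w ++ t)) : t = [] := by
  by_contra hne
  exact h.2 (Slot.Node.replicated hS ht hne)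

theorem comb_append_eq_nil_of {i j : ℕ} {t : List Bool}
    (h : comb i ++ t = zeros j ∨ comb i ++ t = comb j) : t = [] := by
  rcases h with h | h
  · exact absurd h comb_append_ne_zeros
  · exact (comb_append_inj (h.trans (List.append_nil _).symm)).2

/-- By the prefix code property, a virtual node extending `loc s u` lies in the same copy and
mirrors a goal node that extends the leaf `s ++ u`. -/
theorem vLeaf_loc {P Q R : ConstGame} {S : Position} (hS : S ∈ (production P Q R).legal)
    {s u : List Bool} (h : GoalLeaf S (s ++ u)) : VLeaf S .consR (loc s u) := by
  refine ⟨.inr ⟨s, u, rfl, h.1⟩, ?_⟩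
  rintro t (⟨i, hi⟩ | ⟨s', u', he, hn⟩)
  · unfold loc at hi
    rw [List.append_assoc] at hi
    exact (List.append_eq_nil_iff.1 (comb_append_eq_nil_of hi)).2
  · unfold loc at he
    rw [List.append_assoc] at he
    obtain ⟨h1, rfl⟩ := comb_append_inj he
    obtain rfl := encode_injective h1
    rw [← List.append_assoc] at hn
    exact h.eq_nil hS hn

theorem vLeaf_comb {S : Position} (i : ℕ) : VLeaf S .consP (comb i) :=
  ⟨⟨i, .inr rfl⟩, fun _ ⟨_, h⟩ => comb_append_eq_nil_of h⟩

theorem Linked.symm {n : ℕ} {S : Position} {σ τ : Slot} {x y : List Bool}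
    (h : Linked n S σ x τ y) : Linked n S τ y σ x := Or.symm h

theorem Linked.vLeaf {P Q R : ConstGame} {n : ℕ} {S : Position}
    (hS : S ∈ (production P Q R).legal) {σ τ : Slot} {x y : List Bool}
    (h : Linked n S σ x τ y) : VLeaf S τ y := by
  rcases h with h | h
  · cases h with
    | given => exact ⟨rfl, fun t ht => ht⟩
    | produce i hi => exact vLeaf_comb i
    | goal w hw => exact vLeaf_loc hS (s := []) hw
    | supply s k hl hs => exact vLeaf_comb (S := S) _
    | chain s k u h1 hl hs hk => exact vLeaf_loc hS (by simpa using hl)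
  · cases h with
    | given => exact vLeaf_comb (S := S) _
    | produce i hi => exact vLeaf_comb (S := S) _
    | goal w hw => exact ⟨hw.1, fun t ht => hw.eq_nil hS ht⟩
    | supply s k hl hs => exact vLeaf_loc hS hl
    | chain s k u h1 hl hs hk => exact vLeaf_loc hS hl

theorem mem_pats {σ : Slot} {x : List Bool} {t : Move} :
    t ∈ pats (σ.place x) ↔ ∃ u, u <+: x ∧ t = full (σ.place u) := by
  simp only [pats, List.mem_map, List.mem_range]
  constructor
  · rintro ⟨i, -, rfl⟩
    exact ⟨_, List.take_prefix _ _, rfl⟩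
  · rintro ⟨u, ⟨r, rfl⟩, rfl⟩
    exact ⟨u.length, by simp, by simp⟩

theorem head?_eq_some_of_forall {α : Type*} {l : List α} {a : α} (h : ∀ b ∈ l, b = a)
    (ha : a ∈ l) : l.head? = some a := by
  cases l with
  | nil => simp at ha
  | cons b l => rw [List.head?_cons, h b (by simp)]

/-- A node on a thread through `x` either is an initial segment of `x`, hence covered by the
patterns, or extends `x`, hence equals `x` because `x` is a virtual leaf. The finitely many patterns
therefore compute the moves of the infinite thread. All patterns matching a move leave the same
remainder, so taking the first match loses nothing. -/
theorem hits_pats {S Φ : Position} {σ : Slot} {x : List Bool} (hx : VLeaf S σ x) {p : Player}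
    (hΦ : ∀ u β, (p, full (σ.place u) ++ β) ∈ Φ → VNode S σ u) {v : ℕ → Bool}
    (hv : InitSeg x v) : hits p Φ (pats (σ.place x)) = mvs p Φ (σ.ext v) := by
  refine List.filterMap_congr fun z hz => ?_
  obtain ⟨q, m⟩ := z
  by_cases hq : q = p
  swap
  · rw [if_neg hq, if_neg hq]
  subst hq
  rw [if_pos rfl, if_pos rfl]
  dsimp only
  have hmem : ∀ β, β ∈ (pats (σ.place x)).filterMap (fun t => strip t m) ↔
      ∃ u, u <+: x ∧ m = full (σ.place u) ++ β := by
    intro β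
    simp only [List.mem_filterMap, mem_pats, strip_eq_some]
    constructor
    · rintro ⟨_, ⟨u, hu, rfl⟩, rfl⟩
      exact ⟨u, hu, rfl⟩
    · rintro ⟨u, hu, rfl⟩
      exact ⟨_, ⟨u, hu, rfl⟩, rfl⟩
  cases he : σ.ext v m with
  | none =>
    rw [List.head?_eq_none_iff, List.eq_nil_iff_forall_not_mem]
    intro β hβ
    obtain ⟨u, hu, hm⟩ := (hmem β).1 hβ
    have := Slot.ext_eq_some.2 ⟨u, hv.of_prefix hu, hm⟩
    simp [he] at this
  | some β =>
    obtain ⟨u, hu, hm⟩ := Slot.ext_eq_some.1 he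
    refine head?_eq_some_of_forall ?_ ?_
    · intro β' hβ'
      obtain ⟨u', -, hm'⟩ := (hmem β').1 hβ'
      exact (Slot.full_inj (hm'.symm.trans hm)).2.2
    · rw [hmem]
      refine ⟨u, ?_, hm⟩
      rcases hu.total hv with h | ⟨t, rfl⟩
      · exact h
      · rw [hm] at hz
        rw [hx.2 t (hΦ _ _ hz)]
        simp

/-! ### Threads that are kept equal by copying -/

/-- The infinite string of zeros. -/
def zeroStr : ℕ → Bool := fun _ => false

/-- The pairs of threads that are kept equal by copying moves. -/
inductive Mate : Slot → (ℕ → Bool) → Slot → (ℕ → Bool) → Prop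
  | given (v v' : ℕ → Bool) : Mate .anteP (cat (comb 0) v) .given v'
  | produce (n : ℕ) (v : ℕ → Bool) :
      Mate .anteP (cat (comb (n + 1)) v) .consP (cat (comb n) v)
  | supply (n : ℕ) (v : ℕ → Bool) :
      Mate .anteQ (cat (comb n) zeroStr) .consQ (cat (comb n) v)
  | chain (s : List Bool) (k : ℕ) (v : ℕ → Bool) : OneEnded s →
      Mate .anteR (cat (comb (encode s)) (cat (comb k) v)) .consR
        (cat (comb (encode (s ++ comb k))) v)
  | goal (v : ℕ → Bool) : Mate .goal v .consR (cat (comb (encode ([] : List Bool))) v)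

/-- Either order of the threads of a pair. -/
def Mated (σ : Slot) (v : ℕ → Bool) (τ : Slot) (v' : ℕ → Bool) : Prop :=
  Mate σ v τ v' ∨ Mate τ v' σ v

theorem Mated.symm {σ τ : Slot} {v v' : ℕ → Bool} (h : Mated σ v τ v') : Mated τ v' σ v :=
  Or.symm h

theorem Mated.flip {σ τ : Slot} {v v' : ℕ → Bool} (h : Mated σ v τ v') : τ.flip = !σ.flip := by
  rcases h with h | h <;> cases h <;> rfl

theorem Mated.game {σ τ : Slot} {v v' : ℕ → Bool} (h : Mated σ v τ v') (P Q R : ConstGame) :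
    τ.game P Q R = σ.game P Q R := by
  rcases h with h | h <;> cases h <;> rfl

theorem initSeg_comb {m n : ℕ} {v : ℕ → Bool} : InitSeg (comb m) (cat (comb n) v) ↔ m = n := by
  have := initSeg_comb_append (m := m) (n := n) (u := []) (v := v)
  simpa [initSeg_nil] using this

theorem initSeg_zeros (k : ℕ) : InitSeg (zeros k) zeroStr := by
  intro i hi
  simp [zeros_eq_replicate, zeroStr]

theorem append_comb_ne_nil (s : List Bool) (k : ℕ) : s ++ comb k ≠ [] := by simp [comb]

/-- The finite links and the infinite mates agree: whenever a thread through one end of a link has a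
mate, this mate passes through the other end. So a copied move never disturbs a thread that is to be
kept equal to something else. -/
theorem Linked.mated {n : ℕ} {S : Position} {σ τ ρ : Slot} {x y : List Bool} {v v' : ℕ → Bool}
    (h : Linked n S σ x τ y) (hm : Mated σ v ρ v') (hx : InitSeg x v) :
    ρ = τ ∧ InitSeg y v' := by
  rcases h with h | h
  · cases h with
    | given =>
      rcases hm with hm | hm <;> cases hm
      · exact ⟨rfl, initSeg_nil _⟩
      · exact absurd (initSeg_comb.1 hx) (by omega)
    | produce i hi =>
      rcases hm with hm | hm <;> cases hm
      · exact absurd (initSeg_comb.1 hx) (by omega)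
      · exact ⟨rfl, initSeg_comb.2 (by have := initSeg_comb.1 hx; omega)⟩
    | goal w hw =>
      rcases hm with hm | hm <;> cases hm
      exact ⟨rfl, initSeg_comb_append.2 ⟨rfl, hx⟩⟩
    | supply s k hl hs =>
      rcases hm with hm | hm <;> cases hm
      exact ⟨rfl, initSeg_comb.2 (initSeg_comb_append.1 hx).1⟩
    | chain s k u h1 hl hs hk =>
      rcases hm with hm | hm <;> cases hm
      obtain ⟨h2, h3⟩ := initSeg_comb_append.1 hx
      obtain ⟨rfl, h4⟩ := initSeg_comb_append.1 h3
      obtain rfl := encode_injective h2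
      exact ⟨rfl, initSeg_comb_append.2 ⟨rfl, h4⟩⟩
  · cases h with
    | given =>
      rcases hm with hm | hm <;> cases hm
      exact ⟨rfl, initSeg_cat _ _⟩
    | produce i hi =>
      rcases hm with hm | hm <;> cases hm
      exact ⟨rfl, initSeg_comb.2 (by have := initSeg_comb.1 hx; omega)⟩
    | goal w hw =>
      rcases hm with hm | hm <;> cases hm
      -- The copy for the empty string serves the goal only; a chain always leads to a copy for a
      -- nonempty string.
      · exact absurd (encode_injective (initSeg_comb_append.1 hx).1).symm (append_comb_ne_nil _ _)
      · exact ⟨rfl, (initSeg_comb_append.1 hx).2⟩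
    | supply s k hl hs =>
      rcases hm with hm | hm <;> cases hm
      exact ⟨rfl, initSeg_comb_append.2 ⟨initSeg_comb.1 hx, initSeg_zeros _⟩⟩
    | chain s k u h1 hl hs hk =>
      rcases hm with hm | hm <;> cases hm
      · obtain ⟨h2, h3⟩ := initSeg_comb_append.1 hx
        rename_i s' k' v1 hs'
        -- Here `OneEnded` is essential: it makes the antecedent that uses this consequent unique.
        obtain ⟨rfl, rfl⟩ := append_comb_inj h1 hs' (encode_injective h2)
        exact ⟨rfl, initSeg_comb_append.2 ⟨rfl, initSeg_comb_append.2 ⟨rfl, h3⟩⟩⟩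
      · exact absurd (encode_injective (initSeg_comb_append.1 hx).1) (append_comb_ne_nil _ _)

/-- Each thread through a linked node is one of those that are kept equal to another thread, except
that among the threads of the antecedent `Q` only one is. -/
theorem Linked.exists_mated {n : ℕ} {S : Position} {σ τ : Slot} {x y : List Bool} {v : ℕ → Bool}
    (h : Linked n S σ x τ y) (hx : InitSeg x v) :
    ∃ v₁ v', Mated σ v₁ τ v' ∧ InitSeg x v₁ ∧ (v₁ = v ∨ σ = .anteQ) := by
  rcases h with h | h
  · cases h with
    | given =>
      obtain ⟨v, rfl⟩ := hx.exists_cat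
      exact ⟨_, zeroStr, .inl (.given v _), hx, .inl rfl⟩
    | produce i hi =>
      obtain ⟨v, rfl⟩ := hx.exists_cat
      exact ⟨_, _, .inl (.produce i v), hx, .inl rfl⟩
    | goal w hw => exact ⟨_, _, .inl (.goal v), hx, .inl rfl⟩
    | supply s k hl hs =>
      exact ⟨_, _, .inl (.supply (encode s) zeroStr),
        initSeg_comb_append.2 ⟨rfl, initSeg_zeros _⟩, .inr rfl⟩
    | chain s k u h1 hl hs hk =>
      obtain ⟨v, rfl⟩ := hx.exists_cat
      rw [loc, cat_append, cat_append] at hx ⊢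
      exact ⟨_, _, .inl (.chain s k _ h1), hx, .inl rfl⟩
  · cases h with
    | given => exact ⟨_, _, .inr (.given zeroStr v), hx, .inl rfl⟩
    | produce i hi =>
      obtain ⟨v, rfl⟩ := hx.exists_cat
      exact ⟨_, _, .inr (.produce i v), hx, .inl rfl⟩
    | goal w hw =>
      obtain ⟨v, rfl⟩ := hx.exists_cat
      rw [loc, cat_append] at hx ⊢
      exact ⟨_, _, .inr (.goal _), hx, .inl rfl⟩
    | supply s k hl hs =>
      obtain ⟨v, rfl⟩ := hx.exists_cat
      exact ⟨_, _, .inr (.supply _ v), hx, .inl rfl⟩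
    | chain s k u h1 hl hs hk =>
      obtain ⟨v, rfl⟩ := hx.exists_cat
      rw [loc, cat_append] at hx ⊢
      exact ⟨_, _, .inr (.chain s k _ h1), hx, .inl rfl⟩

end CoL

namespace CoL

open Encodable

/-! ### Copied threads stay behind -/

/-- In each thread the machine has only made moves that the environment has made before in the
thread it is to be kept equal to. -/
def InSync (Φ : Position) : Prop := ∀ σ v τ v', Mated σ v τ v' →
  mvs machine Φ (σ.ext v) <+: mvs environment Φ (τ.ext v')

/-- The copying relation has held in all earlier positions. -/
def AllSync (Φ : Position) : Prop := ∀ Φ', Φ' <+: Φ → InSync Φ'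

theorem allSync_nil : AllSync [] := by
  intro Φ' h σ v τ v' _
  rw [List.prefix_nil.1 h]
  exact List.prefix_rfl

/-- Moves of the environment lengthen only the sequence that the machine has to catch up with. -/
theorem AllSync.append_label {Φ : Position} (h : AllSync Φ) (l : List Move) :
    AllSync (Φ ++ label environment l) := by
  intro Φ' hΦ'
  rcases prefix_append_cases hΦ' with h' | ⟨b, hb, rfl⟩
  · exact h Φ' h'
  · obtain ⟨l', -, rfl⟩ := List.prefix_map_iff.1 hb
    intro σ v τ v' hm
    have e := mvs_label_of_ne (p := machine) (q := environment) (by simp) l' (σ.ext v)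
    rw [label] at e
    rw [mvs_append, mvs_append, e, List.append_nil]
    exact (h Φ List.prefix_rfl σ v τ v' hm).trans (List.prefix_append _ _)

theorem AllSync.concat {Φ : Position} (h : AllSync Φ) {x : LabMove} (hx : InSync (Φ ++ [x])) :
    AllSync (Φ ++ [x]) := by
  intro Φ' hΦ'
  rcases List.prefix_concat_iff.1 hΦ' with rfl | h'
  · exact hx
  · exact h Φ' h'

/-- The machine is the copier in both threads. In a slot with interchanged roles it plays the letter
as ⊥, whence the player `xor σ.flip machine`. -/
theorem AllSync.copies {Φ : Position} (h : AllSync Φ) {σ τ : Slot} {v v' : ℕ → Bool}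
    (hm : Mated σ v τ v') : ∀ Φ', Φ' <+: Φ → Copies (xor σ.flip machine)
      (Φ'.filterMap (lab σ.flip (σ.ext v))) (Φ'.filterMap (lab τ.flip (τ.ext v'))) := by
  intro Φ' hΦ'
  have e1 := h Φ' hΦ' σ v τ v' hm
  have e2 := h Φ' hΦ' τ v' σ v hm.symm
  unfold Copies
  simp only [mv_filterMap_lab, hm.flip]
  cases σ.flip <;> exact ⟨e1, e2⟩

theorem AllSync.legal {P Q R : ConstGame} (hP : P.Static) (hQ : Q.Static) (hR : R.Static)
    {Φ : Position} (h : AllSync Φ) (hΦ : Φ ∈ (production P Q R).legal) {σ τ : Slot}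
    {v v' : ℕ → Bool} (hm : Mated σ v τ v') {α : Move}
    (hα : mvs machine Φ (σ.ext v) ++ [α] <+: mvs environment Φ (τ.ext v')) :
    Φ.filterMap (lab σ.flip (σ.ext v)) ++ [(xor σ.flip machine, α)] ∈ (σ.game P Q R).legal := by
  have hst : (σ.game P Q R).Static := by cases σ <;> assumption
  refine hst.legal_of_copies (h.copies hm) (Slot.legal_ext hΦ σ v) ?_ ?_
  · rw [← hm.game]
    exact Slot.legal_ext hΦ τ v'
  · simp only [mv_filterMap_lab, hm.flip]
    revert hα
    cases σ.flip <;> exact id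

/-! ### Counting moves -/

theorem hits_append (p : Player) (Φ Ψ : Position) (l : List Move) :
    hits p (Φ ++ Ψ) l = hits p Φ l ++ hits p Ψ l := List.filterMap_append

theorem hits_append_label (Φ : Position) (l l' : List Move) :
    hits machine (Φ ++ label environment l) l' = hits machine Φ l' := by
  rw [hits_append]
  simp [hits, label]

theorem length_hits_mono {p : Player} {Φ Ψ : Position} (h : Φ <+: Ψ) (l : List Move) :
    (hits p Φ l).length ≤ (hits p Ψ l).length := (h.filterMap _).length_le

theorem length_hits_concat {p : Player} {Φ : Position} {l : List Move} {t β : Move} (ht : t ∈ l) :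
    (hits p (Φ ++ [(p, t ++ β)]) l).length = (hits p Φ l).length + 1 := by
  rw [hits_append, List.length_append]
  congr 1
  have hmem : β ∈ l.filterMap fun s => strip s (t ++ β) :=
    List.mem_filterMap.2 ⟨t, ht, strip_append t β⟩
  cases h : (l.filterMap fun s => strip s (t ++ β)) with
  | nil => rw [h] at hmem; simp at hmem
  | cons a l' =>
    simp only [hits, List.filterMap_cons, if_true, h, List.head?_cons, List.filterMap_nil,
      List.length_singleton]

/-- A task counts its own move. -/
theorem length_hits_task {k : ℕ} {S Φ : Position} {t : Task} (ht : t ∈ sync k S) :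
    (hits machine (Φ ++ [(machine, t.1)]) t.2.1).length = (hits machine Φ t.2.1).length + 1 := by
  have hrep : ∀ a x, (hits machine (Φ ++ [(machine, (repTask a x).1)]) (repTask a x).2.1).length =
      (hits machine Φ (repTask a x).2.1).length + 1 := by
    intro a x
    have := length_hits_concat (p := machine) (Φ := Φ) (β := [])
      (List.mem_singleton_self (a ++ (bits x ++ [colon])))
    rwa [List.append_nil] at this
  rcases mem_sync.1 ht with rfl | rfl | ht | ht
  · exact hrep _ _
  · exact hrep _ _
  · obtain ⟨s, u, -, -, rfl⟩ := mem_repTasks.1 ht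
    exact hrep _ _
  · obtain ⟨σ, x, τ, y, α, -, -, rfl⟩ := mem_pushTasks.1 ht
    exact length_hits_concat (mem_pats.2 ⟨y, List.prefix_rfl, rfl⟩)

/-- As counts only grow, a count that differs from the expected one exceeds it, so a skipped task is
in fact done. -/
theorem task_le {k : ℕ} {S : Position} {t : Task} (ht : t ∈ sync k S) :
    t.2.2 ≤ (hits machine S t.2.1).length := by
  rcases mem_sync.1 ht with rfl | rfl | ht | ht
  · exact Nat.zero_le _
  · exact Nat.zero_le _
  · obtain ⟨s, u, -, -, rfl⟩ := mem_repTasks.1 ht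
    exact Nat.zero_le _
  · obtain ⟨σ, x, τ, y, α, -, -, rfl⟩ := mem_pushTasks.1 ht
    exact le_rfl

theorem mem_of_mem_append_label {Φ : Position} {l : List Move} {m : Move}
    (h : (machine, m) ∈ Φ ++ label environment l) : (machine, m) ∈ Φ := by
  simpa [label] using h

theorem exists_of_mem_hits {p : Player} {Φ : Position} {m : Move}
    (h : 0 < (hits p Φ [m]).length) : ∃ β, (p, m ++ β) ∈ Φ := by
  obtain ⟨β, hβ⟩ := List.exists_mem_of_length_pos h
  simp only [hits, List.mem_filterMap] at hβ
  obtain ⟨⟨q, m'⟩, hx, he⟩ := hβ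
  split_ifs at he with hq
  dsimp only at hq he
  subst hq
  have := List.mem_of_mem_head? he
  simp only [List.mem_filterMap, List.mem_singleton] at this
  obtain ⟨_, rfl, hs⟩ := this
  exact ⟨β, by rw [← strip_eq_some.1 hs]; exact hx⟩

theorem length_hits_pos {p : Player} {Φ : Position} {m : Move} (h : (p, m) ∈ Φ) :
    0 < (hits p Φ [m]).length := by
  obtain ⟨s, t, rfl⟩ := List.append_of_mem h
  have h1 := length_hits_concat (p := p) (Φ := s) (β := []) (List.mem_singleton_self m)
  rw [List.append_nil] at h1
  have h2 := length_hits_mono (p := p) (Φ := s ++ [(p, m)]) (Ψ := s ++ (p, m) :: t)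
    ⟨t, by simp⟩ [m]
  omega

/-! ### The invariant of the machine -/

/-- What holds of the position `S` at the beginning of the `n`-th round. -/
structure Snap (P Q R : ConstGame) (n : ℕ) (S : Position) : Prop where
  legal : S ∈ (production P Q R).legal
  repP : ∀ i < n, Slot.consP.Rep S (zeros i)
  repR : ∀ i < n, Slot.consR.Rep S (zeros i)
  reps : RepsFrom S S

/-- What holds of the position `Φ` in the `k`-th round when the tasks `d` have been carried out and
the tasks `q` are left. -/
structure Mid (P Q R : ConstGame) (k : ℕ) (S Φ : Position) (d q : List Task) : Prop where
  snap : Snap P Q R k S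
  start : S <+: Φ
  queue : d ++ q = sync k S
  done : ∀ t ∈ d, t.2.2 < (hits machine Φ t.2.1).length
  moves : ∀ m, (machine, m) ∈ Φ → (machine, m) ∈ S ∨ ∃ t ∈ sync k S, t.1 = m

variable {P Q R : ConstGame}

theorem snap_zero : Snap P Q R 0 [] where
  legal := (production P Q R).nil_legal
  repP := by simp
  repR := by simp
  reps := ⟨fun x ⟨p, h⟩ => by simp at h, fun x ⟨p, h⟩ => by simp at h⟩

theorem Snap.vnode {n : ℕ} {S : Position} (h : Snap P Q R n S) {σ : Slot} {p : Player}
    {u : List Bool} {β : Move} (hm : (p, full (σ.place u) ++ β) ∈ S) : VNode S σ u := by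
  have hn := Slot.dot_node h.legal hm
  by_cases hσ : σ = .goal
  · subst hσ; exact hn
  · exact h.reps.vnode h.legal hσ hn

namespace Mid

variable {k : ℕ} {S Φ : Position} {d q : List Task}

theorem append_label (h : Mid P Q R k S Φ d q) (l : List Move) :
    Mid P Q R k S (Φ ++ label environment l) d q where
  snap := h.snap
  start := h.start.trans (List.prefix_append _ _)
  queue := h.queue
  done t ht := by rw [hits_append_label]; exact h.done t ht
  moves m hm := h.moves m (mem_of_mem_append_label hm)

/-- The environment may have created new goal nodes since the snapshot. The machine does not react
to them within the round: its moves stem from the snapshot or from tasks at linked nodes, which are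
virtual nodes of `S`. -/
theorem vnode (h : Mid P Q R k S Φ d q) {σ : Slot} {u : List Bool} {β : Move}
    (hm : (machine, full (σ.place u) ++ β) ∈ Φ) : VNode S σ u := by
  rcases h.moves _ hm with hm | ⟨t, ht, he⟩
  · exact h.snap.vnode hm
  · rcases mem_sync.1 ht with rfl | rfl | ht | ht
    · exact absurd he.symm Slot.pre_dot_ne_colon
    · exact absurd he.symm Slot.pre_dot_ne_colon
    · obtain ⟨s, u, -, -, rfl⟩ := mem_repTasks.1 ht
      exact absurd he.symm Slot.pre_dot_ne_colon
    · obtain ⟨σ', x, τ, y, α, hl, -, rfl⟩ := mem_pushTasks.1 ht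
      obtain ⟨rfl, rfl, -⟩ := Slot.full_inj he
      exact (hl.vLeaf h.snap.legal).1

/-- In the resources only the machine may replicate, so each replication there is either old or one
of the tasks. -/
theorem repsFrom (h : Mid P Q R k S Φ d q) (hΦ : Φ ∈ (production P Q R).legal) :
    RepsFrom S Φ := by
  have pre_ne : Slot.consP.pre ≠ Slot.consR.pre := by simp [Slot.pre]
  have inj : ∀ {σ τ : Slot} {x y : List Bool}, σ.pre ++ (bits x ++ [colon]) =
      τ.pre ++ (bits y ++ [colon]) → σ.pre = τ.pre ∧ x = y := by
    intro σ τ x y h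
    obtain ⟨h1, h2⟩ := Slot.pre_append_inj h
    exact ⟨h1, (bits_append_inj bitSym_ne_colon bitSym_ne_colon h2).1⟩
  constructor
  · rintro x ⟨p, hp⟩
    obtain ⟨-, rfl, -⟩ := Slot.colon_node hΦ hp
    rcases h.moves _ hp with hp | ⟨t, ht, he⟩
    · exact h.snap.reps.left x ⟨_, hp⟩
    · rcases mem_sync.1 ht with rfl | rfl | ht | ht
      · exact ⟨k, (inj he).2.symm⟩
      · exact absurd (inj he).1 pre_ne.symm
      · obtain ⟨s, u, -, -, rfl⟩ := mem_repTasks.1 ht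
        exact absurd (inj he).1 pre_ne.symm
      · obtain ⟨σ', x, τ, y, α, hl, -, rfl⟩ := mem_pushTasks.1 ht
        exact absurd he Slot.pre_dot_ne_colon
  · rintro x ⟨p, hp⟩
    obtain ⟨-, rfl, -⟩ := Slot.colon_node hΦ hp
    rcases h.moves _ hp with hp | ⟨t, ht, he⟩
    · exact h.snap.reps.right x ⟨_, hp⟩
    · rcases mem_sync.1 ht with rfl | rfl | ht | ht
      · exact absurd (inj he).1 pre_ne
      · exact .inl ⟨k, (inj he).2.symm⟩
      · obtain ⟨s, u, hr, -, rfl⟩ := mem_repTasks.1 ht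
        exact .inr ⟨s, u, (inj he).2.symm, hr⟩
      · obtain ⟨σ', x, τ, y, α, hl, -, rfl⟩ := mem_pushTasks.1 ht
        exact absurd he Slot.pre_dot_ne_colon

/-- A finished replication task has a positive count, and in a legal position nothing can follow the
colon. -/
theorem rep_of_mem (h : Mid P Q R k S Φ d q) (hΦ : Φ ∈ (production P Q R).legal) {σ : Slot}
    {x : List Bool} (ht : repTask σ.pre x ∈ d) : σ.Rep Φ x := by
  obtain ⟨β, hβ⟩ := exists_of_mem_hits (h.done _ ht)
  have e : σ.pre ++ (bits x ++ [colon]) ++ β = σ.pre ++ (bits x ++ colon :: β) := by simp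
  rw [e] at hβ
  obtain ⟨rfl, -, -⟩ := Slot.colon_node hΦ hβ
  exact ⟨_, hβ⟩

theorem toSnap (h : Mid P Q R k S Φ d []) (hΦ : Φ ∈ (production P Q R).legal) :
    Snap P Q R (k + 1) Φ := by
  have hd : ∀ t ∈ sync k S, t ∈ d := by
    intro t ht
    rw [← h.queue] at ht
    simpa using ht
  refine ⟨hΦ, ?_, ?_, ?_⟩
  · intro i hi
    rcases Nat.lt_succ_iff_lt_or_eq.1 hi with hi | rfl
    · exact (h.snap.repP i hi).mono h.start.subset
    · exact h.rep_of_mem hΦ (hd _ (mem_sync.2 (.inl rfl)))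
  · intro i hi
    rcases Nat.lt_succ_iff_lt_or_eq.1 hi with hi | rfl
    · exact (h.snap.repR i hi).mono h.start.subset
    · exact h.rep_of_mem hΦ (hd _ (mem_sync.2 (.inr (.inl rfl))))
  · have := h.repsFrom hΦ
    exact ⟨this.left, fun x hx => (this.right x hx).imp id fun ⟨s, u, hu, hr⟩ =>
      ⟨s, u, hu, hr.mono h.start.subset⟩⟩

/-- The test fails only if the count has already passed the expected value. This is how a
replication that is queued again in later rounds is performed only once. -/
theorem skip {t : Task} (h : Mid P Q R k S Φ d (t :: q))
    (ht : (hits machine Φ t.2.1).length ≠ t.2.2) : Mid P Q R k S Φ (d ++ [t]) q where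
  snap := h.snap
  start := h.start
  queue := by rw [← h.queue]; simp
  done t' ht' := by
    rcases List.mem_append.1 ht' with ht' | ht'
    · exact h.done t' ht'
    · rw [List.mem_singleton.1 ht']
      have h1 := task_le (t := t) (k := k) (S := S) (by rw [← h.queue]; simp)
      have h2 := length_hits_mono (p := machine) h.start t.2.1
      omega
  moves := h.moves

theorem move {t : Task} (h : Mid P Q R k S Φ d (t :: q))
    (ht : (hits machine Φ t.2.1).length = t.2.2) :
    Mid P Q R k S (Φ ++ [(machine, t.1)]) (d ++ [t]) q where
  snap := h.snap
  start := h.start.trans (List.prefix_append _ _)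
  queue := by rw [← h.queue]; simp
  done t' ht' := by
    rcases List.mem_append.1 ht' with ht' | ht'
    · exact (h.done t' ht').trans_le (length_hits_mono (List.prefix_append _ _) _)
    · rw [List.mem_singleton.1 ht', length_hits_task (k := k) (S := S) (by rw [← h.queue]; simp)]
      omega
  moves m hm := by
    rcases List.mem_append.1 hm with hm | hm
    · exact h.moves m hm
    · right
      refine ⟨t, by rw [← h.queue]; simp, ?_⟩
      simpa using (congrArg Prod.snd (List.mem_singleton.1 hm)).symm

theorem prefix_concat_of_getElem? {α : Type*} {l l' : List α} {a : α} (h : l <+: l')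
    (ha : l'[l.length]? = some a) : l ++ [a] <+: l' := by
  obtain ⟨r, rfl⟩ := h
  cases r with
  | nil => simp at ha
  | cons b r =>
    simp at ha
    exact ⟨r, by simp [ha]⟩

/-- A copied move is the next one in all threads it belongs to. -/
theorem push_prefix (h : Mid P Q R k S Φ d q) (hs : InSync Φ) {σ τ : Slot} {x y : List Bool}
    {α : Move} (hl : Linked k S σ x τ y)
    (hα : (hits environment S (pats (σ.place x)))[(hits machine Φ (pats (τ.place y))).length]? =
      some α) {v v' : ℕ → Bool} (hm : Mated τ v σ v') (hy : InitSeg y v) :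
    mvs machine Φ (τ.ext v) ++ [α] <+: mvs environment Φ (σ.ext v') := by
  have hx := (hl.symm.mated hm hy).2
  rw [hits_pats (hl.symm.vLeaf h.snap.legal) (fun _ _ => h.snap.vnode) hx,
    hits_pats (hl.vLeaf h.snap.legal) (fun _ _ => h.vnode) hy] at hα
  refine prefix_concat_of_getElem? (hs _ _ _ _ hm) ?_
  obtain ⟨r, hr⟩ := mvs_prefix environment h.start (σ.ext v')
  obtain ⟨hlt, -⟩ := List.getElem?_eq_some_iff.1 hα
  rw [← hr, List.getElem?_append_left hlt]
  exact hα

theorem inSync_rep (hs : InSync Φ) (σ : Slot) (x : List Bool) :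
    InSync (Φ ++ [(machine, (repTask σ.pre x).1)]) := by
  intro τ v ρ v' hm
  have e : τ.ext v (repTask σ.pre x).1 = none := by
    rw [Option.eq_none_iff_forall_ne_some]
    intro β hβ
    obtain ⟨u, -, hu⟩ := Slot.ext_eq_some.1 hβ
    exact absurd hu.symm Slot.pre_dot_ne_colon
  rw [mvs_append, mvs_append]
  simpa [mvs, e] using hs τ v ρ v' hm

/-- The move shows only in threads of `τ` through an initial segment of the mate's side of the link,
and there `push_prefix` says that it is the next one to be copied. -/
theorem inSync_push (h : Mid P Q R k S Φ d q) (hs : InSync Φ) {σ τ : Slot} {x y : List Bool}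
    {α : Move} (hl : Linked k S σ x τ y)
    (hα : (hits environment S (pats (σ.place x)))[(hits machine Φ (pats (τ.place y))).length]? =
      some α) : InSync (Φ ++ [(machine, full (τ.place y) ++ α)]) := by
  intro ρ v ρ' v' hm
  rw [mvs_append, mvs_append]
  cases he : ρ.ext v (full (τ.place y) ++ α) with
  | none => simpa [mvs, he] using hs ρ v ρ' v' hm
  | some β =>
    obtain ⟨u, hu, hu'⟩ := Slot.ext_eq_some.1 he
    obtain ⟨rfl, rfl, rfl⟩ := Slot.full_inj hu'
    obtain ⟨rfl, -⟩ := hl.symm.mated hm hu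
    simpa [mvs, he] using h.push_prefix hs hl hα hm hu

/-- In the copies a node that is linked is a leaf, so that all threads through it are equal. -/
theorem filterMap_ext_eq (h : Mid P Q R k S Φ d q) (hΦ : Φ ∈ (production P Q R).legal) {τ : Slot}
    (hτ : τ ≠ .goal) {y : List Bool} (hy : VLeaf S τ y) {v v₁ : ℕ → Bool} (hv : InitSeg y v)
    (hv₁ : InitSeg y v₁) (φ : Bool) :
    Φ.filterMap (lab φ (τ.ext v)) = Φ.filterMap (lab φ (τ.ext v₁)) := by
  have key : ∀ {v v₁ : ℕ → Bool}, InitSeg y v → InitSeg y v₁ → ∀ x ∈ Φ, ∀ β,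
      τ.ext v x.2 = some β → τ.ext v₁ x.2 = some β := by
    intro v v₁ hv hv₁ x hx β hβ
    obtain ⟨u, hu, hm⟩ := Slot.ext_eq_some.1 hβ
    refine Slot.ext_eq_some.2 ⟨u, ?_, hm⟩
    rcases hu.total hv with hp | ⟨t, rfl⟩
    · exact hv₁.of_prefix hp
    · obtain ⟨p, m⟩ := x
      dsimp only at hm
      rw [hm] at hx
      rw [hy.2 t ((h.repsFrom hΦ).vnode hΦ hτ (Slot.dot_node hΦ hx)), List.append_nil]
      exact hv₁
  refine List.filterMap_congr fun x hx => ?_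
  unfold lab
  congr 1
  ext β
  exact ⟨key hv hv₁ x hx β, key hv₁ hv x hx β⟩

theorem node_zeros {σ : Slot} (n : ℕ) (h : ∀ i < n, σ.Rep Φ (zeros i)) : σ.Node Φ (zeros n) := by
  cases n with
  | zero => exact .inl rfl
  | succ n => exact .inr ⟨zeros n, false, by rw [zeros_add]; rfl, h n (by omega)⟩

/-- The roots `comb i` with i ≤ k exist because 0ⁱ has been replicated, now or in an earlier round.
A deeper node `loc s u` exists because its parent mirrors a replicated goal node. A leaf of the
snapshot of the goal stays a node, although the environment may have split it since. -/
theorem linked_node (h : Mid P Q R k S Φ d q) (hΦ : Φ ∈ (production P Q R).legal)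
    (hP : repTask Slot.consP.pre (zeros k) ∈ d) (hR : repTask Slot.consR.pre (zeros k) ∈ d)
    (hd : ∀ t ∈ repTasks k S, t ∈ d) {σ τ : Slot} {x y : List Bool} (hl : Linked k S σ x τ y) :
    τ.Node Φ y := by
  have hcP : ∀ i ≤ k, Slot.consP.Node Φ (comb i) := by
    intro i hi
    refine .inr ⟨zeros i, true, rfl, ?_⟩
    rcases hi.lt_or_eq with hi | rfl
    · exact (h.snap.repP i hi).mono h.start.subset
    · exact h.rep_of_mem hΦ hP
  have hloc : ∀ s u, encode s ≤ k → GoalLeaf S (s ++ u) → Slot.consR.Node Φ (loc s u) := by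
    intro s u hs hl
    rcases List.eq_nil_or_concat u with rfl | ⟨u, b, rfl⟩
    · refine .inr ⟨zeros (encode s), true, by simp [loc, comb], ?_⟩
      rcases hs.lt_or_eq with hi | he
      · exact (h.snap.repR _ hi).mono h.start.subset
      · rw [he]; exact h.rep_of_mem hΦ hR
    · refine .inr ⟨loc s u, b, by simp [loc], h.rep_of_mem hΦ (hd _ (mem_repTasks.2
        ⟨s, u, ?_, hs, rfl⟩))⟩
      have := hl.1
      rw [List.concat_eq_append, ← List.append_assoc] at this
      exact Slot.Node.replicated h.snap.legal this (by simp)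
  have h0 : encode ([] : List Bool) ≤ k := by simp
  rcases hl with hl | hl
  · cases hl with
    | given => exact .inl rfl
    | produce i hi => exact hcP i hi.le
    | goal w hw => exact hloc [] _ h0 hw
    | supply s j hl hs => exact hcP _ hs
    | chain s j u h1 hl hs hk => exact hloc _ _ hk (by simpa using hl)
  · cases hl with
    | given => exact hcP 0 (Nat.zero_le _)
    | produce i hi => exact hcP _ hi
    | goal w hw => exact hw.1.mono h.start.subset
    | supply s j hl hs => exact hloc _ _ hs hl
    | chain s j u h1 hl hs hk => exact hloc _ _ hs hl

/-- The machine does not make illegal moves, and its moves respect the copying relation. -/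
theorem legal_move (hP : P.Static) (hQ : Q.Static) (hR : R.Static) {t : Task}
    (h : Mid P Q R k S Φ d (t :: q)) (hΦ : Φ ∈ (production P Q R).legal) (hs : AllSync Φ)
    (ht : (hits machine Φ t.2.1).length = t.2.2) :
    Φ ++ [(machine, t.1)] ∈ (production P Q R).legal ∧ InSync (Φ ++ [(machine, t.1)]) := by
  have hs' := hs Φ List.prefix_rfl
  have hrep : ∀ {σ : Slot} {x : List Bool}, σ.treeFlip = machine → σ ≠ .given → σ.Node Φ x →
      (hits machine Φ (repTask σ.pre x).2.1).length = (repTask σ.pre x).2.2 →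
      Φ ++ [(machine, (repTask σ.pre x).1)] ∈ (production P Q R).legal := by
    intro σ x hf hσ hx hn
    -- An earlier replication of the node would be a move of the machine and would make the count
    -- positive, while the task requires zero.
    have := Slot.legal_colon hΦ hσ hx (by
      rintro ⟨p, hp⟩
      obtain ⟨-, rfl, -⟩ := Slot.colon_node hΦ hp
      rw [hf] at hp
      have h1 := length_hits_pos hp
      exact h1.ne' hn)
    rwa [hf] at this
  rcases sync_cases h.snap.legal h.queue with rfl | rfl | ⟨hdP, hdR, h'⟩
  · exact ⟨hrep rfl (by simp) (node_zeros k fun i hi =>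
      (h.snap.repP i hi).mono h.start.subset) ht, inSync_rep hs' _ _⟩
  · exact ⟨hrep rfl (by simp) (node_zeros k fun i hi =>
      (h.snap.repR i hi).mono h.start.subset) ht, inSync_rep hs' _ _⟩
  rcases h' with ⟨s, u, hr, hk, rfl, hd⟩ | ⟨hp, hd⟩
  · refine ⟨hrep rfl (by simp) ?_ ht, inSync_rep hs' _ _⟩
    rcases List.eq_nil_or_concat u with rfl | ⟨u, b, rfl⟩
    · refine .inr ⟨zeros (encode s), true, by simp [loc, comb], ?_⟩
      rcases hk.lt_or_eq with hi | he
      · exact (h.snap.repR _ hi).mono h.start.subset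
      · rw [he]; exact h.rep_of_mem hΦ hdR
    · exact .inr ⟨loc s u, b, by simp [loc], h.rep_of_mem hΦ (hd u b (by simp))⟩
  · obtain ⟨σ, x, τ, y, α, hl, hα, rfl⟩ := mem_pushTasks.1 hp
    dsimp only at ht ⊢
    rw [← ht] at hα
    refine ⟨Slot.legal_dot hΦ (h.linked_node hΦ hdP hdR hd hl) fun v hv => ?_,
      h.inSync_push hs' hl hα⟩
    -- The move must be legal in all threads through the node. In the antecedent Q only the all-zero
    -- continuation has a mate; the other threads through the node carry the same play, because the
    -- node is a leaf.
    obtain ⟨v₁, v', hm, hv₁, hor⟩ := hl.symm.exists_mated hv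
    have hleg := hs.legal hP hQ hR hΦ hm (h.push_prefix hs' hl hα hm hv₁)
    rcases hor with rfl | rfl
    · exact hleg
    · rwa [h.filterMap_ext_eq hΦ (by simp) (hl.vLeaf h.snap.legal) hv hv₁]

end Mid

end CoL

namespace CoL

open Encodable

/-! ### Runs of the machine -/

section

variable {P Q R : ConstGame} (e : Valuation) (E : EnvBehavior)

/-- The number of rounds and the tasks that are left at the beginning of the `i`-th cycle. -/
def memAt (i : ℕ) : ℕ × List Task := (copycat.config e E i).1

/-- The position at the beginning of the `i`-th cycle. -/
def posAt (i : ℕ) : Position := (copycat.config e E i).2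

theorem posAt_mono {i j : ℕ} (h : i ≤ j) : posAt e E i <+: posAt e E j :=
  copycat.config_mono e E h

theorem posAt_mem (i : ℕ) : posAt e E i ∈ (copycat.run e E).segs := ⟨i, List.prefix_rfl⟩

variable {e E}

theorem memAt_succ_nil {i n : ℕ} (h : memAt e E i = (n, [])) :
    memAt e E (i + 1) = (n + 1, sync n (posAt e E i)) ∧
    posAt e E (i + 1) =
      posAt e E i ++ label environment (E.before i) ++ label environment (E.after i) := by
  unfold memAt at h
  simp [memAt, posAt, HPM.config, copycat, cycle] at h ⊢
  simp [h, label]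

theorem memAt_succ_cons {i n : ℕ} {t : Task} {q : List Task} (h : memAt e E i = (n, t :: q)) :
    memAt e E (i + 1) = (n, q) ∧
    posAt e E (i + 1) = posAt e E i ++ label environment (E.before i) ++
      label machine (exec (posAt e E i) t).toList ++ label environment (E.after i) := by
  unfold memAt at h
  simp [memAt, posAt, HPM.config, copycat, cycle] at h ⊢
  simp [h]

/-- The test is made on the position at the start of the cycle, but moves of the environment that
arrive before the machine's own move do not change the machine's counts. -/
theorem Mid.cycle {k i n : ℕ} {S : Position} {d q : List Task} {t : Task}
    (hm : memAt e E i = (n, t :: q)) (h : Mid P Q R k S (posAt e E i) d (t :: q)) :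
    Mid P Q R k S (posAt e E (i + 1)) (d ++ [t]) q := by
  rw [(memAt_succ_cons hm).2]
  refine Mid.append_label ?_ _
  have h' := h.append_label (E.before i)
  unfold exec
  split_ifs with ht
  · exact h'.move (by rwa [hits_append_label])
  · simpa [label] using! h'.skip (by rwa [hits_append_label])

theorem Snap.start {n i : ℕ} (hm : memAt e E i = (n, [])) (h : Snap P Q R n (posAt e E i)) :
    Mid P Q R n (posAt e E i) (posAt e E (i + 1)) [] (sync n (posAt e E i)) := by
  rw [(memAt_succ_nil hm).2]
  refine Mid.append_label (Mid.append_label ?_ _) _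
  exact ⟨h, List.prefix_rfl, rfl, by simp, fun m hm => .inl hm⟩

theorem fst_memAt_le (i : ℕ) : (memAt e E i).1 ≤ i := by
  induction i with
  | zero => exact le_rfl
  | succ i ih =>
    rcases hm : memAt e E i with ⟨n, q⟩
    rw [hm] at ih
    cases q with
    | nil => rw [(memAt_succ_nil hm).1]; simpa using ih
    | cons t q => rw [(memAt_succ_cons hm).1]; exact Nat.le_succ_of_le ih

/-- What holds at the beginning of the `i`-th cycle, as long as the environment makes no illegal
moves. -/
structure Good (P Q R : ConstGame) (e : Valuation) (E : EnvBehavior) (i : ℕ) : Prop where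
  legal : posAt e E i ∈ (production P Q R).legal
  sync : AllSync (posAt e E i)
  state : ((memAt e E i).2 = [] ∧ Snap P Q R (memAt e E i).1 (posAt e E i)) ∨
    ∃ k S d, (memAt e E i).1 = k + 1 ∧ Mid P Q R k S (posAt e E i) d (memAt e E i).2

theorem Good.snap {i n : ℕ} (h : Good P Q R e E i) (hm : memAt e E i = (n, [])) :
    Snap P Q R n (posAt e E i) := by
  rcases h.state with ⟨-, hs⟩ | ⟨k, S, d, hk, hmid⟩
  · rwa [hm] at hs
  · rw [hm] at hk hmid
    dsimp only at hk
    subst hk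
    exact hmid.toSnap h.legal

/-- In a cycle, each block of environment moves either preserves legality or contains the first
illegal move of the run, and the machine's own move is legal by `Mid.legal_move`. -/
theorem good_or_illegal (hP : P.Static) (hQ : Q.Static) (hR : R.Static) (i : ℕ) :
    IllegalBy (production P Q R).legal environment (copycat.run e E) ∨ Good P Q R e E i := by
  induction i with
  | zero => exact .inr ⟨(production P Q R).nil_legal, allSync_nil, .inl ⟨rfl, snap_zero⟩⟩
  | succ i ih =>
    rcases ih with ih | ih
    · exact .inl ih
    have henv : ∀ {Φ : Position} {l : List Move}, Φ ∈ (production P Q R).legal →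
        Φ ++ label environment l <+: posAt e E (i + 1) →
        IllegalBy (production P Q R).legal environment (copycat.run e E) ∨
          Φ ++ label environment l ∈ (production P Q R).legal := by
      intro Φ l h hp
      by_cases hl : Φ ++ label environment l ∈ (production P Q R).legal
      · exact .inr hl
      · exact .inl ((production P Q R).illegalBy_of_label h hl ⟨i + 1, hp⟩)
    rcases hm : memAt e E i with ⟨n, q⟩
    cases q with
    | nil =>
      obtain ⟨hm', hp⟩ := memAt_succ_nil hm
      rcases henv ih.legal (by rw [hp]; exact List.prefix_append _ _) with h | h1
      · exact .inl h
      rcases henv h1 (by rw [hp]) with h | h2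
      · exact .inl h
      refine .inr ⟨by rw [hp]; exact h2, by rw [hp]; exact (ih.sync.append_label _).append_label _,
        .inr ⟨n, posAt e E i, [], by rw [hm'], by rw [hm']; exact (ih.snap hm).start hm⟩⟩
    | cons t q =>
      obtain ⟨hm', hp⟩ := memAt_succ_cons hm
      rcases henv ih.legal (by
        rw [hp, List.append_assoc]; exact List.prefix_append _ _) with h | h1
      · exact .inl h
      obtain ⟨k, S, d, hk, hmid⟩ : ∃ k S d, (memAt e E i).1 = k + 1 ∧
          Mid P Q R k S (posAt e E i) d (t :: q) := by
        rcases ih.state with ⟨h, -⟩ | ⟨k, S, d, hk, hmid⟩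
        · simp [hm] at h
        · exact ⟨k, S, d, hk, by rwa [hm] at hmid⟩
      have hs := ih.sync.append_label (E.before i)
      obtain ⟨h2, hs2⟩ : posAt e E i ++ label environment (E.before i) ++
          label machine (exec (posAt e E i) t).toList ∈ (production P Q R).legal ∧
          AllSync (posAt e E i ++ label environment (E.before i) ++
            label machine (exec (posAt e E i) t).toList) := by
        unfold exec
        split_ifs with ht
        · obtain ⟨h2, h3⟩ := (hmid.append_label (E.before i)).legal_move hP hQ hR h1 hs
            (by rwa [hits_append_label])
          exact ⟨h2, hs.concat h3⟩
        · exact ⟨by simpa [label] using h1, by simpa [label] using hs⟩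
      rcases henv h2 (by rw [hp]) with h | h3
      · exact .inl h
      refine .inr ⟨by rw [hp]; exact h3, by rw [hp]; exact hs2.append_label _,
        .inr ⟨k, S, d ++ [t], ?_, ?_⟩⟩
      · rw [hm', ← hk, hm]
      · rw [hm']; exact hmid.cycle hm

theorem Mid.finish {k n : ℕ} {S : Position} {q : List Task} : ∀ {i : ℕ} {d : List Task},
    memAt e E i = (n, q) → Mid P Q R k S (posAt e E i) d q →
    ∃ j, i ≤ j ∧ memAt e E j = (n, []) ∧ Mid P Q R k S (posAt e E j) (sync k S) [] := by
  induction q with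
  | nil =>
    intro i d hm h
    refine ⟨i, le_rfl, hm, ?_⟩
    have := h.queue
    rw [List.append_nil] at this
    exact this ▸ h
  | cons t q ih =>
    intro i d hm h
    obtain ⟨j, hj, h1, h2⟩ := ih (memAt_succ_cons hm).1 (h.cycle hm)
    exact ⟨j, by omega, h1, h2⟩

theorem Snap.finish {n i : ℕ} (hm : memAt e E i = (n, [])) (h : Snap P Q R n (posAt e E i)) :
    ∃ j, i < j ∧ memAt e E j = (n + 1, []) ∧
      Mid P Q R n (posAt e E i) (posAt e E j) (sync n (posAt e E i)) [] := by
  obtain ⟨j, hj, h1, h2⟩ := Mid.finish (memAt_succ_nil hm).1 (h.start hm)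
  exact ⟨j, by omega, h1, h2⟩

/-! ### Progress: rounds recur forever and linked threads catch up -/

variable (hg : ∀ i, Good P Q R e E i)

include hg

theorem exists_memAt (n : ℕ) : ∃ i, n ≤ i ∧ memAt e E i = (n, []) := by
  induction n with
  | zero => exact ⟨0, le_rfl, rfl⟩
  | succ n ih =>
    obtain ⟨i, hi, hm⟩ := ih
    obtain ⟨j, hj, hm', -⟩ := ((hg i).snap hm).finish hm
    exact ⟨j, by omega, hm'⟩

omit hg in
/-- From some round on, moves are copied between the two threads in each round. -/
def Live (e : Valuation) (E : EnvBehavior) (σ : Slot) (v : ℕ → Bool) (τ : Slot)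
    (v' : ℕ → Bool) : Prop :=
  ∃ N, ∀ n ≥ N, ∀ i, memAt e E i = (n, []) →
    ∃ x y, Linked n (posAt e E i) σ x τ y ∧ InitSeg x v ∧ InitSeg y v'

omit hg in
theorem Live.symm {σ τ : Slot} {v v' : ℕ → Bool} (h : Live e E σ v τ v') : Live e E τ v' σ v := by
  obtain ⟨N, h⟩ := h
  refine ⟨N, fun n hn i hi => ?_⟩
  obtain ⟨x, y, h1, h2, h3⟩ := h n hn i hi
  exact ⟨y, x, h1.symm, h3, h2⟩

/-- If the machine is still one move short at the start of a sufficiently late round, then copying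
exactly that move is among the tasks of the round, and at its end all tasks are done. -/
theorem Live.catch_up {σ τ : Slot} {v v' : ℕ → Bool} (h : Live e E σ v τ v') (L i : ℕ)
    (hL : L ≤ (mvs environment (posAt e E i) (σ.ext v)).length) :
    ∃ j, L ≤ (mvs machine (posAt e E j) (τ.ext v')).length := by
  obtain ⟨N, hN⟩ := h
  induction L with
  | zero => exact ⟨0, Nat.zero_le _⟩
  | succ L ih =>
    obtain ⟨j, hj⟩ := ih (by omega)
    obtain ⟨i', hi', hm⟩ := exists_memAt hg (max N (max i j))
    have h1 := (mvs_prefix environment (posAt_mono e E (show i ≤ i' by omega))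
      (σ.ext v)).length_le
    have h2 := (mvs_prefix machine (posAt_mono e E (show j ≤ i' by omega)) (τ.ext v')).length_le
    by_cases hlt : L + 1 ≤ (mvs machine (posAt e E i') (τ.ext v')).length
    · exact ⟨i', hlt⟩
    obtain ⟨x, y, hl, hx, hy⟩ := hN _ (le_max_left _ _) i' hm
    have hs := (hg i').snap hm
    obtain ⟨j', hj', hm', hmid⟩ := hs.finish hm
    have e1 := hits_pats (hl.symm.vLeaf hs.legal) (p := environment) (fun _ _ => hs.vnode) hx
    have e2 := hits_pats (hl.vLeaf hs.legal) (p := machine) (fun _ _ => hs.vnode) hy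
    have e3 := hits_pats (hl.vLeaf hs.legal) (p := machine) (fun _ _ => hmid.vnode) hy
    have hlen : (hits machine (posAt e E i') (pats (τ.place y))).length <
        (hits environment (posAt e E i') (pats (σ.place x))).length := by
      rw [e1, e2]; omega
    have hdone := hmid.done _ (mem_sync.2 (.inr (.inr (.inr (mem_pushTasks.2
      ⟨σ, x, τ, y, _, hl, List.getElem?_eq_getElem hlen, rfl⟩)))))
    refine ⟨j', ?_⟩
    dsimp only at hdone
    rw [e2, e3] at hdone
    omega

/-- The invariant `AllSync` makes the machine's copies late at every moment, and `catch_up`, used in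
both directions, makes them complete in the limit. -/
theorem Live.isDelay {σ τ : Slot} {v v' : ℕ → Bool} (h : Live e E σ v τ v')
    (hm : Mate σ v τ v') : IsDelay machine ((copycat.run e E).filterMap (lab σ.flip (σ.ext v)))
      ((copycat.run e E).filterMap (lab τ.flip (τ.ext v'))) := by
  have hσ : σ.flip = false := by cases hm <;> rfl
  have hτ : τ.flip = true := by cases hm <;> rfl
  have key : ∀ {σ τ : Slot} {v v' : ℕ → Bool}, Live e E σ v τ v' → Mated σ v τ v' →
      ∀ Φ ∈ (copycat.run e E).segs, ∃ Ψ ∈ (copycat.run e E).segs,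
        mvs environment Φ (σ.ext v) <+: mvs machine Ψ (τ.ext v') := by
    rintro σ τ v v' hl hm Φ ⟨i, hi⟩
    obtain ⟨j, hj⟩ := hl.catch_up hg _ i le_rfl
    have h1 := mvs_prefix environment (posAt_mono e E (le_max_left i j)) (σ.ext v)
    have h2 := mvs_prefix machine (posAt_mono e E (le_max_right i j)) (τ.ext v')
    refine ⟨_, posAt_mem e E (max i j), (mvs_prefix environment hi _).trans ?_⟩
    exact List.prefix_of_prefix_length_le h1
      ((hg _).sync _ List.prefix_rfl _ _ _ _ hm.symm) (hj.trans h2.length_le)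
  refine isDelay_of_copies (S := (copycat.run e E).segs) rfl rfl (copycat.run e E).closed
    (copycat.run e E).chain ?_ ?_ ?_
  · rintro Φ ⟨i, hi⟩
    have := (hg i).sync.copies (.inl hm) Φ hi
    rwa [hσ] at this ⊢
  · intro Φ hΦ
    obtain ⟨Ψ, hΨ, hp⟩ := key h.symm (.inr hm) Φ hΦ
    refine ⟨Ψ, hΨ, ?_⟩
    rw [mv_filterMap_lab, mv_filterMap_lab, hσ, hτ]
    exact hp
  · intro Φ hΦ
    obtain ⟨Ψ, hΨ, hp⟩ := key h (.inl hm) Φ hΦ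
    refine ⟨Ψ, hΨ, ?_⟩
    rw [mv_filterMap_lab, mv_filterMap_lab, hσ, hτ]
    exact hp

end

end CoL

namespace CoL

open Encodable

/-! ### Winners of legal runs -/

theorem Run.filterMap_congr {Γ : Run} {f g : LabMove → Option LabMove}
    (h : ∀ Φ ∈ Γ.segs, Φ.filterMap f = Φ.filterMap g) : Γ.filterMap f = Γ.filterMap g := by
  ext Φ
  constructor
  · rintro ⟨Ψ, hΨ, rfl⟩
    exact ⟨Ψ, hΨ, (h Ψ hΨ).symm⟩
  · rintro ⟨Ψ, hΨ, rfl⟩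
    exact ⟨Ψ, hΨ, h Ψ hΨ⟩

theorem Run.filterMap_lab (φ ψ : Bool) (g h : Move → Option Move) (Γ : Run) :
    (Γ.filterMap (lab φ g)).filterMap (lab ψ h) =
      Γ.filterMap (lab (xor ψ φ) fun m => (g m).bind h) := by
  ext Φ
  constructor
  · rintro ⟨_, ⟨Ψ, hΨ, rfl⟩, rfl⟩
    exact ⟨Ψ, hΨ, (CoL.filterMap_lab φ ψ g h Ψ).symm⟩
  · rintro ⟨Ψ, hΨ, rfl⟩
    exact ⟨_, ⟨Ψ, hΨ, rfl⟩, CoL.filterMap_lab φ ψ g h Ψ⟩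

theorem Run.filterMap_lab_strip (φ ψ : Bool) (p q : Move) (Γ : Run) :
    (Γ.filterMap (lab φ (strip p))).filterMap (lab ψ (strip q)) =
      Γ.filterMap (lab (xor ψ φ) (strip (p ++ q))) := by
  rw [Run.filterMap_lab]
  simp only [strip_bind]

theorem LegalRun.filterMap {L L' : Set Position} {Γ : Run} (h : LegalRun L Γ)
    {f : LabMove → Option LabMove} (hf : ∀ Φ ∈ L, Φ.filterMap f ∈ L') :
    LegalRun L' (Γ.filterMap f) := by
  rintro _ ⟨Φ, hΦ, rfl⟩
  exact hf Φ (h Φ hΦ)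

theorem stdWinner_eq_machine {L : Set Position} {W : Run → Prop} {Γ : Run} (h : LegalRun L Γ) :
    stdWinner L W Γ = machine ↔ W Γ := by
  unfold stdWinner
  rw [if_pos h]
  split_ifs with hW <;> simp [hW]

theorem or_winner {A B : ConstGame} {Γ : Run} (h : LegalRun (parLegal A B) Γ) :
    (A.or B).winner Γ = machine ↔
      A.winner (Γ.filterMap (lab false (strip [bitSym false, dot]))) = machine ∨
      B.winner (Γ.filterMap (lab false (strip [bitSym true, dot]))) = machine := by
  rw [← compLab_eq, ← compLab_eq]
  exact stdWinner_eq_machine (W := fun Γ =>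
    A.winner (Γ.filterMap (compLab false)) = machine ∨
      B.winner (Γ.filterMap (compLab true)) = machine) h

theorem and_winner {A B : ConstGame} {Γ : Run} (h : LegalRun (parLegal A B) Γ) :
    (A.and B).winner Γ = machine ↔
      A.winner (Γ.filterMap (lab false (strip [bitSym false, dot]))) = machine ∧
      B.winner (Γ.filterMap (lab false (strip [bitSym true, dot]))) = machine := by
  rw [← compLab_eq, ← compLab_eq]
  exact stdWinner_eq_machine (W := fun Γ =>
    A.winner (Γ.filterMap (compLab false)) = machine ∧
      B.winner (Γ.filterMap (compLab true)) = machine) h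

theorem cbr_winner {A : ConstGame} {Γ : Run} (h : LegalRun (branchLegal A) Γ) :
    A.cbr.winner Γ = machine ↔
      ∀ v, EssFinite v → A.winner (Γ.filterMap (lab false (threadMove v))) = machine := by
  simp only [← threadLab_eq]
  exact stdWinner_eq_machine (W := fun Γ =>
    ∀ v : ℕ → Bool, EssFinite v → A.winner (Γ.filterMap (threadLab v)) = machine) h

theorem neg_winner {A : ConstGame} {Γ : Run} :
    A.neg.winner Γ = machine ↔
      ¬ A.winner (Γ.filterMap (lab true (strip []))) = machine := by
  have e : Γ.neg = Γ.filterMap (lab true (strip [])) := by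
    unfold Run.neg
    congr 1
    funext x
    simp [lab, flipLab]
  have : A.neg.winner Γ = !(A.winner Γ.neg) := rfl
  rw [this, e]
  simp

section

variable {P Q R : ConstGame} {Γ : Run}

/-- The machine (or, for reversed slots, the environment) wins the letter played at the slot `σ` in
the thread `v`. -/
def Won (P Q R : ConstGame) (Γ : Run) (σ : Slot) (v : ℕ → Bool) : Prop :=
  (σ.game P Q R).winner (Γ.filterMap (lab σ.flip (σ.ext v))) = machine

theorem parLegal_run {A B : ConstGame} (h : LegalRun (parLegal A B) Γ) :
    LegalRun A.legal (Γ.filterMap (lab false (strip [bitSym false, dot]))) ∧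
      LegalRun B.legal (Γ.filterMap (lab false (strip [bitSym true, dot]))) :=
  ⟨h.filterMap fun _ h => (parLegal_iff.1 h).2.1, h.filterMap fun _ h => (parLegal_iff.1 h).2.2⟩

theorem negLegal_run {A : ConstGame} (h : LegalRun A.neg.legal Γ) :
    LegalRun A.legal (Γ.filterMap (lab true (strip []))) :=
  h.filterMap fun _ h => mem_neg_legal.1 h

theorem won_iff {σ : Slot} {v : ℕ → Bool} : Won P Q R Γ σ v ↔
    (σ.game P Q R).winner (((Γ.filterMap (lab σ.treeFlip (strip σ.pre))).filterMap
      (lab false (threadMove v))).filterMap (lab (xor σ.flip σ.treeFlip) (strip σ.suf))) =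
        machine := by
  have e : xor (xor (xor σ.flip σ.treeFlip) false) σ.treeFlip = σ.flip := by
    cases σ <;> rfl
  rw [Run.filterMap_lab, Run.filterMap_lab, e]
  unfold Won
  rw [Slot.ext_eq]

theorem produce_winner (h : LegalRun ((P.neg).or (P.and Q)).legal Γ)
    (hw : ((P.neg).or (P.and Q)).winner Γ = machine)
    (hP : P.winner (Γ.filterMap (lab true (strip [48, 46]))) = machine) :
    P.winner (Γ.filterMap (lab false (strip [49, 46, 48, 46]))) = machine ∧
      Q.winner (Γ.filterMap (lab false (strip [49, 46, 49, 46]))) = machine := by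
  rcases (or_winner h).1 hw with h1 | h1
  · rw [neg_winner, Run.filterMap_lab_strip] at h1
    exact absurd hP h1
  · have := (and_winner (parLegal_run h).2).1 h1
    simp only [Run.filterMap_lab_strip] at this
    exact this

theorem consume_winner (h : LegalRun (((R.or Q).neg).or R).legal Γ)
    (hw : (((R.or Q).neg).or R).winner Γ = machine)
    (hQ : R.winner (Γ.filterMap (lab true (strip [48, 46, 48, 46]))) = machine ∨
      Q.winner (Γ.filterMap (lab true (strip [48, 46, 49, 46]))) = machine) :
    R.winner (Γ.filterMap (lab false (strip [49, 46]))) = machine := by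
  rcases (or_winner h).1 hw with h1 | h1
  · rw [neg_winner, or_winner (negLegal_run (parLegal_run h).1)] at h1
    simp only [Run.filterMap_lab_strip] at h1
    exact absurd hQ h1
  · exact h1

/-- If the environment fails in the given P or in one of the two resources, the machine has won
already. Otherwise both implications hold in every essentially finite thread, and the goal has to be
won from them. -/
theorem production_winner (hl : LegalRun (production P Q R).legal Γ)
    (h : Won P Q R Γ .given zeroStr →
      (∀ v, EssFinite v → Won P Q R Γ .anteP v →
        Won P Q R Γ .consP v ∧ Won P Q R Γ .consQ v) →
      (∀ v, EssFinite v → (Won P Q R Γ .anteR v ∨ Won P Q R Γ .anteQ v) →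
        Won P Q R Γ .consR v) →
      ∀ v, EssFinite v → Won P Q R Γ .goal v) :
    (production P Q R).winner Γ = machine := by
  have hor : LegalRun (parLegal _ _) Γ := hl
  refine (or_winner hor).2 ?_
  obtain ⟨hl0, hl1⟩ := parLegal_run hor
  by_cases h0 : ((P.and (((P.neg).or (P.and Q)).cbr.and (((R.or Q).neg).or R).cbr)).neg).winner
      (Γ.filterMap (lab false (strip [bitSym false, dot]))) = machine
  · exact .inl h0
  right
  rw [neg_winner, not_not] at h0
  have hl0' := negLegal_run hl0
  obtain ⟨hg, h0⟩ := (and_winner hl0').1 h0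
  obtain ⟨-, hl2⟩ := parLegal_run hl0'
  obtain ⟨hp, hc⟩ := (and_winner hl2).1 h0
  obtain ⟨hlp, hlc⟩ := parLegal_run hl2
  replace hp := (cbr_winner hlp).1 hp
  replace hc := (cbr_winner hlc).1 hc
  have hlp' := fun v => LegalRun.filterMap hlp fun Φ h => branchLegal_thread h v
  have hlc' := fun v => LegalRun.filterMap hlc fun Φ h => branchLegal_thread h v
  rw [cbr_winner hl1]
  simp only [Run.filterMap_lab_strip] at hg hp hc hlp' hlc'
  have hid : ∀ Δ : Run, Δ.filterMap (lab false (strip [])) = Δ := by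
    intro Δ
    have e : lab false (strip []) = some := by funext x; simp [lab]
    ext Φ
    simp [Run.filterMap, e]
  intro v hv
  have := won_iff.1 (h ?_ ?_ ?_ v hv)
  · rw [show xor Slot.goal.flip Slot.goal.treeFlip = false from rfl,
      show Slot.goal.suf = [] from rfl, hid] at this
    exact this
  · have e := Run.filterMap_congr (Γ := Γ) fun Φ hΦ =>
      Slot.ext_given_of_legal (hl Φ hΦ) zeroStr true
    unfold Won
    rw [show Slot.given.flip = true from rfl, e]
    exact hg
  · intro v hv ha
    simp only [won_iff] at ha ⊢
    exact produce_winner (hlp' v) (hp v hv) ha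
  · intro v hv ha
    simp only [won_iff] at ha ⊢
    exact consume_winner (hlc' v) (hc v hv) ha

end

/-! ### Essentially finite threads -/

theorem cat_add (w : List Bool) (v : ℕ → Bool) (i : ℕ) : cat w v (i + w.length) = v i := by
  induction w generalizing i with
  | nil => rfl
  | cons b w ih => exact ih i

theorem essFinite_iff {v : ℕ → Bool} : EssFinite v ↔ ∃ N, ∀ i ≥ N, v i = false := by
  constructor
  · intro h
    obtain ⟨N, hN⟩ := h.bddAbove
    refine ⟨N + 1, fun i hi => ?_⟩
    by_contra hv
    have := hN (show i ∈ {i | v i = true} by simpa using hv)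
    omega
  · rintro ⟨N, hN⟩
    refine (Set.finite_lt_nat N).subset fun i hi => ?_
    by_contra hv
    have := hN i (by simpa using hv)
    simp_all

theorem EssFinite.cat {v : ℕ → Bool} (h : EssFinite v) (w : List Bool) : EssFinite (cat w v) := by
  rw [essFinite_iff] at h ⊢
  obtain ⟨N, hN⟩ := h
  refine ⟨N + w.length, fun i hi => ?_⟩
  obtain ⟨j, rfl⟩ := Nat.exists_eq_add_of_le' (show w.length ≤ i by omega)
  rw [cat_add]
  exact hN j (by omega)

theorem essFinite_zeroStr : EssFinite zeroStr := essFinite_iff.2 ⟨0, fun _ _ => rfl⟩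

/-- The string is cut after its first 1. -/
theorem exists_eq_cat_comb {v : ℕ → Bool} (h : v ≠ zeroStr) : ∃ k v', v = cat (comb k) v' := by
  have hex : ∃ i, v i = true := by
    by_contra hn
    push Not at hn
    exact h (funext fun i => by simpa [zeroStr] using hn i)
  refine ⟨Nat.find hex, InitSeg.exists_cat ?_⟩
  intro i hi
  have hi' := hi
  rw [length_comb] at hi'
  simp only [comb, zeros_eq_replicate, List.getElem_append, List.length_replicate,
    List.getElem_replicate, List.getElem_singleton]
  split_ifs with hlt
  · simpa using Nat.find_min hex hlt
  · rw [show i = Nat.find hex by omega, Nat.find_spec hex]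

theorem InitSeg.eq_zeros {u : List Bool} (h : InitSeg u zeroStr) : u = zeros u.length := by
  rw [zeros_eq_replicate, List.eq_replicate_iff]
  refine ⟨rfl, fun b hb => ?_⟩
  obtain ⟨i, hi, rfl⟩ := List.getElem_of_mem hb
  exact h i hi

/-- Follow the thread `s`, `v` until it meets a node that is not replicated; this is a leaf, and it
cannot lie strictly above the actual node `s`. -/
theorem exists_goalLeaf {P Q R : ConstGame} {S : Position} (hS : S ∈ (production P Q R).legal)
    {s : List Bool} (hs : Slot.goal.Node S s) (v : ℕ → Bool) :
    ∃ u, GoalLeaf S (s ++ u) ∧ InitSeg u v := by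
  classical
  have hinit : ∀ n, InitSeg ((List.range n).map (cat s v)) (cat s v) := by
    intro n i hi
    simp
  have hex : ∃ n, ¬ Slot.goal.Rep S ((List.range n).map (cat s v)) := by
    -- No address in the position is as long as all its moves together plus one, so a string of this
    -- length is not replicated.
    refine ⟨(S.map fun x => x.2.length).sum + 1, ?_⟩
    rintro ⟨p, hp⟩
    have := List.le_sum_of_mem (List.mem_map_of_mem (f := fun x : LabMove => x.2.length) hp)
    simp [bits] at this
    omega
  have hleaf : GoalLeaf S ((List.range (Nat.find hex)).map (cat s v)) := by
    refine ⟨?_, Nat.find_spec hex⟩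
    cases hn : Nat.find hex with
    | zero => exact .inl rfl
    | succ n =>
      have := Nat.find_min hex (m := n) (by omega)
      rw [not_not] at this
      exact .inr ⟨_, _, by rw [List.range_succ, List.map_append]; rfl, this⟩
  rcases (initSeg_cat s v).total (hinit (Nat.find hex)) with ⟨u, hu⟩ | ⟨t, ht⟩
  · rw [← hu] at hleaf
    refine ⟨u, hleaf, initSeg_cat_append.1 (hu ▸ hinit _)⟩
  · rw [← ht] at hs
    have h0 := hleaf.eq_nil hS hs
    rw [h0, List.append_nil] at ht
    exact ⟨[], by rw [List.append_nil, ← ht]; exact hleaf, initSeg_nil v⟩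

/-! ### Threads that are linked forever, and the induction over their ones -/

section

variable {P Q R : ConstGame} {e : Valuation} {E : EnvBehavior}

theorem Good.repsFrom {i : ℕ} (h : Good P Q R e E i) : RepsFrom (posAt e E i) (posAt e E i) := by
  rcases h.state with ⟨-, hs⟩ | ⟨k, S, d, -, hm⟩
  · exact hs.reps
  · have := hm.repsFrom h.legal
    exact ⟨this.left, fun x hx => (this.right x hx).imp id fun ⟨s, u, hu, hr⟩ =>
      ⟨s, u, hu, hr.mono hm.start.subset⟩⟩

theorem live_given (v v' : ℕ → Bool) : Live e E .anteP (cat (comb 0) v) .given v' :=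
  ⟨0, fun _ _ _ _ => ⟨_, _, .inl .given, initSeg_cat _ _, initSeg_nil _⟩⟩

theorem live_produce (n : ℕ) (v : ℕ → Bool) :
    Live e E .anteP (cat (comb (n + 1)) v) .consP (cat (comb n) v) :=
  ⟨n + 1, fun _ hn _ _ => ⟨_, _, .inl (.produce n hn), initSeg_cat _ _, initSeg_cat _ _⟩⟩

variable (hg : ∀ i, Good P Q R e E i)

include hg

theorem live_goal (v : ℕ → Bool) :
    Live e E .goal v .consR (cat (comb (encode ([] : List Bool))) v) := by
  refine ⟨0, fun n _ i _ => ?_⟩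
  obtain ⟨w, hw, hv⟩ := exists_goalLeaf (hg i).legal (s := []) (.inl rfl) v
  exact ⟨_, _, .inl (.goal w hw), hv, initSeg_comb_append.2 ⟨rfl, hv⟩⟩

theorem live_supply {s : List Bool} {i : ℕ} (hs : Slot.goal.Node (posAt e E i) s)
    (v : ℕ → Bool) : Live e E .anteQ (cat (comb (encode s)) zeroStr) .consQ
      (cat (comb (encode s)) v) := by
  -- Round n does not begin before cycle n, so from round i on the node `s` is actual; `encode s ≤
  -- n` makes sure that its copies are in use.
  refine ⟨max i (encode s), fun n hn j hj => ?_⟩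
  have hnj := fst_memAt_le (e := e) (E := E) j
  rw [hj] at hnj
  obtain ⟨u, hu, hv⟩ := exists_goalLeaf (hg j).legal
    (hs.mono (posAt_mono e E (show i ≤ j by dsimp only at hnj; omega)).subset) zeroStr
  rw [hv.eq_zeros] at hu
  exact ⟨_, _, .inl (.supply s _ hu (by omega)), initSeg_comb_append.2 ⟨rfl, initSeg_zeros _⟩,
    initSeg_cat _ _⟩

theorem live_chain {s : List Bool} {k i : ℕ} (h1 : OneEnded s)
    (hs : Slot.goal.Node (posAt e E i) (s ++ comb k)) (v : ℕ → Bool) :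
    Live e E .anteR (cat (comb (encode s)) (cat (comb k) v)) .consR
      (cat (comb (encode (s ++ comb k))) v) := by
  refine ⟨max i (max (encode s) (encode (s ++ comb k))), fun n hn j hj => ?_⟩
  have hnj := fst_memAt_le (e := e) (E := E) j
  rw [hj] at hnj
  obtain ⟨u, hu, hv⟩ := exists_goalLeaf (hg j).legal
    (hs.mono (posAt_mono e E (show i ≤ j by dsimp only at hnj; omega)).subset) v
  rw [List.append_assoc] at hu
  exact ⟨_, _, .inl (.chain s k u h1 hu (by omega) (by omega)),
    initSeg_comb_append.2 ⟨rfl, initSeg_comb_append.2 ⟨rfl, hv⟩⟩,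
    initSeg_comb_append.2 ⟨rfl, hv⟩⟩

/-- In a `Mate` the first slot is the one where the machine has to win the letter and the second the
one where it is supplied; the first play is a ⊤-delay of the second. -/
theorem Won.of_mate (hP : P.Static) (hQ : Q.Static) (hR : R.Static) {σ τ : Slot}
    {v v' : ℕ → Bool} (hm : Mate σ v τ v') (hl : Live e E σ v τ v')
    (h : Won P Q R (copycat.run e E) τ v') : Won P Q R (copycat.run e E) σ v := by
  have hst : (σ.game P Q R).Static := by cases σ <;> assumption
  refine hst machine _ _ (hl.isDelay hg hm) ?_
  rw [← (show Mated σ v τ v' from .inl hm).game]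
  exact h

/-- If a node of the goal never becomes actual, then the threads of a copy that branch off at this
node are not distinguished. -/
theorem ext_eq_zeroStr {s : List Bool} {k : ℕ}
    (hs : ∀ i, ¬ Slot.goal.Node (posAt e E i) (s ++ comb k)) (v : ℕ → Bool) :
    Won P Q R (copycat.run e E) .consR (cat (comb (encode s)) (cat (comb k) v)) ↔
      Won P Q R (copycat.run e E) .consR (cat (comb (encode s)) zeroStr) := by
  have key : ∀ i t, Slot.goal.Node (posAt e E i) (s ++ t) →
      (InitSeg t (cat (comb k) v) ↔ InitSeg t zeroStr) := by
    intro i t ht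
    constructor
    · intro h
      rcases h.total (initSeg_cat (comb k) v) with hp | ⟨r, rfl⟩
      · rcases List.prefix_concat_iff.1 (show t <+: zeros k ++ [true] from hp) with rfl | hp
        · exact absurd ht (hs i)
        · exact (initSeg_zeros k).of_prefix hp
      · rw [← List.append_assoc] at ht
        exact absurd (ht.of_append (hg i).legal) (hs i)
    · intro h
      have ht' := h.eq_zeros
      rcases le_or_gt t.length k with hle | hlt
      · obtain ⟨j, hj⟩ := Nat.exists_eq_add_of_le hle
        refine (initSeg_cat (comb k) v).of_prefix ?_
        rw [ht', comb, hj, zeros_add, List.append_assoc]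
        exact List.prefix_append _ _
      -- A goal node `s` followed by more than k zeros would require that `s ++ zeros k` has been
      -- replicated, which would also make its other child `s ++ comb k` actual.
      · obtain ⟨j, hj⟩ := Nat.exists_eq_add_of_lt hlt
        rw [ht', hj, add_assoc, zeros_add, ← List.append_assoc] at ht
        exact absurd (.inr ⟨_, true, by simp [comb],
          ht.replicated (hg i).legal (by simp)⟩) (hs i)
  -- An actual node of the resource on either thread lies on the way to the root of the copy, where
  -- the threads agree, or below it, where it mirrors a goal node below `s`.
  have key' : ∀ i u, Slot.consR.Node (posAt e E i) u →
      (InitSeg u (cat (comb (encode s)) (cat (comb k) v)) ↔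
        InitSeg u (cat (comb (encode s)) zeroStr)) := by
    intro i u hu
    have hv := (hg i).repsFrom.vnode (hg i).legal (by simp) hu
    have main : ∀ t, u = comb (encode s) ++ t →
        (InitSeg u (cat (comb (encode s)) (cat (comb k) v)) ↔
          InitSeg u (cat (comb (encode s)) zeroStr)) := by
      rintro t rfl
      rw [initSeg_cat_append, initSeg_cat_append]
      rcases hv with ⟨j, hj⟩ | ⟨s', t', he, hn⟩
      · rw [comb_append_eq_nil_of hj]
        simp [initSeg_nil]
      · obtain ⟨h1, rfl⟩ := comb_append_inj he
        obtain rfl := encode_injective h1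
        exact key i t hn
    have half : ∀ w w', InitSeg u (cat (comb (encode s)) w) →
        u <+: comb (encode s) ∧ InitSeg u (cat (comb (encode s)) w') ∨
          ∃ t, u = comb (encode s) ++ t := by
      intro w w' h
      rcases h.total (initSeg_cat (comb (encode s)) w) with hp | ⟨t, rfl⟩
      · exact .inl ⟨hp, (initSeg_cat _ w').of_prefix hp⟩
      · exact .inr ⟨t, rfl⟩
    constructor
    · intro h
      rcases half _ zeroStr h with h' | ⟨t, ht⟩
      · exact h'.2
      · exact (main t ht).1 h
    · intro h
      rcases half _ (cat (comb k) v) h with h' | ⟨t, ht⟩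
      · exact h'.2
      · exact (main t ht).2 h
  unfold Won
  rw [Run.filterMap_congr]
  rintro Φ ⟨i, hi⟩
  refine List.filterMap_congr fun x hx => ?_
  unfold lab
  congr 1
  ext β
  rw [Slot.ext_eq_some, Slot.ext_eq_some]
  refine exists_congr fun u => and_congr_left fun hm => ?_
  obtain ⟨p, m⟩ := x
  dsimp only at hm
  subst hm
  exact key' i u (Slot.dot_node (hg i).legal (hi.subset hx))

/-- First all antecedents P are won by induction on the number of the copy, so every left copy
delivers its Q. Then the consequent R of each right copy whose goal node becomes actual is won by
induction on a bound for the positions of the ones in its thread. -/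
theorem won_goal (hP : P.Static) (hQ : Q.Static) (hR : R.Static)
    (h0 : Won P Q R (copycat.run e E) .given zeroStr)
    (hp : ∀ v, EssFinite v → Won P Q R (copycat.run e E) .anteP v →
      Won P Q R (copycat.run e E) .consP v ∧ Won P Q R (copycat.run e E) .consQ v)
    (hc : ∀ v, EssFinite v → (Won P Q R (copycat.run e E) .anteR v ∨
      Won P Q R (copycat.run e E) .anteQ v) → Won P Q R (copycat.run e E) .consR v)
    (v : ℕ → Bool) (hv : EssFinite v) : Won P Q R (copycat.run e E) .goal v := by
  have hante : ∀ n, Won P Q R (copycat.run e E) .anteP (cat (comb n) zeroStr) := by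
    intro n
    induction n with
    | zero => exact .of_mate hg hP hQ hR (.given _ _) (live_given _ _) h0
    | succ n ih =>
      exact .of_mate hg hP hQ hR (.produce n _) (live_produce n _)
        (hp _ (essFinite_zeroStr.cat _) ih).1
  have hcons : ∀ N s v, OneEnded s → (∃ i, Slot.goal.Node (posAt e E i) s) →
      (∀ i ≥ N, v i = false) →
      Won P Q R (copycat.run e E) .consR (cat (comb (encode s)) v) := by
    intro N
    induction N using Nat.strong_induction_on with
    | _ N ih =>
      rintro s v h1 ⟨i, hi⟩ hN
      -- The all-zero thread needs no further copy: its antecedent is won through Q.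
      have hz : Won P Q R (copycat.run e E) .consR (cat (comb (encode s)) zeroStr) :=
        hc _ (essFinite_zeroStr.cat _) (.inr (.of_mate hg hP hQ hR (.supply _ zeroStr)
          (live_supply hg hi _) (hp _ (essFinite_zeroStr.cat _) (hante _)).2))
      by_cases hv : v = zeroStr
      · rwa [hv]
      obtain ⟨k, v, rfl⟩ := exists_eq_cat_comb hv
      by_cases hk : ∃ i, Slot.goal.Node (posAt e E i) (s ++ comb k)
      · obtain ⟨j, hj⟩ := hk
        have hshift : ∀ i, cat (comb k) v (i + (k + 1)) = v i := by
          intro i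
          have := cat_add (comb k) v i
          rwa [length_comb] at this
        have hkN : k < N := by
          by_contra hle
          have h2 := hN k (by omega)
          have h3 := initSeg_cat (comb k) v k (by simp)
          rw [h2] at h3
          simp [comb] at h3
        -- After the first 1, at position k, the rest of the thread is continued in the copy for `s
        -- ++ comb k`; its ones lie below N − (k+1).
        refine hc _ ((essFinite_iff.2 ⟨N, hN⟩).cat _) (.inl (.of_mate hg hP hQ hR
          (.chain s k v h1) (live_chain hg h1 hj v) (ih (N - (k + 1)) (by omega) _ v
            (oneEnded_comb s k) ⟨j, hj⟩ fun i hi => ?_)))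
        rw [← hshift]
        exact hN _ (by omega)
      · push Not at hk
        exact (ext_eq_zeroStr hg hk v).2 hz
  obtain ⟨N, hN⟩ := essFinite_iff.1 hv
  exact .of_mate hg hP hQ hR (.goal v) (live_goal hg v)
    (hcons N [] v oneEnded_nil ⟨0, .inl rfl⟩ hN)

end

theorem copycat_wins {P Q R : ConstGame} (hP : P.Static) (hQ : Q.Static) (hR : R.Static)
    (e : Valuation) (E : EnvBehavior) :
    (production P Q R).winner (copycat.run e E) = machine := by
  by_cases hill : IllegalBy (production P Q R).legal environment (copycat.run e E)
  · have := (production P Q R).winner_illegal _ _ hill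
    simpa using this
  · have hg : ∀ i, Good P Q R e E i := fun i => (good_or_illegal hP hQ hR i).resolve_left hill
    refine production_winner ?_ fun h0 hp hc v hv => won_goal hg hP hQ hR h0 hp hc v hv
    rintro Φ ⟨i, hi⟩
    exact (production P Q R).closed _ (hg i).legal _ hi

end CoL

theorem mainTheorem4 (p q r : ℕ) :
    CoL.UniformlyValid (CoL.longProduction (.letter p) (.letter q) (.letter r)) :=
  ⟨CoL.copycat, fun I e E =>
    CoL.copycat_wins (I.static p e) (I.static q e) (I.static r e) e E⟩
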